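/- Let $\mathbf{1}_{\mathbf E}$ be the indicator function of the set $\mathbf E=\{a^2+b^2 : a,b\in\mathbb Z\}$ and let $\chi_4$ be the non-trivial Dirichlet character modulo $4$. For $f(s)=\zeta(s)(s-1)$ (with value $1$ at $s=1$) and for $f(s)=L(s,\chi_4)$, let $\Omega_f$ be the set of $s$ with $\operatorname{Re}(s)>1/2$ such that $f(s+t)\neq 0$ for all real $t\ge 0$; then $\Omega_f$ contains the real half-line $(1/2,\infty)$, and there is an analytic function $f^{1/2}$ on $\Omega_f$ with $(f^{1/2})^2=f$ that is positive on that half-line. Put $$G(s) = (\zeta(s)(s-1))^{1/2}\, L(s, \chi_4)^{1/2}\, (1-2^{-s})^{-1/2} \prod_{p \equiv 3 \bmod 4} \left( 1 - p^{-2s} \right)^{-1/2},$$ with these square roots in the first two factors and principal powers in the others. Then $G$ is analytic on $\Omega_{\zeta(s)(s-1)}\cap\Omega_{L(s,\chi_4)}$, and for every $0<\varepsilon<1/2$ there exists a constant $c>0$ such that, as $x\to\infty$, $$\sum_{1\le n \leq x} \mathbf{1}_{\mathbf{E}}(n) = \frac{1}{\pi} \int_{1/2+\varepsilon}^1 G(\sigma)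 \frac{x^\sigma}{\sigma |\sigma -1|^{1/2}} \, d \sigma + O_\varepsilon\left( x \exp\left( - c \sqrt{\log{x}} \right)\right).$$ If the Riemann Hypothesis holds for $\zeta(s)$ and for $L(s, \chi_4)$, then $G$ is analytic on the whole half-plane $\operatorname{Re}(s)>1/2$, and for every $0<\varepsilon<1/2$ the error term above can be replaced by $O_\varepsilon(x^{1/2+\varepsilon})$. -/

import Mathlib

open Filter Asymptotics

namespace TwoSquares

/-- The set `E` of sums of two squares. -/
def sumsOfTwoSquares : Set ℕ :=
  {n : ℕ | ∃ a b : ℤ, (n : ℤ) = a ^ 2 + b ^ 2}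

/-- The counting function `∑_{1 ≤ n ≤ x} 1_E(n)`. -/
noncomputable def countTwoSquares (x : ℝ) : ℝ :=
  ∑ n ∈ Finset.Icc 1 ⌊x⌋₊, sumsOfTwoSquares.indicator (fun _ => (1 : ℝ)) n

/-- The non-trivial Dirichlet character modulo 4, with complex values. -/
noncomputable def chi4 : DirichletCharacter ℂ 4 :=
  ZMod.χ₄.ringHomComp (Int.castRingHom ℂ)

/-- The entire function `ζ(s) (s - 1)`, with its limit value `1` at `s = 1`. -/
noncomputable def zetaReg : ℂ → ℂ :=
  Function.update (fun s => riemannZeta s * (s - 1)) 1 1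

/-- The Riemann Hypothesis for `L(s, χ₄)`: every zero in the critical strip is on the
critical line. -/
def RiemannHypothesisChi4 : Prop :=
  ∀ s : ℂ, chi4.LFunction s = 0 → 0 < s.re → s.re < 1 → s.re = 1 / 2

/-- The half-plane `Re s > 1/2`, cut to the left along the horizontal ray that starts at each
zero of `f`. It is the whole half-plane when `f` has no zero there. -/
def cutHalfPlane (f : ℂ → ℂ) : Set ℂ :=
  {s : ℂ | 1 / 2 < s.re ∧ ∀ t : ℝ, 0 ≤ t → f (s + t) ≠ 0}

/-- `h` is the function `f ^ (1/2)`: the analytic branch of the square root of `f` on the cut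
half-plane which is positive on the real axis. -/
structure IsSqrtBranch (f h : ℂ → ℂ) : Prop where
  analytic : AnalyticOnNhd ℂ h (cutHalfPlane f)
  sq_eq : ∀ s ∈ cutHalfPlane f, h s ^ 2 = f s
  pos : ∀ σ : ℝ, 1 / 2 < σ → (σ : ℂ) ∈ cutHalfPlane f ∧ 0 < (h σ).re ∧ (h σ).im = 0

/-- `G(s) = (ζ(s)(s-1))^{1/2} L(s, χ₄)^{1/2} (1 - 2^{-s})^{-1/2} ∏_{p ≡ 3 (4)} (1 - p^{-2s})^{-1/2}`,
where `A` and `B` stand for the first two factors. In the other factors the bases have positive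
real part for `Re s > 1/2`, so that the principal powers are the analytic ones. -/
noncomputable def G (A B : ℂ → ℂ) (s : ℂ) : ℂ :=
  A s * B s * (1 - (2 : ℂ) ^ (-s)) ^ (-(1 / 2) : ℂ) *
    ∏' p : {p : ℕ // p.Prime ∧ p % 4 = 3}, (1 - ((p : ℕ) : ℂ) ^ (-2 * s)) ^ (-(1 / 2) : ℂ)

/-- The main term `(1/π) ∫_{1/2+ε}^1 g(σ) x^σ / (σ |σ - 1|^{1/2}) dσ`. -/
noncomputable def mainTerm (g : ℂ → ℂ) (ε x : ℝ) : ℂ :=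
  (1 / (Real.pi : ℂ)) *
    ∫ σ in (1 / 2 + ε)..1, g (σ : ℂ) * ((x ^ σ / (σ * |σ - 1| ^ (1 / 2 : ℝ)) : ℝ) : ℂ)

end TwoSquares

/-!
The Dirichlet series `F(s) = ∑ 1_E(n) n^{-s}` satisfies
`F² = ζ L(·, χ₄) (1 - 2^{-s})^{-1} ∏_{p ≡ 3} (1 - p^{-2s})^{-1}` by comparison of Euler factors
(`twoSquaresSeries_sq`), so that `F(s) = G(s) (s - 1)^{-1/2}` for `Re s > 1`, the sign being decided
at `s = 2` (`twoSquaresSeries_eq`). The square roots in `G` exist because the cut half-planes are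
simply connected (`exists_isSqrtBranch`).

The counting function is compared with a difference quotient over `[x, x + h]` of the Riesz mean
`∑_{n ≤ x} 1_E(n) (x - n)`, for which Perron's formula converges absolutely
(`integral_series_mul_kernel`, `abs_riesz_quotient_sub_le`). Moving the line of integration to
`Re s = σ₀ < 1` leaves the integral over `[σ₀, 1]` of the jump of `(s - 1)^{-1/2}` across its cut
(`integral_vertical_shift`), which is the main term of the theorem. The outcome is
`exists_norm_count_sub_le`: the error is governed by `h`, by the height `T` of the contour and by
the integral of `|G(s)| |s - 1|^{-1/2} / |s|` over `Re s = σ₀`, `|Im s| ≤ T`.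

* Unconditionally, `σ₀ = 1 - c / log T` is admissible by the zero-free region of `ζ(s) L(s, χ₄)`
  (`exists_zero_free_region`, from Landau's lemma and `3 + 4 cos θ + cos 2θ ≥ 0`). Trivial bounds
  for `G` and `T = exp (a √(log x))` then suffice.
* Under the Riemann hypotheses `σ₀ = 1/2 + ε/2` is admissible with `T` a power of `x`. Since
  `|G(s)|² / |s - 1|` is bounded by `|ζ(s) L(s, χ₄)|`, the integral over `Re s = σ₀` is controlled
  by the second moments of `ζ` and `L`, which are `O(T)`
  (`IsRemainder.exists_second_moment_le`): `ζ(s) / s` and `L(s, χ₄) / s` are Mellin transforms of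
  bounded remainder terms, multiplication by `e^{s / (4T)} - 1` takes the increment of these over a
  multiplicative shift, and the mean square of that increment is `O(1 / T)`.
-/

namespace TwoSquares

open MeasureTheory Set Complex
open scoped Topology

/-! ### Dirichlet integrals of remainder terms and continuation to `Re s > 0` -/

/-- The Dirichlet integral `∫_1^∞ R(u) u^{-s-1} du` of a remainder term `R`. -/
noncomputable def tailIntegral (R : ℝ → ℝ) (s : ℂ) : ℂ :=
  ∫ u in Ioi (1 : ℝ), (R u : ℂ) * (u : ℂ) ^ (-(s + 1))

section tail
variable {R : ℝ → ℝ}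

lemma norm_mul_cpow_le (hb : ∀ u, 1 ≤ u → |R u| ≤ 1) (s : ℂ) {u : ℝ} (hu : 1 < u) :
    ‖(R u : ℂ) * (u : ℂ) ^ (-(s + 1))‖ ≤ u ^ (-(s.re + 1)) := by
  rw [norm_mul, norm_real, Real.norm_eq_abs, norm_cpow_eq_rpow_re_of_pos (by linarith)]
  have := hb u hu.le
  have h2 : 0 ≤ u ^ (-(s.re + 1)) := by positivity
  simp only [neg_re, add_re, one_re]
  nlinarith

lemma integrableOn_tail (hm : Measurable R) (hb : ∀ u, 1 ≤ u → |R u| ≤ 1) {s : ℂ}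
    (hs : 0 < s.re) :
    IntegrableOn (fun u : ℝ => (R u : ℂ) * (u : ℂ) ^ (-(s + 1))) (Ioi 1) := by
  refine Integrable.mono' (integrableOn_Ioi_rpow_of_lt (a := -(s.re + 1)) (by linarith) one_pos)
    ?_ ?_
  · refine AEStronglyMeasurable.mul (by fun_prop) ?_
    refine ContinuousOn.aestronglyMeasurable (fun u hu => ?_) measurableSet_Ioi
    exact (continuousAt_ofReal_cpow_const _ _ (Or.inr (by simp at hu; linarith))).continuousWithinAt
  · exact (ae_restrict_mem measurableSet_Ioi).mono fun u hu => norm_mul_cpow_le hb s hu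

lemma norm_tailIntegral_le (hb : ∀ u, 1 ≤ u → |R u| ≤ 1) {s : ℂ} (hs : 0 < s.re) :
    ‖tailIntegral R s‖ ≤ 1 / s.re := by
  have h1 : ∫ u in Ioi (1 : ℝ), u ^ (-(s.re + 1)) = 1 / s.re := by
    rw [integral_Ioi_rpow_of_lt (by linarith) one_pos]
    simp
  rw [← h1]
  refine norm_integral_le_of_norm_le (integrableOn_Ioi_rpow_of_lt (by linarith) one_pos) ?_
  exact (ae_restrict_mem measurableSet_Ioi).mono fun u hu => norm_mul_cpow_le hb s hu

lemma differentiableAt_tailIntegral (hm : Measurable R) (hb : ∀ u, 1 ≤ u → |R u| ≤ 1) {s : ℂ}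
    (hs : 0 < s.re) : DifferentiableAt ℂ (tailIntegral R) s := by
  let f : ℝ → ℂ := (Ioi (1 : ℝ)).indicator fun u => (R u : ℂ)
  have hfb : ∀ u, ‖f u‖ ≤ 1 := fun u => by
    by_cases hu : u ∈ Ioi (1 : ℝ)
    · simp only [f, indicator_of_mem hu, norm_real]; exact hb u (le_of_lt hu)
    · simp only [f, indicator_of_notMem hu, norm_zero]; exact zero_le_one
  have hfm : Measurable f := by
    exact (measurable_ofReal.comp hm).indicator measurableSet_Ioi
  have heq : tailIntegral R = fun s => mellin f (-s) := by
    funext s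
    have : ∀ u : ℝ, (u : ℂ) ^ (-s - 1) • f u
        = (Ioi (1 : ℝ)).indicator (fun u : ℝ => (R u : ℂ) * (u : ℂ) ^ (-(s + 1))) u := fun u => by
      by_cases hu : u ∈ Ioi (1 : ℝ)
      · simp only [f, indicator_of_mem hu, smul_eq_mul]
        rw [mul_comm]; congr 2; ring
      · simp only [f, indicator_of_notMem hu, smul_zero]
    simp only [mellin, this]
    rw [setIntegral_indicator measurableSet_Ioi, tailIntegral]
    congr 2
    rw [Ioi_inter_Ioi]; simp
  rw [heq]
  have key : DifferentiableAt ℂ (mellin f) (-s) := by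
    refine mellin_differentiableAt_of_isBigO_rpow (a := 0) (b := -s.re - 1) ?_ ?_ (by simpa) ?_
      (by simp)
    · exact (locallyIntegrable_const (1 : ℝ)).mono hfm.aestronglyMeasurable
        (ae_of_all _ fun u => by simpa using hfb u) |>.locallyIntegrableOn _
    · simp only [neg_zero, Real.rpow_zero]
      exact isBigO_of_le _ fun u => by simpa using hfb u
    · refine EventuallyEq.trans_isBigO (f₂ := fun _ => (0 : ℂ)) ?_ (isBigO_zero _ _)
      have : Iio (1 : ℝ) ∈ 𝓝[>] (0 : ℝ) := nhdsWithin_le_nhds (Iio_mem_nhds one_pos)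
      filter_upwards [this] with u hu
      exact indicator_of_notMem (by simpa using le_of_lt hu) _
  exact key.comp s differentiableAt_id.neg
end tail

/-- The remainder `⌊u⌋ - u` in counting the positive integers up to `u`. -/
noncomputable def floorRemainder (u : ℝ) : ℝ := ⌊u⌋₊ - u

/-- The summatory function of `χ₄`. -/
noncomputable def chiSum (u : ℝ) : ℝ := ∑ k ∈ Finset.Icc 1 ⌊u⌋₊, (ZMod.χ₄ (k : ZMod 4) : ℝ)

lemma measurable_floorRemainder : Measurable floorRemainder := by
  unfold floorRemainder; fun_prop

lemma measurable_chiSum : Measurable chiSum := by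
  have : Measurable fun n : ℕ => ∑ k ∈ Finset.Icc 1 n, (ZMod.χ₄ (k : ZMod 4) : ℝ) :=
    measurable_from_nat
  exact this.comp Nat.measurable_floor

lemma abs_floorRemainder_le {u : ℝ} (hu : 0 ≤ u) : |floorRemainder u| ≤ 1 := by
  unfold floorRemainder
  have := Nat.floor_le hu
  have := Nat.lt_floor_add_one u
  rw [abs_le]; constructor <;> linarith

lemma sum_chi4_eq (n : ℕ) :
    ∑ k ∈ Finset.Icc 1 n, ZMod.χ₄ (k : ZMod 4) = if n % 4 = 1 ∨ n % 4 = 2 then 1 else 0 := by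
  induction n with
  | zero => simp
  | succ n ih =>
    rw [Finset.sum_Icc_succ_top (by omega), ih, ZMod.χ₄_nat_eq_if_mod_four]
    split_ifs <;> omega

lemma chiSum_eq (u : ℝ) :
    chiSum u = if ⌊u⌋₊ % 4 = 1 ∨ ⌊u⌋₊ % 4 = 2 then 1 else 0 := by
  have := sum_chi4_eq ⌊u⌋₊
  unfold chiSum
  rw [← Int.cast_sum, this]
  split_ifs <;> simp

lemma chiSum_nonneg (u : ℝ) : 0 ≤ chiSum u := by
  rw [chiSum_eq]; split_ifs <;> norm_num

lemma abs_chiSum_le (u : ℝ) : |chiSum u| ≤ 1 := by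
  rw [chiSum_eq]; split_ifs <;> norm_num

lemma riemannZeta_eq_tail {s : ℂ} (hs : 1 < s.re) :
    riemannZeta s = s / (s - 1) + s * tailIntegral floorRemainder s := by
  have h1 := LSeries_eq_mul_integral' 1 (r := 1) zero_le_one hs
    (by simpa using isBigO_refl _ _)
  rw [LSeries_one_eq_riemannZeta hs] at h1
  have hint : IntegrableOn (fun u : ℝ => (u : ℂ) ^ (-s)) (Ioi 1) :=
    integrableOn_Ioi_cpow_of_lt (by simpa) one_pos
  have h2 : ∫ u in Ioi (1 : ℝ), (u : ℂ) ^ (-s) = 1 / (s - 1) := by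
    rw [integral_Ioi_cpow_of_lt (by simpa) one_pos]
    have h3 : s - 1 ≠ 0 := fun h => by
      rw [sub_eq_zero] at h; rw [h] at hs; simp at hs
    have h4 : -s + 1 ≠ 0 := fun h => h3 (by linear_combination -h)
    simp only [ofReal_one, one_cpow]
    field_simp
    ring
  have h3 : ∫ t in Ioi (1 : ℝ), (∑ k ∈ Finset.Icc 1 ⌊t⌋₊, (1 : ℕ → ℂ) k) * (t : ℂ) ^ (-(s + 1))
      = 1 / (s - 1) + tailIntegral floorRemainder s := by
    rw [← h2, tailIntegral, ← integral_add hint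
      (integrableOn_tail measurable_floorRemainder
        (fun u hu => abs_floorRemainder_le (by linarith)) (by linarith))]
    refine setIntegral_congr_fun measurableSet_Ioi fun u hu => ?_
    have hu0 : (u : ℂ) ≠ 0 := ofReal_ne_zero.2 (by simp at hu; linarith)
    have : (u : ℂ) ^ (-s) = u * (u : ℂ) ^ (-(s + 1)) := by
      rw [neg_add, cpow_add _ _ hu0, cpow_neg_one]; field_simp
    simp [this, floorRemainder]; ring
  rw [h1, h3]; ring

lemma chi4_apply (n : ℕ) : chi4 (n : ZMod 4) = ((ZMod.χ₄ (n : ZMod 4) : ℤ) : ℂ) := by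
  simp [chi4]

lemma chi4_ne_one : chi4 ≠ 1 := by
  intro h
  have h1 := chi4_apply 3
  rw [h, ZMod.χ₄_nat_three_mod_four (by norm_num)] at h1
  have h2 : IsUnit ((3 : ℕ) : ZMod 4) := by decide
  rw [MulChar.one_apply h2] at h1
  norm_num at h1

lemma differentiable_LFunction_chi4 : Differentiable ℂ chi4.LFunction :=
  DirichletCharacter.differentiable_LFunction chi4_ne_one

lemma LFunction_eq_tail_aux {s : ℂ} (hs : 1 < s.re) :
    chi4.LFunction s = s * tailIntegral chiSum s := by
  have h1 := LSeries_eq_mul_integral' (fun n : ℕ => chi4 (n : ZMod 4)) (r := 1) zero_le_one hs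
    (by
      refine isBigO_of_le _ fun n => ?_
      simp only [Real.rpow_one]
      rw [Real.norm_of_nonneg (Finset.sum_nonneg fun _ _ => norm_nonneg _),
        Real.norm_of_nonneg (Nat.cast_nonneg n)]
      calc _ ≤ ∑ k ∈ Finset.Icc 1 n, (1 : ℝ) :=
            Finset.sum_le_sum fun k _ => DirichletCharacter.norm_le_one chi4 _
        _ = n := by simp)
  rw [DirichletCharacter.LFunction_eq_LSeries _ hs, h1, tailIntegral]
  congr 1
  refine setIntegral_congr_fun measurableSet_Ioi fun u _ => ?_
  simp [chi4_apply, chiSum]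

lemma isOpen_re_gt (a : ℝ) : IsOpen {s : ℂ | a < s.re} := isOpen_lt continuous_const continuous_re

lemma isPreconnected_re_gt (a : ℝ) : IsPreconnected {s : ℂ | a < s.re} :=
  (convex_halfSpace_re_gt a).isPreconnected

/-- A function that is analytic for `Re s > 0` is determined by its values for `Re s > 1`. -/
lemma eqOn_re_pos_of_eqOn_re_gt_one {f g : ℂ → ℂ} (hf : ∀ s : ℂ, 0 < s.re → DifferentiableAt ℂ f s)
    (hg : ∀ s : ℂ, 0 < s.re → DifferentiableAt ℂ g s) (h : ∀ s : ℂ, 1 < s.re → f s = g s) {s : ℂ}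
    (hs : 0 < s.re) : f s = g s := by
  have hd : ∀ {f : ℂ → ℂ}, (∀ s : ℂ, 0 < s.re → DifferentiableAt ℂ f s) →
      AnalyticOnNhd ℂ f {s : ℂ | 0 < s.re} := fun hf =>
    DifferentiableOn.analyticOnNhd (fun s hs => (hf s hs).differentiableWithinAt) (isOpen_re_gt 0)
  refine (hd hf).eqOn_of_preconnected_of_eventuallyEq (hd hg) (isPreconnected_re_gt 0)
    (z₀ := 2) (by simp) ?_ hs
  filter_upwards [(isOpen_re_gt 1).mem_nhds (show (2 : ℂ) ∈ {s : ℂ | 1 < s.re} by simp)] with s hs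
  exact h s hs

lemma LFunction_eq_tail {s : ℂ} (hs : 0 < s.re) :
    chi4.LFunction s = s * tailIntegral chiSum s := by
  refine eqOn_re_pos_of_eqOn_re_gt_one (g := fun s => s * tailIntegral chiSum s)
    (fun s _ => differentiable_LFunction_chi4 s) (fun s hs => ?_)
    (fun s hs => LFunction_eq_tail_aux hs) hs
  exact differentiableAt_id.mul
    (differentiableAt_tailIntegral measurable_chiSum (fun u _ => abs_chiSum_le u) hs)

lemma zetaReg_of_ne {s : ℂ} (hs : s ≠ 1) : zetaReg s = riemannZeta s * (s - 1) := by
  simp [zetaReg, hs]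

lemma zetaReg_one : zetaReg 1 = 1 := by simp [zetaReg]

lemma differentiable_zetaReg : Differentiable ℂ zetaReg := by
  rw [← differentiableOn_univ]
  refine (differentiableOn_compl_singleton_and_continuousAt_iff (c := 1) univ_mem).1 ⟨?_, ?_⟩
  · intro s hs
    have hs1 : s ≠ 1 := by simpa using hs
    have h1 : DifferentiableAt ℂ (fun s => riemannZeta s * (s - 1)) s :=
      (differentiableAt_riemannZeta hs1).mul (by fun_prop)
    refine (h1.congr_of_eventuallyEq ?_).differentiableWithinAt
    filter_upwards [isOpen_ne.mem_nhds hs1] with z hz using zetaReg_of_ne hz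
  · unfold zetaReg
    rw [continuousAt_update_same]
    simpa only [mul_comm] using riemannZeta_residue_one

lemma zetaReg_eq_tail {s : ℂ} (hs : 0 < s.re) :
    zetaReg s = s + s * (s - 1) * tailIntegral floorRemainder s := by
  refine eqOn_re_pos_of_eqOn_re_gt_one
    (g := fun s => s + s * (s - 1) * tailIntegral floorRemainder s)
    (fun s _ => differentiable_zetaReg s) (fun s hs => ?_) (fun s hs => ?_) hs
  · have := differentiableAt_tailIntegral measurable_floorRemainder
      (fun u hu => abs_floorRemainder_le (by linarith)) hs
    fun_prop
  · have hs1 : s ≠ 1 := by rintro rfl; simp at hs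
    have h2 : s - 1 ≠ 0 := sub_ne_zero.2 hs1
    rw [zetaReg_of_ne hs1, riemannZeta_eq_tail hs]
    field_simp

lemma norm_LFunction_chi4_le {s : ℂ} (hs : 1 / 2 ≤ s.re) : ‖chi4.LFunction s‖ ≤ 2 * ‖s‖ := by
  rw [LFunction_eq_tail (by linarith), norm_mul, mul_comm]
  gcongr
  refine (norm_tailIntegral_le (fun u _ => abs_chiSum_le u) (by linarith)).trans ?_
  rw [div_le_iff₀ (by linarith)]; linarith

lemma norm_zetaReg_le {s : ℂ} (hs : 1 / 2 ≤ s.re) : ‖zetaReg s‖ ≤ 8 * ‖s‖ ^ 2 := by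
  rw [zetaReg_eq_tail (by linarith)]
  have h1 : ‖tailIntegral floorRemainder s‖ ≤ 2 := by
    refine (norm_tailIntegral_le
      (fun u hu => abs_floorRemainder_le (by linarith)) (by linarith)).trans ?_
    rw [div_le_iff₀ (by linarith)]; linarith
  have h2 : 1 / 2 ≤ ‖s‖ := hs.trans ((le_abs_self _).trans (abs_re_le_norm s))
  have h3 : ‖s - 1‖ ≤ ‖s‖ + 1 := (norm_sub_le _ _).trans (by simp)
  calc _ ≤ ‖s‖ + ‖s‖ * ‖s - 1‖ * ‖tailIntegral floorRemainder s‖ := by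
        refine (norm_add_le _ _).trans ?_; rw [norm_mul, norm_mul]
    _ ≤ ‖s‖ + ‖s‖ * (‖s‖ + 1) * 2 := by gcongr
    _ ≤ 8 * ‖s‖ ^ 2 := by nlinarith

/-- At real points the Dirichlet integral of a real remainder is a real integral. -/
lemma tailIntegral_ofReal (R : ℝ → ℝ) (σ : ℝ) :
    tailIntegral R σ = ((∫ u in Ioi (1 : ℝ), R u * u ^ (-(σ + 1)) : ℝ) : ℂ) := by
  rw [tailIntegral, ← integral_complex_ofReal]
  refine setIntegral_congr_fun measurableSet_Ioi fun u hu => ?_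
  have : 0 ≤ u := by simp at hu; linarith
  push_cast
  rw [ofReal_cpow this]; push_cast; rfl

lemma LFunction_chi4_pos {σ : ℝ} (hσ : 0 < σ) :
    ∃ y : ℝ, 0 < y ∧ chi4.LFunction σ = y := by
  refine ⟨σ * ∫ u in Ioi (1 : ℝ), chiSum u * u ^ (-(σ + 1)), mul_pos hσ ?_, ?_⟩
  · have hi : IntegrableOn (fun u : ℝ => chiSum u * u ^ (-(σ + 1))) (Ioi 1) := by
      have h : IntegrableOn (fun u : ℝ => ((chiSum u : ℂ) * (u : ℂ) ^ (-((σ : ℂ) + 1))).re) (Ioi 1) :=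
        (integrableOn_tail measurable_chiSum (fun u _ => abs_chiSum_le u)
        (s := σ) (by simpa)).re
      refine IntegrableOn.congr_fun h (fun u hu => ?_) measurableSet_Ioi
      have h0 : 0 ≤ u := by simp at hu; linarith
      have : (u : ℂ) ^ (-((σ : ℂ) + 1)) = ((u ^ (-(σ + 1)) : ℝ) : ℂ) := by
        rw [ofReal_cpow h0]; push_cast; rfl
      rw [this, ← ofReal_mul, ofReal_re]
    rw [setIntegral_pos_iff_support_of_nonneg_ae _ hi]
    · refine lt_of_lt_of_le (?_ : 0 < volume (Ioo (1 : ℝ) 2)) (measure_mono fun u hu => ?_)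
      · simp
      · refine ⟨?_, hu.1⟩
        have h1 : ⌊u⌋₊ = 1 := by
          rw [Nat.floor_eq_iff (by linarith [hu.1])]
          constructor <;> norm_num <;> linarith [hu.1, hu.2]
        have h2 : 0 < u := by linarith [hu.1]
        rw [Function.mem_support, chiSum_eq, h1]
        simp only [Nat.one_mod, true_or, if_true, one_mul]
        positivity
    · refine (ae_restrict_mem measurableSet_Ioi).mono fun u hu => ?_
      have h2 : 0 < u := by simp at hu; linarith
      exact mul_nonneg (chiSum_nonneg u) (by positivity)
  · rw [LFunction_eq_tail (by simpa), tailIntegral_ofReal]; push_cast; rfl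

lemma zetaReg_pos {σ : ℝ} (hσ : 0 < σ) : ∃ y : ℝ, 0 < y ∧ zetaReg σ = y := by
  refine ⟨σ + σ * (σ - 1) * ∫ u in Ioi (1 : ℝ), floorRemainder u * u ^ (-(σ + 1)), ?_, ?_⟩
  · have h1 : ∫ u in Ioi (1 : ℝ), floorRemainder u * u ^ (-(σ + 1)) ≤ 0 := by
      refine setIntegral_nonpos measurableSet_Ioi fun u hu => ?_
      have h2 : 0 < u := by simp at hu; linarith
      refine mul_nonpos_of_nonpos_of_nonneg ?_ (by positivity)
      have := Nat.floor_le h2.le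
      simp [floorRemainder, this]
    have h2 := norm_tailIntegral_le (R := floorRemainder) (s := σ)
      (fun u hu => abs_floorRemainder_le (by linarith)) (by simpa)
    rw [tailIntegral_ofReal, norm_real, Real.norm_eq_abs, ofReal_re, abs_of_nonpos h1,
      le_div_iff₀ hσ] at h2
    set J := ∫ u in Ioi (1 : ℝ), floorRemainder u * u ^ (-(σ + 1))
    rcases le_total σ 1 with h | h
    · nlinarith [mul_nonneg (mul_nonneg hσ.le (sub_nonneg.2 h)) (neg_nonneg.2 h1)]
    · nlinarith [mul_nonneg (sub_nonneg.2 h) (sub_nonneg.2 h2)]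
  · rw [zetaReg_eq_tail (by simpa), tailIntegral_ofReal]; push_cast; rfl

/-! ### Landau's lemma on logarithmic derivatives -/

lemma finite_zeros_ball {f : ℂ → ℂ} (hf : Differentiable ℂ f) (h0 : f 0 ≠ 0) (r : ℝ) :
    {z ∈ Metric.ball (0 : ℂ) r | f z = 0}.Finite := by
  by_contra hinf
  obtain ⟨a, -, ha⟩ := Set.Infinite.exists_accPt_of_subset_isCompact (hs := hinf)
    (isCompact_closedBall (0 : ℂ) r) (fun z hz => Metric.ball_subset_closedBall hz.1)
  have hfr : ∃ᶠ z in 𝓝[≠] a, f z = (fun _ => (0 : ℂ)) z :=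
    (accPt_iff_frequently_nhdsNE.1 ha).mono fun z hz => hz.2
  have han : AnalyticOnNhd ℂ f univ := hf.differentiableOn.analyticOnNhd isOpen_univ
  exact h0 (congrFun (han.eq_of_frequently_eq (fun z _ => analyticAt_const) hfr) 0)

/-- The full power of a zero of an entire function can be split off. -/
lemma exists_eq_pow_mul {f : ℂ → ℂ} (hf : Differentiable ℂ f) (h0 : f 0 ≠ 0) {u : ℂ}
    (hu : f u = 0) :
    ∃ (m : ℕ) (g : ℂ → ℂ), 1 ≤ m ∧ Differentiable ℂ g ∧ g u ≠ 0 ∧ ∀ z, f z = (z - u) ^ m * g z := by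
  have han : AnalyticOnNhd ℂ f univ := hf.differentiableOn.analyticOnNhd isOpen_univ
  have hne : ¬ ∀ᶠ z in 𝓝 u, f z = 0 := fun h => by
    have : f = fun _ => 0 := han.eq_of_eventuallyEq (fun z _ => analyticAt_const) h
    exact h0 (congrFun this 0)
  obtain ⟨m, g, hg, hgu, hfg⟩ :=
    (han u (mem_univ u)).exists_eventuallyEq_pow_smul_nonzero_iff.2 hne
  refine ⟨m, fun z => if z = u then g u else f z / (z - u) ^ m, ?_, fun z => ?_, by simpa, fun z => ?_⟩
  · rw [Nat.one_le_iff_ne_zero]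
    rintro rfl
    have := hfg.self_of_nhds
    simp [hu, hgu.symm] at this
  · by_cases hz : z = u
    · subst hz
      refine hg.differentiableAt.congr_of_eventuallyEq ?_
      filter_upwards [hfg] with w hw
      split_ifs with h
      · rw [h]
      · rw [hw, smul_eq_mul, mul_div_cancel_left₀ _ (pow_ne_zero _ (sub_ne_zero.2 h))]
    · have : DifferentiableAt ℂ (fun z => f z / (z - u) ^ m) z :=
        (hf z).div (by fun_prop) (pow_ne_zero _ (sub_ne_zero.2 hz))
      refine this.congr_of_eventuallyEq ?_
      filter_upwards [isOpen_ne.mem_nhds hz] with w hw using if_neg hw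
  · beta_reduce
    split_ifs with h
    · have := hfg.self_of_nhds
      rw [h, this, smul_eq_mul]
    · field_simp [sub_ne_zero.2 h]

open ComplexConjugate in
/-- Removal of a zero `u` by a Blaschke factor: on the circle of radius `r` the modulus does not
change, at the centre it does not decrease. -/
lemma exists_blaschke_quotient {f : ℂ → ℂ} (hf : Differentiable ℂ f) (h0 : f 0 ≠ 0) {r : ℝ}
    (hr : 0 < r) {u : ℂ} (hur : ‖u‖ < r) (hu : f u = 0) :
    ∃ (m : ℕ) (h : ℂ → ℂ), 1 ≤ m ∧ Differentiable ℂ h ∧ h 0 ≠ 0 ∧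
      (∀ z, ‖z‖ = r → ‖h z‖ = ‖f z‖) ∧ ‖f 0‖ ≤ ‖h 0‖ ∧
      (∀ z, ‖z‖ < r → h z = 0 → f z = 0 ∧ z ≠ u) ∧
      logDeriv f 0 = logDeriv h 0 + m * (-u⁻¹ + conj u / r ^ 2) := by
  obtain ⟨m, g, hm, hg, hgu, hfg⟩ := exists_eq_pow_mul hf h0 hu
  have hu0 : u ≠ 0 := by rintro rfl; exact h0 hu
  have hg0 : g 0 ≠ 0 := fun h => h0 (by rw [hfg, h, mul_zero])
  have hrc : (r : ℂ) ≠ 0 := ofReal_ne_zero.2 hr.ne'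
  set B : ℂ → ℂ := fun z => (r ^ 2 - conj u * z) / r with hB
  have hB0 : B 0 = r := by simp only [hB, mul_zero, sub_zero]; field_simp
  have hBd : Differentiable ℂ B := by fun_prop
  have hBne : ∀ z, ‖z‖ < r → B z ≠ 0 := fun z hz h => by
    have h1 : (r : ℂ) ^ 2 = conj u * z := by
      rcases div_eq_zero_iff.1 h with h | h
      · exact sub_eq_zero.1 h
      · exact absurd h hrc
    have h2 : r ^ 2 = ‖u‖ * ‖z‖ := by
      have := congrArg norm h1
      simpa [abs_of_pos hr] using this
    nlinarith [norm_nonneg u, norm_nonneg z]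
  have hfh : logDeriv f 0 = m * (-u⁻¹) + logDeriv g 0 := by
    have h1 : f = fun z => (z - u) ^ m * g z := funext hfg
    rw [h1, logDeriv_mul (f := fun z => (z - u) ^ m) 0 (by simp [hu0]) hg0 (by fun_prop) (hg 0),
      logDeriv_fun_pow (f := fun z => z - u) (by fun_prop)]
    simp [logDeriv_apply]
  have hhh : logDeriv (fun z => B z ^ m * g z) 0 = m * (-(conj u / r ^ 2)) + logDeriv g 0 := by
    have hd : deriv B 0 = -(conj u) / r := by
      simp [hB]
    rw [logDeriv_mul (f := fun z => B z ^ m) 0 (by simp [hB0, hrc]) hg0 (by fun_prop) (hg 0),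
      logDeriv_fun_pow (f := B) (by fun_prop), logDeriv_apply, hd, hB0]
    field_simp
  refine ⟨m, fun z => B z ^ m * g z, hm, by fun_prop, ?_, fun z hz => ?_, ?_, fun z hz h => ?_, ?_⟩
  · simp [hB0, hrc, hg0]
  · have h1 : ‖B z‖ = ‖z - u‖ := by
      have h2 : (r : ℂ) ^ 2 = z * conj z := by
        rw [mul_conj, normSq_eq_norm_sq, hz]; push_cast; rfl
      have h3 : B z = z * conj (z - u) / r := by
        simp only [hB, h2, map_sub]; ring
      rw [h3, norm_div, norm_mul, norm_conj, hz, norm_real, Real.norm_of_nonneg hr.le]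
      field_simp
    rw [norm_mul, norm_pow, h1, hfg, norm_mul, norm_pow]
  · rw [hfg, norm_mul, norm_mul, norm_pow, norm_pow, hB0]
    gcongr
    simpa [abs_of_pos hr] using hur.le
  · have hgz : g z = 0 := by
      rcases mul_eq_zero.1 h with h | h
      · exact absurd h (pow_ne_zero _ (hBne z hz))
      · exact h
    exact ⟨by rw [hfg, hgz, mul_zero], by rintro rfl; exact hgu hgz⟩
  · rw [hfh, hhh]; ring

/-- Borel–Carathéodory bound for the logarithmic derivative of a function without zeros. -/
lemma norm_logDeriv_le_of_ne_zero {f : ℂ → ℂ} (hf : Differentiable ℂ f) {r M : ℝ} (hr : 0 < r)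
    (hM : 0 < M) (hne : ∀ z, ‖z‖ < r → f z ≠ 0)
    (hb : ∀ z, ‖z‖ = r → ‖f z‖ ≤ Real.exp M * ‖f 0‖) : ‖logDeriv f 0‖ ≤ 4 * M / r := by
  have hne' : ∀ z ∈ Metric.ball (0 : ℂ) r, f z ≠ 0 := fun z hz => hne z (by simpa using hz)
  have h00 : (0 : ℂ) ∈ Metric.ball (0 : ℂ) r := Metric.mem_ball_self hr
  have hbound : ∀ z ∈ Metric.ball (0 : ℂ) r, ‖f z‖ ≤ Real.exp M * ‖f 0‖ := fun z hz => by
    refine norm_le_of_forall_mem_frontier_norm_le (U := Metric.ball (0 : ℂ) r) Metric.isBounded_ball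
      hf.diffContOnCl (fun w hw => hb w ?_) (subset_closure hz)
    rw [frontier_ball _ hr.ne'] at hw
    simpa using hw
  have hld : DifferentiableOn ℂ (logDeriv f) (Metric.ball 0 r) := by
    refine DifferentiableOn.div ?_ hf.differentiableOn hne'
    exact (hf.differentiableOn.deriv Metric.isOpen_ball)
  obtain ⟨φ, hφ0, hφ⟩ := hld.isExactOn_ball.with_val_at 0 0
  have hφd : DifferentiableOn ℂ φ (Metric.ball 0 r) := fun z hz =>
    (hφ z hz).differentiableAt.differentiableWithinAt
  have hexp : ∀ z ∈ Metric.ball (0 : ℂ) r, f z * exp (-φ z) = f 0 := by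
    intro z hz
    have h1 : ∀ w ∈ Metric.ball (0 : ℂ) r, HasDerivAt (fun z => f z * exp (-φ z)) 0 w := by
      intro w hw
      have := (hf w).hasDerivAt.mul (hφ w hw).neg.cexp
      refine this.congr_deriv ?_
      have := hne' w hw
      rw [logDeriv_apply, Pi.neg_apply]; field_simp; ring
    have h2 := (convex_ball (0 : ℂ) r).is_const_of_fderivWithin_eq_zero (𝕜 := ℂ)
      (f := fun z => f z * exp (-φ z))
      (fun w hw => (h1 w hw).differentiableAt.differentiableWithinAt)
      (fun w hw => by
        rw [fderivWithin_of_isOpen Metric.isOpen_ball hw]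
        ext
        simp [(h1 w hw).deriv]) hz h00
    simpa [hφ0] using h2
  have hre : ∀ z ∈ Metric.ball (0 : ℂ) r, (φ z).re ≤ M := by
    intro z hz
    have h1 : f z = f 0 * exp (φ z) := by
      rw [← hexp z hz, mul_assoc, ← exp_add]; simp
    have h2 := hbound z hz
    rw [h1, norm_mul, norm_exp, mul_comm] at h2
    have h3 := le_of_mul_le_mul_right h2 (norm_pos_iff.2 (hne' 0 h00))
    exact Real.exp_le_exp.1 h3
  have hd : deriv φ 0 = logDeriv f 0 := (hφ 0 h00).deriv
  rw [← hd]
  have h4 : 4 * M / r = 2 * M / (r / 2) := by field_simp; ring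
  rw [h4]
  refine norm_deriv_le_of_forall_mem_sphere_norm_le (by positivity) ?_ fun z hz => ?_
  · refine (hφd.mono ?_).diffContOnCl
    rw [closure_ball _ (by positivity)]
    exact Metric.closedBall_subset_ball (by linarith)
  · have hz' : ‖z‖ = r / 2 := by simpa using hz
    have h5 := borelCaratheodory_zero hM hφd (fun w hw => hre w hw) hr
      (z := z) (by simp [hz']; linarith) hφ0
    rw [hz'] at h5
    refine h5.trans (le_of_eq ?_)
    field_simp
    ring

open ComplexConjugate in
lemma re_blaschke_term (u : ℂ) (r : ℝ) :
    (-u⁻¹ + conj u / (r : ℂ) ^ 2).re = -u.re * (1 / ‖u‖ ^ 2 - 1 / r ^ 2) := by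
  have : (conj u / (r : ℂ) ^ 2).re = u.re / r ^ 2 := by
    rw [← ofReal_pow, div_ofReal_re, conj_re]
  rw [add_re, neg_re, inv_re, this, normSq_eq_norm_sq]
  ring

lemma blaschke_term_nonneg {u : ℂ} (hu : u ≠ 0) {r : ℝ} (hur : ‖u‖ < r) (hre : u.re ≤ 0) :
    0 ≤ -u.re * (1 / ‖u‖ ^ 2 - 1 / r ^ 2) := by
  have h1 : 0 < ‖u‖ := norm_pos_iff.2 hu
  refine mul_nonneg (by linarith) (sub_nonneg.2 ?_)
  gcongr

/-- Landau's lemma: if all zeros in a disc lie to the left of the centre, then the growth of the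
function bounds the real part of the logarithmic derivative at the centre from below. -/
lemma neg_re_logDeriv_le {r M : ℝ} (hr : 0 < r) (hM : 0 < M) {f : ℂ → ℂ} (hf : Differentiable ℂ f)
    (h0 : f 0 ≠ 0) (hb : ∀ z, ‖z‖ = r → ‖f z‖ ≤ Real.exp M * ‖f 0‖)
    (hz : ∀ z, ‖z‖ < r → f z = 0 → z.re ≤ 0) : -(logDeriv f 0).re ≤ 4 * M / r := by
  -- induction on the number of zeros in the disc, each removed by a Blaschke quotient
  obtain ⟨n, hn⟩ : ∃ n, {z ∈ Metric.ball (0 : ℂ) r | f z = 0}.ncard = n := ⟨_, rfl⟩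
  induction n using Nat.strong_induction_on generalizing f with
  | _ n ih =>
    by_cases hne : ∀ z, ‖z‖ < r → f z ≠ 0
    · have h1 := norm_logDeriv_le_of_ne_zero hf hr hM hne hb
      have h2 := abs_re_le_norm (logDeriv f 0)
      have h3 := neg_abs_le (logDeriv f 0).re
      linarith
    · push Not at hne
      obtain ⟨u, hur, hu⟩ := hne
      have hu0 : u ≠ 0 := by rintro rfl; exact h0 hu
      obtain ⟨m, h, hm, hh, hh0, hsph, hge, hzer, hld⟩ := exists_blaschke_quotient hf h0 hr hur hu
      have hlt : {z ∈ Metric.ball (0 : ℂ) r | h z = 0}.ncard < n := by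
        rw [← hn]
        refine Set.ncard_lt_ncard ⟨fun z hz => ⟨hz.1, ?_⟩, fun hsub => ?_⟩
          (finite_zeros_ball hf h0 r)
        · exact (hzer z (by simpa using hz.1) hz.2).1
        · have : u ∈ {z ∈ Metric.ball (0 : ℂ) r | h z = 0} := hsub ⟨by simpa using hur, hu⟩
          exact (hzer u hur this.2).2 rfl
      have h1 := ih _ hlt hh hh0 (fun z hz => (hsph z hz).trans_le ((hb z hz).trans (by gcongr)))
        (fun z hz' hhz => hz z hz' (hzer z hz' hhz).1) rfl
      have h2 := blaschke_term_nonneg hu0 hur (hz u hur hu)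
      have h3 : (logDeriv f 0).re = (logDeriv h 0).re + m * (-u.re * (1 / ‖u‖ ^ 2 - 1 / r ^ 2)) := by
        rw [hld, add_re, ← re_blaschke_term u, ← ofReal_natCast, re_ofReal_mul]
      rw [h3]
      have : 0 ≤ (m : ℝ) * (-u.re * (1 / ‖u‖ ^ 2 - 1 / r ^ 2)) := by positivity
      linarith

/-- Landau's lemma with the contribution of one real zero `-d` kept. -/
lemma neg_re_logDeriv_le_sub {r M d : ℝ} (hr : 0 < r) (hM : 0 < M) {f : ℂ → ℂ}
    (hf : Differentiable ℂ f) (h0 : f 0 ≠ 0) (hb : ∀ z, ‖z‖ = r → ‖f z‖ ≤ Real.exp M * ‖f 0‖)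
    (hz : ∀ z, ‖z‖ < r → f z = 0 → z.re ≤ 0) (hd : 0 < d) (hdr : d < r) (hfd : f (-d) = 0) :
    -(logDeriv f 0).re ≤ 4 * M / r - (1 / d - d / r ^ 2) := by
  have hnd : ‖(-d : ℂ)‖ = d := by simp [abs_of_pos hd]
  have hd0 : (-d : ℂ) ≠ 0 := by simpa using hd.ne'
  obtain ⟨m, h, hm, hh, hh0, hsph, hge, hzer, hld⟩ :=
    exists_blaschke_quotient hf h0 hr (by rwa [hnd]) hfd
  have h1 := neg_re_logDeriv_le hr hM hh hh0
    (fun z hz => (hsph z hz).trans_le ((hb z hz).trans (by gcongr)))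
    (fun z hz' hhz => hz z hz' (hzer z hz' hhz).1)
  have h3 : (logDeriv f 0).re = (logDeriv h 0).re + m * (1 / d - d / r ^ 2) := by
    rw [hld, add_re, ← ofReal_natCast, re_ofReal_mul, re_blaschke_term (-d), hnd]
    congr 2
    simp only [neg_re, ofReal_re, neg_neg]
    field_simp
  have h4 : 0 ≤ 1 / d - d / r ^ 2 := by
    rw [sub_nonneg, div_le_div_iff₀ (by positivity) hd]
    nlinarith
  have h5 : (1 : ℝ) ≤ m := by exact_mod_cast hm
  rw [h3]
  nlinarith

/-! ### The zero-free region of `ζ(s) L(s, χ₄)` -/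

/-- The entire function `(s - 1) ζ(s) L(s, χ₄)`: up to the factor `s - 1`, the Dedekind zeta
function of the Gaussian field. -/
noncomputable def zetaL (s : ℂ) : ℂ := zetaReg s * chi4.LFunction s

lemma differentiable_zetaL : Differentiable ℂ zetaL :=
  differentiable_zetaReg.mul differentiable_LFunction_chi4

lemma zetaReg_ne_zero_of_one_le_re {s : ℂ} (hs : 1 ≤ s.re) : zetaReg s ≠ 0 := by
  by_cases h : s = 1
  · rw [h, zetaReg_one]; exact one_ne_zero
  · rw [zetaReg_of_ne h]
    exact mul_ne_zero (riemannZeta_ne_zero_of_one_le_re hs) (sub_ne_zero.2 h)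

lemma LFunction_chi4_ne_zero_of_one_le_re {s : ℂ} (hs : 1 ≤ s.re) : chi4.LFunction s ≠ 0 :=
  DirichletCharacter.LFunction_ne_zero_of_one_le_re chi4 (Or.inl chi4_ne_one) hs

lemma zetaL_ne_zero_of_one_le_re {s : ℂ} (hs : 1 ≤ s.re) : zetaL s ≠ 0 :=
  mul_ne_zero (zetaReg_ne_zero_of_one_le_re hs) (LFunction_chi4_ne_zero_of_one_le_re hs)

/-- The coefficients `Λ(n) (1 + χ₄(n))` of the negative logarithmic derivative of `ζ(s) L(s, χ₄)`.
They are nonnegative. -/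
noncomputable def mangoldtCoeff (n : ℕ) : ℝ :=
  ArithmeticFunction.vonMangoldt n * (1 + (ZMod.χ₄ (n : ZMod 4) : ℝ))

lemma mangoldtCoeff_nonneg (n : ℕ) : 0 ≤ mangoldtCoeff n := by
  refine mul_nonneg ArithmeticFunction.vonMangoldt_nonneg ?_
  rw [ZMod.χ₄_nat_eq_if_mod_four]
  split_ifs <;> norm_num

/-- The Dirichlet series `∑ Λ(n) (1 + χ₄(n)) n^{-s}`. -/
noncomputable def mangoldtSeries (s : ℂ) : ℂ := LSeries (fun n => (mangoldtCoeff n : ℂ)) s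

lemma mangoldtCoeff_eq_add :
    (fun n => (mangoldtCoeff n : ℂ)) = (fun n => (ArithmeticFunction.vonMangoldt n : ℂ)) +
      ((fun n : ℕ => chi4 (n : ZMod 4)) * fun n => (ArithmeticFunction.vonMangoldt n : ℂ)) := by
  funext n
  simp only [mangoldtCoeff, Pi.add_apply, Pi.mul_apply, chi4_apply]
  push_cast
  ring

lemma LSeriesSummable_mangoldtCoeff {s : ℂ} (hs : 1 < s.re) :
    LSeriesSummable (fun n => (mangoldtCoeff n : ℂ)) s := by
  rw [mangoldtCoeff_eq_add]
  exact (ArithmeticFunction.LSeriesSummable_vonMangoldt hs).add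
    (DirichletCharacter.LSeriesSummable_twist_vonMangoldt chi4 hs)

lemma one_ne_of_one_lt_re {s : ℂ} (hs : 1 < s.re) : s ≠ 1 := by
  rintro rfl; simp at hs

lemma logDeriv_zetaL {s : ℂ} (hs : 1 < s.re) :
    logDeriv zetaL s = 1 / (s - 1) - mangoldtSeries s := by
  have hs1 := one_ne_of_one_lt_re hs
  have h1 : logDeriv zetaReg s = logDeriv riemannZeta s + 1 / (s - 1) := by
    have : zetaReg =ᶠ[𝓝 s] fun s => riemannZeta s * (s - 1) := by
      filter_upwards [isOpen_ne.mem_nhds hs1] with z hz using zetaReg_of_ne hz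
    rw [(logDeriv_congr_nhds this).self_of_nhds,
      logDeriv_mul (g := fun s => s - 1) s (riemannZeta_ne_zero_of_one_le_re hs.le)
        (sub_ne_zero.2 hs1) (differentiableAt_riemannZeta hs1) (by fun_prop)]
    simp [logDeriv_apply]
  have h2 : logDeriv zetaL s = logDeriv zetaReg s + logDeriv chi4.LFunction s :=
    logDeriv_mul s (zetaReg_ne_zero_of_one_le_re hs.le) (LFunction_chi4_ne_zero_of_one_le_re hs.le)
      (differentiable_zetaReg s) (differentiable_LFunction_chi4 s)
  have h3 : mangoldtSeries s = -logDeriv riemannZeta s - logDeriv chi4.LFunction s := by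
    rw [mangoldtSeries, mangoldtCoeff_eq_add,
      LSeries_add (ArithmeticFunction.LSeriesSummable_vonMangoldt hs)
        (DirichletCharacter.LSeriesSummable_twist_vonMangoldt chi4 hs),
      ArithmeticFunction.LSeries_vonMangoldt_eq_deriv_riemannZeta_div hs,
      DirichletCharacter.LSeries_twist_vonMangoldt_eq chi4 hs, logDeriv_apply, logDeriv_apply,
      DirichletCharacter.deriv_LFunction_eq_deriv_LSeries chi4 hs,
      DirichletCharacter.LFunction_eq_LSeries chi4 hs]
    ring
  rw [h2, h1, h3]; ring

lemma re_term_mangoldtCoeff (σ t : ℝ) (n : ℕ) :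
    (LSeries.term (fun n => (mangoldtCoeff n : ℂ)) (σ + t * I) n).re =
      if n = 0 then 0 else
        mangoldtCoeff n * Real.exp (-σ * Real.log n) * Real.cos (t * Real.log n) := by
  rw [LSeries.term_def]
  split_ifs with h
  · simp
  · have hn : (n : ℂ) ≠ 0 := Nat.cast_ne_zero.2 h
    rw [div_eq_mul_inv, ← cpow_neg, cpow_def_of_ne_zero hn, re_ofReal_mul, exp_re,
      ← natCast_log, mul_assoc]
    have h1 : (((Real.log n : ℝ) : ℂ) * -(σ + t * I)).re = -σ * Real.log n := by
      rw [re_ofReal_mul]; simp; ring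
    have h2 : (((Real.log n : ℝ) : ℂ) * -(σ + t * I)).im = -(t * Real.log n) := by
      rw [im_ofReal_mul]; simp; ring
    rw [h1, h2, Real.cos_neg]

/-- The classical inequality `3 + 4 cos θ + cos 2θ ≥ 0`, summed over the coefficients. -/
lemma three_four_one {σ : ℝ} (hσ : 1 < σ) (t : ℝ) :
    0 ≤ 3 * (mangoldtSeries σ).re + 4 * (mangoldtSeries (σ + t * I)).re +
      (mangoldtSeries (σ + (2 * t : ℝ) * I)).re := by
  have hs : ∀ t : ℝ, Summable fun n =>
      LSeries.term (fun n => (mangoldtCoeff n : ℂ)) (σ + t * I) n := fun t =>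
    LSeriesSummable_mangoldtCoeff (by simpa)
  have hre : ∀ t : ℝ, HasSum (fun n =>
      (LSeries.term (fun n => (mangoldtCoeff n : ℂ)) (σ + t * I) n).re)
      (mangoldtSeries (σ + t * I)).re := fun t => hasSum_re (hs t).hasSum
  have h0 := hre 0
  simp only [ofReal_zero, zero_mul, add_zero] at h0
  refine (((h0.mul_left 3).add ((hre t).mul_left 4)).add (hre (2 * t))).nonneg fun n => ?_
  have h1 := re_term_mangoldtCoeff σ 0 n
  simp only [ofReal_zero, zero_mul, add_zero, Real.cos_zero, mul_one] at h1
  rw [h1, re_term_mangoldtCoeff, re_term_mangoldtCoeff]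
  split_ifs with h
  · simp
  · have h2 : Real.cos (2 * t * Real.log n) = 2 * Real.cos (t * Real.log n) ^ 2 - 1 := by
      rw [mul_assoc, Real.cos_two_mul]
    have h3 := mangoldtCoeff_nonneg n
    have h4 := Real.exp_nonneg (-σ * Real.log n)
    rw [h2]
    have h5 : 0 ≤ mangoldtCoeff n * Real.exp (-σ * Real.log n) *
      (2 * (1 + Real.cos (t * Real.log n)) ^ 2) := by positivity
    linarith

/-- Comparison with `ζ(Re s)`, which has a simple pole at `1`. -/
lemma norm_LSeries_le {f : ℕ → ℂ} (hf : ∀ n, ‖f n‖ ≤ 1) {s : ℂ} (hs : 1 < s.re) (hs2 : s.re ≤ 2) :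
    ‖LSeries f s‖ ≤ 32 / (s.re - 1) := by
  have hr : HasSum (fun n => (LSeries.term 1 (s.re : ℂ) n).re) (riemannZeta s.re).re :=
    hasSum_re (LSeriesHasSum_one (s := (s.re : ℂ)) (by simpa))
  have h1 : ‖LSeries f s‖ ≤ (riemannZeta s.re).re := by
    refine tsum_of_norm_bounded hr fun n => ?_
    rw [LSeries.norm_term_eq, LSeries.term_def]
    split_ifs with h
    · simp
    · have : (1 : ℕ → ℂ) n / (n : ℂ) ^ (s.re : ℂ) = ((1 / (n : ℝ) ^ s.re : ℝ) : ℂ) := by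
        rw [← ofReal_natCast, ← ofReal_cpow (Nat.cast_nonneg n)]; simp
      rw [this, ofReal_re]
      gcongr
      exact hf n
  have hne : (s.re : ℂ) ≠ 1 := one_ne_of_one_lt_re (by simpa)
  have h2 := norm_zetaReg_le (s := (s.re : ℂ)) (by simp; linarith)
  rw [zetaReg_of_ne hne, norm_mul] at h2
  have h3 : ‖(s.re : ℂ) - 1‖ = s.re - 1 := by
    rw [← ofReal_one, ← ofReal_sub, norm_real, Real.norm_of_nonneg (by linarith)]
  have h4 : ‖(s.re : ℂ)‖ = s.re := by rw [norm_real, Real.norm_of_nonneg (by linarith)]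
  rw [h3, h4] at h2
  refine h1.trans (((le_abs_self _).trans (abs_re_le_norm _)).trans ?_)
  rw [le_div_iff₀ (by linarith)]
  nlinarith

/-- Lower bound from the Dirichlet series of `1 / ζ` and `1 / L(·, χ₄)`, whose coefficients are those of
the Möbius function and hence bounded. -/
lemma norm_zetaL_ge {s : ℂ} (hs : 1 < s.re) (hs2 : s.re ≤ 2) (ht : 1 ≤ |s.im|) :
    (s.re - 1) ^ 2 / 1024 ≤ ‖zetaL s‖ := by
  have h1 : ‖s - 1‖ ≥ 1 := ht.trans (by simpa using abs_im_le_norm (s - 1))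
  have hη : 0 < s.re - 1 := by linarith
  have hinv : ∀ a b : ℂ, a * b = 1 → ‖b‖ ≤ 32 / (s.re - 1) → (s.re - 1) / 32 ≤ ‖a‖ := by
    intro a b hab hb
    have h2 : ‖a‖ * ‖b‖ = 1 := by rw [← norm_mul, hab, norm_one]
    have h3 : 1 ≤ ‖a‖ * (32 / (s.re - 1)) := h2.symm.le.trans (by gcongr)
    rw [mul_div_assoc', le_div_iff₀ hη] at h3
    linarith
  have hμ : ∀ n : ℕ, ‖((ArithmeticFunction.moebius n : ℤ) : ℂ)‖ ≤ 1 := fun n => by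
    rw [norm_intCast]
    exact_mod_cast ArithmeticFunction.abs_moebius_le_one
  have hz : (s.re - 1) / 32 ≤ ‖riemannZeta s‖ := by
    refine hinv _ _ ?_ (norm_LSeries_le hμ hs hs2)
    rw [← LSeries_one_eq_riemannZeta hs]
    exact LSeries_one_mul_Lseries_moebius hs
  have hL : (s.re - 1) / 32 ≤ ‖chi4.LFunction s‖ := by
    refine hinv _ _ ?_ (norm_LSeries_le (f := (fun n : ℕ => chi4 (n : ZMod 4)) *
      fun n => ((ArithmeticFunction.moebius n : ℤ) : ℂ)) (fun n => ?_) hs hs2)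
    · rw [DirichletCharacter.LFunction_eq_LSeries chi4 hs]
      exact DirichletCharacter.LSeries.mul_mu_eq_one chi4 hs
    · rw [Pi.mul_apply, norm_mul]
      exact mul_le_one₀ (DirichletCharacter.norm_le_one chi4 _) (norm_nonneg _) (hμ n)
  rw [zetaL, zetaReg_of_ne (one_ne_of_one_lt_re hs), norm_mul, norm_mul]
  calc (s.re - 1) ^ 2 / 1024 = (s.re - 1) / 32 * 1 * ((s.re - 1) / 32) := by ring
    _ ≤ _ := by gcongr

lemma norm_zetaL_le {s : ℂ} (hs : 1 / 2 ≤ s.re) : ‖zetaL s‖ ≤ 16 * ‖s‖ ^ 3 := by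
  rw [zetaL, norm_mul]
  calc _ ≤ 8 * ‖s‖ ^ 2 * (2 * ‖s‖) := by
        gcongr
        · exact norm_zetaReg_le hs
        · exact norm_LFunction_chi4_le hs
    _ = _ := by ring

/-- The logarithm of the growth of `zetaL` in the disc of radius `1/2` about `1 + η + it`, where
`τ` exceeds the height. -/
noncomputable def growthExponent (η τ : ℝ) : ℝ := Real.log (2 ^ 14 * τ ^ 3 / η ^ 2)

/-- The hypothesis of Landau's lemma for `ζ(s) L(s, χ₄)` on the disc of radius `1/2` about `1 + η + it`. -/
lemma growth_bound {η t τ : ℝ} (hη : 0 < η) (hη1 : η ≤ 1) (ht : 1 ≤ |t|) (hτ : |t| + 3 ≤ τ) {z : ℂ}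
    (hz : ‖z‖ = 1 / 2) :
    ‖zetaL ((1 + η : ℝ) + t * I + z)‖ ≤
      Real.exp (growthExponent η τ) * ‖zetaL ((1 + η : ℝ) + t * I)‖ := by
  have hτ0 : 0 < τ := by linarith
  have hre := abs_le.1 (abs_re_le_norm z)
  have him := abs_le.1 (abs_im_le_norm z)
  rw [hz] at hre him
  have h1 : ‖zetaL ((1 + η : ℝ) + t * I + z)‖ ≤ 16 * τ ^ 3 := by
    refine (norm_zetaL_le (by simp; linarith)).trans ?_
    gcongr
    calc _ ≤ ‖((1 + η : ℝ) : ℂ)‖ + ‖(t : ℂ) * I‖ + ‖z‖ := norm_add₃_le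
      _ ≤ _ := by
        rw [norm_mul, norm_I, norm_real, norm_real, hz, Real.norm_of_nonneg (by linarith),
          Real.norm_eq_abs]
        linarith
  have h2 := norm_zetaL_ge (s := (1 + η : ℝ) + t * I) (by simp; linarith) (by simp; linarith)
    (by simpa)
  have h3 : (((1 + η : ℝ) : ℂ) + t * I).re - 1 = η := by simp
  rw [h3] at h2
  rw [growthExponent, Real.exp_log (by positivity)]
  refine h1.trans ?_
  calc 16 * τ ^ 3 = 2 ^ 14 * τ ^ 3 / η ^ 2 * (η ^ 2 / 1024) := by field_simp; ring
    _ ≤ _ := by gcongr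

lemma growthExponent_pos {η τ : ℝ} (hη : 0 < η) (hη1 : η ≤ 1) (hτ : 3 ≤ τ) :
    0 < growthExponent η τ := by
  refine Real.log_pos ?_
  rw [lt_div_iff₀ (by positivity)]
  have h1 : η ^ 2 ≤ 1 := pow_le_one₀ hη.le hη1
  have h2 : (1 : ℝ) ≤ τ ^ 3 := one_le_pow₀ (by linarith)
  linarith

lemma inv_sub_one_re_le {s : ℂ} (ht : 1 ≤ |s.im|) : (1 / (s - 1)).re ≤ 1 := by
  have h1 : 1 ≤ ‖s - 1‖ := ht.trans (by simpa using abs_im_le_norm (s - 1))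
  refine ((le_abs_self _).trans (abs_re_le_norm _)).trans ?_
  rw [norm_div, norm_one]
  exact div_le_one_of_le₀ h1 (norm_nonneg _)

lemma logDeriv_comp_const_add (f : ℂ → ℂ) (a : ℂ) :
    logDeriv (fun z => f (a + z)) 0 = logDeriv f a := by
  rw [logDeriv_apply, logDeriv_apply, deriv_comp_const_add, add_zero]

/-- Landau's lemma at `1 + η + it`, with the contribution of every zero discarded. -/
lemma re_mangoldtSeries_le {η t τ : ℝ} (hη : 0 < η) (hη1 : η ≤ 1) (ht : 1 ≤ |t|)
    (hτ : |t| + 3 ≤ τ) :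
    (mangoldtSeries ((1 + η : ℝ) + t * I)).re ≤ 8 * growthExponent η τ + 1 := by
  set s : ℂ := (1 + η : ℝ) + t * I with hs
  have hsre : s.re = 1 + η := by simp [hs]
  have hsim : s.im = t := by simp [hs]
  have h1 := neg_re_logDeriv_le (r := 1 / 2) (M := growthExponent η τ) (by norm_num)
    (growthExponent_pos hη hη1 (by linarith)) (f := fun z => zetaL (s + z))
    (differentiable_zetaL.comp (by fun_prop))
    (by rw [add_zero]; exact zetaL_ne_zero_of_one_le_re (by linarith))
    (fun z hz => by rw [add_zero]; exact growth_bound hη hη1 ht hτ hz)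
    (fun z _ hz => by
      by_contra hre
      exact zetaL_ne_zero_of_one_le_re (s := s + z) (by rw [add_re, hsre]; linarith) hz)
  rw [logDeriv_comp_const_add, logDeriv_zetaL (by linarith), sub_re] at h1
  have h2 := inv_sub_one_re_le (s := s) (by rwa [hsim])
  linarith

/-- Landau's lemma at `1 + η + it`, keeping the contribution `1 / d` of a zero at distance `d` to the
left. -/
lemma re_mangoldtSeries_le_sub {η t τ d : ℝ} (hη : 0 < η) (hη1 : η ≤ 1) (ht : 1 ≤ |t|)
    (hτ : |t| + 3 ≤ τ) (hd : 0 < d) (hd2 : d < 1 / 2)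
    (hzero : zetaL ((1 + η : ℝ) + t * I - d) = 0) :
    (mangoldtSeries ((1 + η : ℝ) + t * I)).re ≤ 8 * growthExponent η τ - 1 / d + 3 := by
  set s : ℂ := (1 + η : ℝ) + t * I with hs
  have hsre : s.re = 1 + η := by simp [hs]
  have hsim : s.im = t := by simp [hs]
  have h1 := neg_re_logDeriv_le_sub (r := 1 / 2) (M := growthExponent η τ) (by norm_num)
    (growthExponent_pos hη hη1 (by linarith)) (f := fun z => zetaL (s + z))
    (differentiable_zetaL.comp (by fun_prop))
    (by rw [add_zero]; exact zetaL_ne_zero_of_one_le_re (by linarith))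
    (fun z hz => by rw [add_zero]; exact growth_bound hη hη1 ht hτ hz)
    (fun z _ hz => by
      by_contra hre
      exact zetaL_ne_zero_of_one_le_re (s := s + z) (by rw [add_re, hsre]; linarith) hz)
    hd hd2 (by rw [← sub_eq_add_neg]; exact hzero)
  rw [logDeriv_comp_const_add, logDeriv_zetaL (by linarith), sub_re] at h1
  have h2 := inv_sub_one_re_le (s := s) (by rwa [hsim])
  have h3 : d / (1 / 2) ^ 2 = 4 * d := by ring
  rw [h3] at h1
  linarith

/-- Near `1` the series is governed by the pole of zeta; `1 / η` is its contribution. -/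
lemma exists_re_mangoldtSeries_real_le : ∃ C : ℝ, 0 ≤ C ∧ ∀ η : ℝ, 0 < η → η ≤ 1 →
    (mangoldtSeries ((1 + η : ℝ) : ℂ)).re ≤ 1 / η + C := by
  have hc : ContinuousOn (fun x : ℝ => logDeriv zetaL (x : ℂ)) (Icc 1 2) := by
    have h1 : Continuous (deriv zetaL) :=
      (differentiable_zetaL.contDiff (n := 1)).continuous_deriv le_rfl
    have h2 := differentiable_zetaL.continuous
    refine ContinuousOn.div (by fun_prop) (by fun_prop) fun x hx => ?_
    exact zetaL_ne_zero_of_one_le_re (by simpa using hx.1)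
  obtain ⟨C, hC⟩ := isCompact_Icc.exists_bound_of_continuousOn hc
  refine ⟨C, (norm_nonneg _).trans (hC 1 (by simp)), fun η hη hη1 => ?_⟩
  have h1 := hC (1 + η) ⟨by linarith, by linarith⟩
  rw [logDeriv_zetaL (by simpa using hη)] at h1
  have h2 := (neg_le_abs _).trans ((abs_re_le_norm _).trans h1)
  have h3 : (1 / (((1 + η : ℝ) : ℂ) - 1)).re = 1 / η := by
    have : (1 / (((1 + η : ℝ) : ℂ) - 1)) = ((1 / η : ℝ) : ℂ) := by push_cast; ring
    rw [this, ofReal_re]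
  rw [sub_re, h3] at h2
  linarith

lemma growthExponent_le {N l τ : ℝ} (hN : 1 ≤ N) (hτ : 3 ≤ τ) (hl : l = Real.log τ) (hl1 : 1 ≤ l) :
    growthExponent (1 / (N ^ 2 * l)) (2 * τ) ≤ (22 + 4 * N) * l := by
  have hl0 : 0 < l := by linarith
  have h1 : 2 ^ 14 * (2 * τ) ^ 3 / (1 / (N ^ 2 * l)) ^ 2 = 2 ^ 17 * τ ^ 3 * (N ^ 4 * l ^ 2) := by
    field_simp
  have h2 : Real.log 2 ≤ 0.7 := by have := Real.log_two_lt_d9; linarith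
  have h3 : Real.log N ≤ N := (Real.log_le_sub_one_of_pos (by linarith)).trans (by linarith)
  have h4 : Real.log l ≤ l := (Real.log_le_sub_one_of_pos hl0).trans (by linarith)
  rw [growthExponent, h1, Real.log_mul (by positivity) (by positivity),
    Real.log_mul (by positivity) (by positivity), Real.log_mul (by positivity) (by positivity),
    Real.log_pow, Real.log_pow, Real.log_pow, Real.log_pow, ← hl]
  push_cast
  nlinarith

/-- The zero-free region away from the real axis. -/
lemma exists_zero_free_of_one_le_abs_im : ∃ c : ℝ, 0 < c ∧ ∀ s : ℂ, 1 ≤ |s.im| →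
    1 - c / Real.log (|s.im| + 3) ≤ s.re → zetaL s ≠ 0 := by
  obtain ⟨C, hC0, hC⟩ := exists_re_mangoldtSeries_real_le
  -- Take `η = 1 / (N² log τ)`: the growth term is `O(N log τ)`, which for large `N` is small against
  -- `1 / η = N² log τ`, so that `4 / d ≤ 3 / η + O(N log τ)` keeps `d` away from `η`.
  set N : ℝ := 1000 + C with hN
  refine ⟨1 / (8 * N ^ 2), by positivity, fun s ht hre hzero => ?_⟩
  set t := s.im
  set τ := |t| + 3 with hτ
  have hτ4 : 4 ≤ τ := by linarith
  obtain ⟨l, hl⟩ : ∃ l, l = Real.log τ := ⟨_, rfl⟩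
  have hl1 : 1 ≤ l := by
    rw [hl, Real.le_log_iff_exp_le (by linarith)]
    have := Real.exp_one_lt_d9
    linarith
  have hl0 : 0 < l := by linarith
  set η : ℝ := 1 / (N ^ 2 * l) with hη
  have hη0 : 0 < η := by positivity
  have hη1 : η ≤ 1 / 1000 := by
    rw [hη]
    refine one_div_le_one_div_of_le (by norm_num) ?_
    nlinarith
  have hre' : 1 - η / 8 ≤ s.re := by
    rw [← hl] at hre
    have : η / 8 = 1 / (8 * N ^ 2) / l := by rw [hη]; field_simp
    rwa [this]
  have hs1 : s.re < 1 := by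
    by_contra h
    exact zetaL_ne_zero_of_one_le_re (not_lt.1 h) hzero
  set d := 1 + η - s.re with hd
  have hd0 : 0 < d := by linarith
  have hseq : ((1 + η : ℝ) : ℂ) + t * I - d = s := by
    apply Complex.ext <;> simp [hd, t]
  have h341 := three_four_one (σ := 1 + η) (by linarith) t
  have hA := hC η hη0 (by linarith)
  have hB := re_mangoldtSeries_le_sub (τ := 2 * τ) (d := d) hη0 (by linarith) ht (by linarith) hd0
    (by linarith) (by rw [hseq]; exact hzero)
  have habs : |2 * t| = 2 * |t| := by rw [abs_mul, abs_two]
  have hD := re_mangoldtSeries_le (t := 2 * t) (τ := 2 * τ) hη0 (by linarith)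
    (by rw [habs]; linarith) (by rw [habs]; linarith)
  have hM := growthExponent_le (N := N) (l := l) (τ := τ) (by linarith) (by linarith) hl hl1
  rw [← hη] at hM
  have hfin : 4 / d ≤ 3 / η + (160 * N + 893 + 3 * C) * l := by
    have h1 : 4 / d = 4 * (1 / d) := by ring
    have h2 : 3 / η = 3 * (1 / η) := by ring
    rw [h1, h2]
    nlinarith
  have hηi : 1 / η = N ^ 2 * l := by rw [hη, one_div_one_div]
  have h4 : 4 / d ≤ 7 / 2 * (1 / η) := by
    refine hfin.trans ?_
    have h5 : 160 * N + 893 + 3 * C ≤ N ^ 2 / 2 := by nlinarith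
    have h6 : 3 / η = 3 * (1 / η) := by ring
    rw [h6, hηi]
    nlinarith
  rw [mul_one_div, div_le_div_iff₀ hd0 hη0] at h4
  linarith

/-- A zero-free strip for bounded height. -/
lemma exists_zero_free_of_abs_im_le_one : ∃ c : ℝ, 0 < c ∧ ∀ s : ℂ, |s.im| ≤ 1 →
    1 - c ≤ s.re → zetaL s ≠ 0 := by
  by_cases hne : ({s : ℂ | zetaL s = 0} ∩ (Icc (1 / 2) 1 ×ℂ Icc (-1) 1)).Nonempty
  · have hK : IsCompact ({s : ℂ | zetaL s = 0} ∩ (Icc (1 / 2) 1 ×ℂ Icc (-1) 1)) :=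
      (isCompact_Icc.reProdIm isCompact_Icc).inter_left
        (isClosed_eq differentiable_zetaL.continuous continuous_const)
    obtain ⟨w, hw, hmax⟩ := hK.exists_isMaxOn hne continuous_re.continuousOn
    have hw1 : w.re < 1 := by
      by_contra h
      exact zetaL_ne_zero_of_one_le_re (not_lt.1 h) hw.1
    have hw2 : 1 / 2 ≤ w.re := hw.2.1.1
    refine ⟨(1 - w.re) / 2, by linarith, fun s him hre hs => ?_⟩
    have hs1 : s.re < 1 := by
      by_contra h
      exact zetaL_ne_zero_of_one_le_re (not_lt.1 h) hs
    have := hmax (show s ∈ {s : ℂ | zetaL s = 0} ∩ (Icc (1 / 2) 1 ×ℂ Icc (-1) 1) from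
      ⟨hs, ⟨by linarith, hs1.le⟩, abs_le.1 him⟩)
    simp only [mem_ofPred_eq] at this
    linarith
  · refine ⟨1 / 2, by norm_num, fun s him hre hs => hne ⟨s, hs, ⟨by linarith, ?_⟩, abs_le.1 him⟩⟩
    by_contra h
    exact zetaL_ne_zero_of_one_le_re (not_le.1 h).le hs

/-- The classical zero-free region of de la Vallée Poussin for `ζ(s) L(s, χ₄)`. -/
theorem exists_zero_free_region : ∃ c : ℝ, 0 < c ∧ ∀ T : ℝ, 2 ≤ T → ∀ s : ℂ, |s.im| ≤ T →
    1 - c / Real.log T ≤ s.re → zetaL s ≠ 0 := by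
  obtain ⟨c₁, hc₁, h₁⟩ := exists_zero_free_of_one_le_abs_im
  obtain ⟨c₂, hc₂, h₂⟩ := exists_zero_free_of_abs_im_le_one
  refine ⟨min (c₁ / 3) (c₂ / 2), by positivity, fun T hT s him hre => ?_⟩
  have hlog : 0 < Real.log T := Real.log_pos (by linarith)
  rcases le_total |s.im| 1 with h | h
  · refine h₂ s h (le_trans ?_ hre)
    have h3 : 1 / 2 ≤ Real.log T := by
      have := Real.log_two_gt_d9
      have := Real.log_le_log (by norm_num) hT
      linarith
    have h4 : min (c₁ / 3) (c₂ / 2) / Real.log T ≤ c₂ := by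
      rw [div_le_iff₀ hlog]
      have := min_le_right (c₁ / 3) (c₂ / 2)
      nlinarith
    linarith
  · refine h₁ s h (le_trans ?_ hre)
    have h3 : Real.log (|s.im| + 3) ≤ 3 * Real.log T := by
      have : 3 * Real.log T = Real.log (T ^ 3) := by rw [Real.log_pow]; norm_num
      rw [this]
      refine Real.log_le_log (by positivity) ?_
      nlinarith [sq_nonneg (T - 2)]
    have h4 : 0 < Real.log (|s.im| + 3) := Real.log_pos (by linarith)
    have h5 : min (c₁ / 3) (c₂ / 2) / Real.log T ≤ c₁ / Real.log (|s.im| + 3) := by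
      rw [div_le_div_iff₀ hlog h4]
      have := min_le_left (c₁ / 3) (c₂ / 2)
      nlinarith
    linarith

/-! ### Square roots on cut half-planes -/

section sqrtBranch
variable {f : ℂ → ℂ}

lemma isOpen_cutHalfPlane (hf : Continuous f) (hne : ∀ s : ℂ, 1 ≤ s.re → f s ≠ 0) :
    IsOpen (cutHalfPlane f) := by
  rw [Metric.isOpen_iff]
  intro s hs
  have hK : IsCompact ((fun t : ℝ => s + t) '' Icc 0 1) := isCompact_Icc.image (by fun_prop)
  have hO : IsOpen {z : ℂ | f z ≠ 0} := isOpen_ne_fun hf continuous_const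
  obtain ⟨δ, hδ, hsub⟩ := hK.exists_thickening_subset_open hO (by
    rintro _ ⟨t, ht, rfl⟩; exact hs.2 t ht.1)
  obtain ⟨r, hr, hball⟩ := Metric.isOpen_iff.1 (isOpen_re_gt (1 / 2)) s hs.1
  refine ⟨min δ r, lt_min hδ hr, fun z hz => ?_⟩
  have hz1 : 1 / 2 < z.re := hball (Metric.ball_subset_ball (min_le_right _ _) hz)
  refine ⟨hz1, fun t ht => ?_⟩
  rcases le_total t 1 with h | h
  · refine hsub (Metric.mem_thickening_iff.2 ⟨s + t, ⟨t, ⟨ht, h⟩, rfl⟩, ?_⟩)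
    rw [dist_add_right]
    exact (Metric.mem_ball.1 hz).trans_le (min_le_left _ _)
  · exact hne _ (by simp; linarith)

lemma mem_cutHalfPlane_of_one_le_re (hne : ∀ s : ℂ, 1 ≤ s.re → f s ≠ 0) {s : ℂ} (hs : 1 ≤ s.re) :
    s ∈ cutHalfPlane f :=
  ⟨by linarith, fun t ht => hne _ (by simp; linarith)⟩

lemma add_mem_cutHalfPlane {s : ℂ} (hs : s ∈ cutHalfPlane f) {t : ℝ} (ht : 0 ≤ t) :
    s + t ∈ cutHalfPlane f :=
  ⟨by have := hs.1; simp; linarith, fun t' ht' => by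
    have := hs.2 (t + t') (by positivity)
    rwa [ofReal_add, ← add_assoc] at this⟩

/-- The cut half-plane is contractible: translate it to the right into the half-plane `Re s ≥ 1`,
which is convex, and contract there. -/
lemma isSimplyConnected_cutHalfPlane (hne : ∀ s : ℂ, 1 ≤ s.re → f s ≠ 0) :
    IsSimplyConnected (cutHalfPlane f) := by
  let shift : C(cutHalfPlane f, cutHalfPlane f) :=
    ⟨fun s => ⟨s + (2 : ℝ), add_mem_cutHalfPlane s.2 zero_le_two⟩, by fun_prop⟩
  let p : cutHalfPlane f := ⟨4, mem_cutHalfPlane_of_one_le_re hne (by simp)⟩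
  have h1 : (ContinuousMap.id (cutHalfPlane f)).Homotopic shift :=
    ⟨{ toFun := fun x => ⟨x.2 + (2 * x.1 : ℝ), add_mem_cutHalfPlane x.2.2
          (mul_nonneg zero_le_two x.1.2.1)⟩
       continuous_toFun := by fun_prop
       map_zero_left := fun s => by ext; simp
       map_one_left := fun s => by ext; simp [shift] }⟩
  have h2 : shift.Homotopic (ContinuousMap.const _ p) :=
    ⟨{ toFun := fun x => ⟨(1 - (x.1 : ℝ) : ℝ) * (x.2 + 2) + (x.1 : ℝ) * 4,
          mem_cutHalfPlane_of_one_le_re hne (by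
            have h3 := x.2.2.1
            have h4 := x.1.2.1
            have h5 := x.1.2.2
            rw [add_re, re_ofReal_mul, re_ofReal_mul, add_re]
            simp only [re_ofNat]
            nlinarith)⟩
       continuous_toFun := by fun_prop
       map_zero_left := fun s => by ext; simp [shift]
       map_one_left := fun s => by ext; simp [p] }⟩
  have : ContractibleSpace (cutHalfPlane f) :=
    (contractible_iff_id_nullhomotopic _).2 ⟨p, h1.trans h2⟩
  exact SimplyConnectedSpace.ofContractible _

/-- A continuous square root of a nonvanishing differentiable function is differentiable: near `a` the
difference quotient of `f = h ^ 2` is that of `h` times `h s + h a`, and the latter tends to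
`2 h a ≠ 0`. -/
lemma differentiableOn_of_sq_eq {h : ℂ → ℂ} {U : Set ℂ} (hU : IsOpen U) (hf : Differentiable ℂ f)
    (hh : ContinuousOn h U) (hsq : ∀ s ∈ U, h s ^ 2 = f s) (hne : ∀ s ∈ U, f s ≠ 0) :
    DifferentiableOn ℂ h U := by
  intro a ha
  have hha : h a ≠ 0 := fun h0 => hne a ha (by rw [← hsq a ha, h0]; simp)
  have hc : ContinuousAt h a := hh.continuousAt (hU.mem_nhds ha)
  refine DifferentiableAt.differentiableWithinAt
    (HasDerivAt.differentiableAt (f' := deriv f a / (h a + h a)) ?_)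
  rw [hasDerivAt_iff_tendsto_slope]
  have h1 := (hasDerivAt_iff_tendsto_slope.1 (hf a).hasDerivAt)
  have h2 : Tendsto (fun z => h z + h a) (𝓝[≠] a) (𝓝 (h a + h a)) :=
    (hc.tendsto.mono_left nhdsWithin_le_nhds).add_const _
  have h3 : h a + h a ≠ 0 := by rw [← two_mul]; exact mul_ne_zero two_ne_zero hha
  refine (h1.div h2 h3).congr' ?_
  filter_upwards [nhdsWithin_le_nhds (hU.mem_nhds ha), h2.eventually_ne h3] with z hz hz2
  simp only [Pi.div_apply, slope_def_field]
  rw [← hsq z hz, ← hsq a ha]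
  field_simp
  ring

/-- The analytic branch of the square root exists as soon as `f` has no zeros for `Re s ≥ 1` and is
positive on the real half-line. -/
theorem exists_isSqrtBranch (hf : Differentiable ℂ f) (hne : ∀ s : ℂ, 1 ≤ s.re → f s ≠ 0)
    (hpos : ∀ σ : ℝ, 0 < σ → ∃ y : ℝ, 0 < y ∧ f σ = y) : ∃ h, IsSqrtBranch f h := by
  have hO := isOpen_cutHalfPlane hf.continuous hne
  have hne0 : ∀ s ∈ cutHalfPlane f, f s ≠ 0 := fun s hs => by simpa using hs.2 0 le_rfl
  have hmem : ∀ σ : ℝ, 1 / 2 < σ → (σ : ℂ) ∈ cutHalfPlane f := fun σ hσ =>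
    ⟨by simpa using hσ, fun t ht => by
      obtain ⟨y, hy, he⟩ := hpos (σ + t) (by linarith)
      rw [← ofReal_add, he]
      exact ofReal_ne_zero.2 hy.ne'⟩
  obtain ⟨h₀, hc, hsq⟩ := exists_continuousOn_pow_eq (isSimplyConnected_cutHalfPlane hne) hO
    hf.continuous.continuousOn (fun ⟨s, hs, h0⟩ => hne0 s hs h0) two_ne_zero
  obtain ⟨y, hy, he⟩ := hpos 1 one_pos
  have h1 : h₀ 1 ^ 2 = y := by rw [hsq, ← he, ofReal_one]
  have hy0 : (y : ℂ) ≠ 0 := ofReal_ne_zero.2 hy.ne'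
  have h10 : h₀ 1 ≠ 0 := fun h0 => hy0 (by rw [← h1, h0]; simp)
  -- the sign `c` makes the branch positive at `1`, hence on the whole half-line
  set c : ℂ := (Real.sqrt y : ℝ) / h₀ 1 with hcdef
  have hc2 : c ^ 2 = 1 := by
    rw [hcdef, div_pow, h1, ← ofReal_pow, Real.sq_sqrt hy.le, div_self hy0]
  have hsq' : ∀ s, (c * h₀ s) ^ 2 = f s := fun s => by rw [mul_pow, hc2, one_mul, hsq]
  have hcont : ContinuousOn (fun s => c * h₀ s) (cutHalfPlane f) := continuousOn_const.mul hc
  refine ⟨fun s => c * h₀ s, ⟨?_, fun s _ => hsq' s, fun σ hσ => ⟨hmem σ hσ, ?_⟩⟩⟩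
  · exact (differentiableOn_of_sq_eq hO hf hcont (fun s _ => hsq' s) hne0).analyticOnNhd hO
  · have key : EqOn (fun σ : ℝ => c * h₀ σ) (fun σ : ℝ => ((Real.sqrt (f σ).re : ℝ) : ℂ))
        (Ioi (1 / 2)) := by
      have hfc := hf.continuous
      refine (isPreconnected_Ioi (a := (1 / 2 : ℝ))).eq_of_sq_eq
        (hcont.comp continuous_ofReal.continuousOn fun σ hσ => hmem σ hσ)
        (Continuous.continuousOn (by fun_prop)) (fun σ hσ => ?_) (fun {σ} hσ => ?_)
        (y := 1) (by norm_num) ?_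
      · obtain ⟨z, hz, hfz⟩ := hpos σ (by linarith [mem_Ioi.1 hσ])
        simp only [Pi.pow_apply]
        rw [hsq', hfz, ofReal_re, ← ofReal_pow, Real.sq_sqrt hz.le]
      · obtain ⟨z, hz, hfz⟩ := hpos σ (by linarith [mem_Ioi.1 hσ])
        rw [hfz, ofReal_re]
        exact ofReal_ne_zero.2 (Real.sqrt_pos.2 hz).ne'
      · rw [he, ofReal_re, hcdef, ofReal_one, div_mul_cancel₀ _ h10]
    obtain ⟨z, hz, hfz⟩ := hpos σ (by linarith)
    have h2 : c * h₀ σ = ((Real.sqrt (f σ).re : ℝ) : ℂ) := key hσ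
    rw [h2, hfz, ofReal_re, ofReal_re, ofReal_im]
    exact ⟨Real.sqrt_pos.2 hz, rfl⟩

end sqrtBranch

/-! ### The Euler factors of `G` at `2` and at the primes congruent to `3` modulo `4` -/

/-- The set of primes congruent to `3` modulo `4`, as a type. -/
abbrev PrimesThree : Type := {p : ℕ // p.Prime ∧ p % 4 = 3}

/-- The series of logarithms of the factors `(1 - p^{-2s})^{-1/2}`. -/
noncomputable def logThree (s : ℂ) : ℂ :=
  ∑' p : PrimesThree, log (1 - ((p : ℕ) : ℂ) ^ (-2 * s)) * (-(1 / 2))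

lemma norm_prime_cpow_le {δ : ℝ} {s : ℂ} (hs : 1 / 2 + δ ≤ s.re) (p : PrimesThree) :
    ‖((p : ℕ) : ℂ) ^ (-2 * s)‖ ≤ ((p : ℕ) : ℝ) ^ (-(1 + 2 * δ)) := by
  have hp := p.2.1.pos
  rw [norm_natCast_cpow_of_pos hp]
  refine Real.rpow_le_rpow_of_exponent_le (by exact_mod_cast hp) ?_
  have : (-2 * s).re = -2 * s.re := by simp
  rw [this]; linarith

lemma norm_prime_cpow_le_half {s : ℂ} (hs : 1 / 2 ≤ s.re) (p : PrimesThree) :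
    ‖((p : ℕ) : ℂ) ^ (-2 * s)‖ ≤ 1 / 2 := by
  refine (norm_prime_cpow_le (δ := 0) (by linarith) p).trans ?_
  have hp : (2 : ℝ) ≤ (p : ℕ) := by exact_mod_cast p.2.1.two_le
  rw [mul_zero, add_zero, Real.rpow_neg_one, inv_le_comm₀ (by linarith) (by norm_num)]
  linarith

lemma one_sub_prime_cpow_ne_zero {s : ℂ} (hs : 1 / 2 ≤ s.re) (p : PrimesThree) :
    1 - ((p : ℕ) : ℂ) ^ (-2 * s) ≠ 0 := fun h => by
  have h1 := norm_prime_cpow_le_half hs p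
  rw [← sub_eq_zero.1 h, norm_one] at h1
  norm_num at h1

lemma norm_log_three_le {δ : ℝ} (hδ : 0 ≤ δ) {s : ℂ} (hs : 1 / 2 + δ ≤ s.re) (p : PrimesThree) :
    ‖log (1 - ((p : ℕ) : ℂ) ^ (-2 * s)) * (-(1 / 2))‖ ≤ ((p : ℕ) : ℝ) ^ (-(1 + 2 * δ)) := by
  have h1 := norm_log_one_add_half_le_self (z := -((p : ℕ) : ℂ) ^ (-2 * s))
    (by rw [norm_neg]; exact norm_prime_cpow_le_half (by linarith) p)
  rw [norm_neg, ← sub_eq_add_neg] at h1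
  have h2 := norm_prime_cpow_le hs p
  rw [norm_mul]
  have h3 : ‖(-(1 / 2) : ℂ)‖ = 1 / 2 := by norm_num
  rw [h3]
  have h4 := norm_nonneg (((p : ℕ) : ℂ) ^ (-2 * s))
  linarith

lemma summable_primesThree {δ : ℝ} (hδ : 0 < δ) :
    Summable fun p : PrimesThree => ((p : ℕ) : ℝ) ^ (-(1 + 2 * δ)) :=
  (Real.summable_nat_rpow.2 (by linarith)).subtype _

lemma summable_log_three {s : ℂ} (hs : 1 / 2 < s.re) :
    Summable fun p : PrimesThree => log (1 - ((p : ℕ) : ℂ) ^ (-2 * s)) * (-(1 / 2)) :=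
  Summable.of_norm_bounded (summable_primesThree (δ := s.re - 1 / 2) (by linarith))
    fun p => norm_log_three_le (by linarith) (by linarith) p

lemma hasProd_three {s : ℂ} (hs : 1 / 2 < s.re) :
    HasProd (fun p : PrimesThree => (1 - ((p : ℕ) : ℂ) ^ (-2 * s)) ^ (-(1 / 2) : ℂ))
      (exp (logThree s)) := by
  rw [logThree]
  convert (summable_log_three hs).hasSum.cexp using 1
  funext p
  rw [Function.comp_apply, cpow_def_of_ne_zero (one_sub_prime_cpow_ne_zero hs.le p)]

lemma norm_logThree_le {δ : ℝ} (hδ : 0 < δ) {s : ℂ} (hs : 1 / 2 + δ ≤ s.re) :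
    ‖logThree s‖ ≤ ∑' p : PrimesThree, ((p : ℕ) : ℝ) ^ (-(1 + 2 * δ)) :=
  tsum_of_norm_bounded (summable_primesThree hδ).hasSum fun p => norm_log_three_le hδ.le hs p

lemma differentiableAt_logThree {s : ℂ} (hs : 1 / 2 < s.re) : DifferentiableAt ℂ logThree s := by
  set δ := (s.re - 1 / 2) / 2 with hδ
  have hδ0 : 0 < δ := by linarith
  have hO := isOpen_re_gt (1 / 2 + δ)
  refine (differentiableOn_tsum_of_summable_norm (summable_primesThree hδ0) (fun p => ?_) hO
    fun p w hw => norm_log_three_le hδ0.le (le_of_lt hw) p).differentiableAt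
      (hO.mem_nhds (show 1 / 2 + δ < s.re by linarith))
  intro w hw
  have hw' : 1 / 2 ≤ w.re := by have : 1 / 2 + δ < w.re := hw; linarith
  have hp : ((p : ℕ) : ℂ) ≠ 0 := Nat.cast_ne_zero.2 p.2.1.ne_zero
  have hslit : 1 - ((p : ℕ) : ℂ) ^ (-2 * w) ∈ slitPlane := by
    rw [sub_eq_add_neg]
    refine mem_slitPlane_of_norm_lt_one ?_
    rw [norm_neg]
    linarith [norm_prime_cpow_le_half hw' p]
  have hd : DifferentiableAt ℂ (fun w : ℂ => 1 - ((p : ℕ) : ℂ) ^ (-2 * w)) w :=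
    (DifferentiableAt.const_cpow (by fun_prop) (Or.inl hp)).const_sub 1
  exact ((hd.clog hslit).mul_const _).differentiableWithinAt

/-- The two factors of `G` other than the square roots. -/
noncomputable def eulerFactor (s : ℂ) : ℂ :=
  (1 - (2 : ℂ) ^ (-s)) ^ (-(1 / 2) : ℂ) * exp (logThree s)

lemma G_eq {A B : ℂ → ℂ} {s : ℂ} (hs : 1 / 2 < s.re) : G A B s = A s * B s * eulerFactor s := by
  rw [G, (hasProd_three hs).tprod_eq, eulerFactor, mul_assoc]

lemma norm_two_cpow_le {s : ℂ} (hs : 1 / 2 ≤ s.re) : ‖(2 : ℂ) ^ (-s)‖ ≤ 3 / 4 := by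
  have h0 : ‖(2 : ℂ) ^ (-s)‖ = (2 : ℝ) ^ (-s.re) := by
    have := norm_cpow_eq_rpow_re_of_pos (x := 2) two_pos (-s)
    simpa using this
  have h1 : (2 : ℝ) ^ (-s.re) ≤ (2 : ℝ) ^ (-(1 / 2) : ℝ) :=
    Real.rpow_le_rpow_of_exponent_le one_le_two (by linarith)
  have h2 : ((2 : ℝ) ^ (-(1 / 2) : ℝ)) ^ 2 = 1 / 2 := by
    rw [← Real.rpow_natCast, ← Real.rpow_mul zero_le_two]
    norm_num [Real.rpow_neg_one]
  have h3 : (2 : ℝ) ^ (-(1 / 2) : ℝ) ≤ 3 / 4 := by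
    refine le_of_sq_le_sq (?_ : _ ≤ (3 / 4 : ℝ) ^ 2) (by norm_num)
    rw [h2]; norm_num
  rw [h0]; exact h1.trans h3

lemma quarter_le_norm_one_sub_two_cpow {s : ℂ} (hs : 1 / 2 ≤ s.re) :
    1 / 4 ≤ ‖1 - (2 : ℂ) ^ (-s)‖ := by
  have h1 := norm_sub_norm_le (1 : ℂ) ((2 : ℂ) ^ (-s))
  rw [norm_one] at h1
  linarith [norm_two_cpow_le hs]

lemma one_sub_two_cpow_ne_zero {s : ℂ} (hs : 1 / 2 ≤ s.re) : 1 - (2 : ℂ) ^ (-s) ≠ 0 :=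
  norm_pos_iff.1 (by linarith [quarter_le_norm_one_sub_two_cpow hs])

lemma differentiableAt_eulerFactor {s : ℂ} (hs : 1 / 2 < s.re) :
    DifferentiableAt ℂ eulerFactor s := by
  have hslit : 1 - (2 : ℂ) ^ (-s) ∈ slitPlane := by
    rw [sub_eq_add_neg]
    refine mem_slitPlane_of_norm_lt_one ?_
    rw [norm_neg]
    linarith [norm_two_cpow_le hs.le]
  have hd : DifferentiableAt ℂ (fun w : ℂ => 1 - (2 : ℂ) ^ (-w)) s :=
    (DifferentiableAt.const_cpow (by fun_prop) (Or.inl two_ne_zero)).const_sub 1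
  exact (hd.cpow_const hslit).mul (differentiableAt_logThree hs).cexp

lemma eulerFactor_ne_zero {s : ℂ} (hs : 1 / 2 < s.re) : eulerFactor s ≠ 0 := by
  refine mul_ne_zero ?_ (exp_ne_zero _)
  rw [cpow_def_of_ne_zero (one_sub_two_cpow_ne_zero hs.le)]
  exact exp_ne_zero _

lemma exists_norm_eulerFactor_le {δ : ℝ} (hδ : 0 < δ) :
    ∃ C : ℝ, 0 < C ∧ ∀ s : ℂ, 1 / 2 + δ ≤ s.re → ‖eulerFactor s‖ ≤ C := by
  refine ⟨2 * Real.exp (∑' p : PrimesThree, ((p : ℕ) : ℝ) ^ (-(1 + 2 * δ))), by positivity,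
    fun s hs => ?_⟩
  rw [eulerFactor, norm_mul, norm_exp]
  gcongr
  · have h1 : (-(1 / 2) : ℂ) = ((-(1 / 2) : ℝ) : ℂ) := by push_cast; rfl
    rw [h1, norm_cpow_real]
    refine (Real.rpow_le_rpow_of_nonpos (by norm_num)
      (quarter_le_norm_one_sub_two_cpow (by linarith)) (by norm_num)).trans (le_of_eq ?_)
    have h4 : (1 / 4 : ℝ) = 2 ^ (-2 : ℝ) := by norm_num
    rw [h4, ← Real.rpow_mul zero_le_two]; norm_num
  · exact (re_le_norm _).trans (norm_logThree_le hδ hs)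

lemma natCast_cpow_ofReal (p : ℕ) (σ : ℝ) : (p : ℂ) ^ (σ : ℂ) = (((p : ℝ) ^ σ : ℝ) : ℂ) := by
  rw [ofReal_cpow (Nat.cast_nonneg p), ofReal_natCast]

lemma eulerFactor_two_pos : ∃ y : ℝ, 0 < y ∧ eulerFactor 2 = y := by
  have h1 : logThree 2 = ((∑' p : PrimesThree,
      Real.log (1 - ((p : ℕ) : ℝ) ^ (-4 : ℝ)) * (-(1 / 2)) : ℝ) : ℂ) := by
    rw [logThree, ofReal_tsum]
    congr 1
    funext p
    have h2 : (-2 * 2 : ℂ) = ((-4 : ℝ) : ℂ) := by norm_num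
    have h3 : ((p : ℕ) : ℝ) ^ (-4 : ℝ) ≤ 1 :=
      Real.rpow_le_one_of_one_le_of_nonpos (by exact_mod_cast p.2.1.pos) (by norm_num)
    rw [h2, natCast_cpow_ofReal]
    push_cast [ofReal_log (sub_nonneg.2 h3)]
    ring
  refine ⟨(1 - (2 : ℝ) ^ (-2 : ℝ)) ^ (-(1 / 2) : ℝ) * Real.exp (∑' p : PrimesThree,
      Real.log (1 - ((p : ℕ) : ℝ) ^ (-4 : ℝ)) * (-(1 / 2))), ?_, ?_⟩
  · have : (0 : ℝ) < 1 - (2 : ℝ) ^ (-2 : ℝ) := by norm_num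
    positivity
  · rw [eulerFactor, h1, ofReal_mul, ofReal_exp, ofReal_cpow (by norm_num)]
    congr 2
    · norm_num [cpow_neg]
    · push_cast; rfl

/-! ### The Dirichlet series of the sums of two squares -/

/-- The indicator function of the sums of two squares. -/
noncomputable def twoSquaresCoeff : ℕ → ℝ := sumsOfTwoSquares.indicator fun _ => 1

lemma twoSquaresCoeff_nonneg (n : ℕ) : 0 ≤ twoSquaresCoeff n :=
  indicator_nonneg (fun _ _ => zero_le_one) n

lemma twoSquaresCoeff_le_one (n : ℕ) : twoSquaresCoeff n ≤ 1 :=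
  indicator_le_self' (fun _ _ => zero_le_one) n

/-- The two-squares theorem. The number `0` satisfies both sides, by `padicValNat q 0 = 0`. -/
lemma mem_sumsOfTwoSquares_iff (n : ℕ) :
    n ∈ sumsOfTwoSquares ↔ ∀ q : ℕ, q.Prime → q % 4 = 3 → Even (padicValNat q n) := by
  have h1 : n ∈ sumsOfTwoSquares ↔ ∃ x y : ℕ, n = x ^ 2 + y ^ 2 := by
    constructor
    · rintro ⟨a, b, h⟩
      refine ⟨a.natAbs, b.natAbs, ?_⟩
      zify
      simpa using h
    · rintro ⟨x, y, h⟩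
      exact ⟨x, y, by exact_mod_cast h⟩
  rw [h1, Nat.eq_sq_add_sq_iff]
  refine ⟨fun h q hq hq4 => ?_, fun h q hq => h q (Nat.prime_of_mem_primeFactors hq)⟩
  by_cases hqn : q ∈ n.primeFactors
  · exact h q hqn hq4
  · have : padicValNat q n = 0 := by
      rw [padicValNat.eq_zero_iff]
      by_cases hn : n = 0
      · exact Or.inr (Or.inl hn)
      · exact Or.inr (Or.inr fun hd => hqn (Nat.mem_primeFactors.2 ⟨hq, hd, hn⟩))
    rw [this]; exact Even.zero

lemma twoSquaresCoeff_eq (n : ℕ) [Decidable (n ∈ sumsOfTwoSquares)] :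
    twoSquaresCoeff n = if n ∈ sumsOfTwoSquares then 1 else 0 := by
  rw [twoSquaresCoeff, indicator_apply]

lemma twoSquaresCoeff_one : twoSquaresCoeff 1 = 1 :=
  indicator_of_mem (show 1 ∈ sumsOfTwoSquares from ⟨1, 0, by norm_num⟩) _

lemma twoSquaresCoeff_mul {m n : ℕ} (hmn : m.Coprime n) (hm : m ≠ 0) (hn : n ≠ 0) :
    twoSquaresCoeff (m * n) = twoSquaresCoeff m * twoSquaresCoeff n := by
  classical
  have h : m * n ∈ sumsOfTwoSquares ↔ m ∈ sumsOfTwoSquares ∧ n ∈ sumsOfTwoSquares := by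
    simp only [mem_sumsOfTwoSquares_iff, ← forall_and]
    refine forall_congr' fun q => forall_congr' fun hq => forall_congr' fun _ => ?_
    have := Fact.mk hq
    rw [padicValNat.mul hm hn]
    have h0 : padicValNat q m = 0 ∨ padicValNat q n = 0 := by
      by_contra! hc
      have h1 := dvd_of_one_le_padicValNat (Nat.one_le_iff_ne_zero.2 hc.1)
      have h2 := dvd_of_one_le_padicValNat (Nat.one_le_iff_ne_zero.2 hc.2)
      exact hq.one_lt.ne' (Nat.Coprime.eq_one_of_dvd (hmn.coprime_dvd_left h1) h2)
    rcases h0 with h0 | h0 <;> simp [h0]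
  rw [twoSquaresCoeff_eq, twoSquaresCoeff_eq, twoSquaresCoeff_eq]
  by_cases h1 : m ∈ sumsOfTwoSquares <;> by_cases h2 : n ∈ sumsOfTwoSquares <;> simp [h, h1, h2]

lemma twoSquaresCoeff_prime_pow {p : ℕ} (hp : p.Prime) (e : ℕ) :
    twoSquaresCoeff (p ^ e) = if p % 4 = 3 ∧ ¬ Even e then 0 else 1 := by
  classical
  have h : p ^ e ∈ sumsOfTwoSquares ↔ ¬ (p % 4 = 3 ∧ ¬ Even e) := by
    rw [mem_sumsOfTwoSquares_iff]
    constructor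
    · rintro h ⟨h1, h2⟩
      have := Fact.mk hp
      have h3 := h p hp h1
      rw [padicValNat.prime_pow] at h3
      exact h2 h3
    · intro h q hq hq4
      have := Fact.mk hq
      have := Fact.mk hp
      by_cases hqp : q = p
      · subst hqp
        rw [padicValNat.prime_pow]
        by_contra he
        exact h ⟨hq4, he⟩
      · rw [padicValNat.pow, padicValNat_primes hqp]
        simp
  rw [twoSquaresCoeff_eq]
  simp only [h]
  split_ifs <;> simp_all

/-- The Dirichlet series of the sums of two squares. -/
noncomputable def twoSquaresSeries (s : ℂ) : ℂ := LSeries (fun n => (twoSquaresCoeff n : ℂ)) s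

lemma norm_twoSquaresCoeff_le (n : ℕ) : ‖(twoSquaresCoeff n : ℂ)‖ ≤ 1 := by
  rw [norm_real, Real.norm_of_nonneg (twoSquaresCoeff_nonneg n)]
  exact twoSquaresCoeff_le_one n

lemma LSeriesSummable_twoSquaresCoeff {s : ℂ} (hs : 1 < s.re) :
    LSeriesSummable (fun n => (twoSquaresCoeff n : ℂ)) s :=
  LSeriesSummable_of_bounded_of_one_lt_re (m := 1) (fun n _ => norm_twoSquaresCoeff_le n) hs

lemma term_prime_pow {p : ℕ} (hp : p.Prime) (s : ℂ) (e : ℕ) :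
    LSeries.term (fun n => (twoSquaresCoeff n : ℂ)) s (p ^ e) =
      if p % 4 = 3 ∧ ¬ Even e then 0 else ((p : ℂ) ^ (-s)) ^ e := by
  rw [LSeries.term_of_ne_zero (pow_ne_zero _ hp.ne_zero), twoSquaresCoeff_prime_pow hp]
  split_ifs with h
  · simp
  · rw [Nat.cast_pow, ← natCast_cpow_natCast_mul, cpow_nat_mul, cpow_neg, inv_pow]
    simp

lemma norm_prime_cpow_lt_one {p : ℕ} (hp : p.Prime) {s : ℂ} (hs : 0 < s.re) :
    ‖(p : ℂ) ^ (-s)‖ < 1 := by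
  rw [norm_natCast_cpow_of_pos hp.pos]
  exact Real.rpow_lt_one_of_one_lt_of_neg (by exact_mod_cast hp.one_lt) (by simpa)

lemma cpow_neg_two_mul (p : ℕ) (s : ℂ) :
    (p : ℂ) ^ (-2 * s) = ((p : ℂ) ^ (-s)) ^ 2 := by
  rw [← cpow_nat_mul]; congr 1; push_cast; ring

lemma hasSum_even_geometric {w : ℂ} (hw : ‖w‖ < 1) :
    HasSum (fun e : ℕ => if ¬ Even e then 0 else w ^ e) (1 - w ^ 2)⁻¹ := by
  have hw2 : ‖w ^ 2‖ < 1 := by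
    rw [norm_pow]; exact pow_lt_one₀ (norm_nonneg _) hw two_ne_zero
  rw [← add_zero (1 - w ^ 2)⁻¹]
  refine HasSum.even_add_odd ?_ ?_
  · simpa [pow_mul] using hasSum_geometric_of_norm_lt_one hw2
  · simp

lemma tsum_term_prime_pow {p : ℕ} (hp : p.Prime) {s : ℂ} (hs : 0 < s.re) :
    ∑' e, LSeries.term (fun n => (twoSquaresCoeff n : ℂ)) s (p ^ e) =
      if p % 4 = 3 then (1 - (p : ℂ) ^ (-2 * s))⁻¹ else (1 - (p : ℂ) ^ (-s))⁻¹ := by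
  simp only [term_prime_pow hp]
  have hw := norm_prime_cpow_lt_one hp hs
  split_ifs with h
  · rw [cpow_neg_two_mul]
    simp only [h, true_and]
    exact (hasSum_even_geometric hw).tsum_eq
  · simp only [h, false_and, if_false]
    exact tsum_geometric_of_norm_lt_one hw

/-- Euler product of the sums of two squares: a prime `p ≡ 3 mod 4` enters with even exponents only. -/
lemma hasProd_twoSquaresSeries {s : ℂ} (hs : 1 < s.re) :
    HasProd (fun p : Nat.Primes => if (p : ℕ) % 4 = 3 then (1 - ((p : ℕ) : ℂ) ^ (-2 * s))⁻¹
      else (1 - ((p : ℕ) : ℂ) ^ (-s))⁻¹) (twoSquaresSeries s) := by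
  have h := EulerProduct.eulerProduct_hasProd
    (f := LSeries.term (fun n => (twoSquaresCoeff n : ℂ)) s)
    (by rw [LSeries.term_of_ne_zero one_ne_zero, twoSquaresCoeff_one]; simp)
    (fun {m n} hmn => ?_) (LSeriesSummable_twoSquaresCoeff hs).norm (by simp)
  · rw [twoSquaresSeries, LSeries]
    convert h using 1
    funext p
    exact (tsum_term_prime_pow p.2 (by linarith)).symm
  · rcases eq_or_ne m 0 with rfl | hm
    · simp
    rcases eq_or_ne n 0 with rfl | hn
    · simp
    rw [LSeries.term_of_ne_zero (mul_ne_zero hm hn), LSeries.term_of_ne_zero hm,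
      LSeries.term_of_ne_zero hn, twoSquaresCoeff_mul hmn hm hn, Nat.cast_mul,
      natCast_mul_natCast_cpow]
    push_cast
    rw [div_mul_div_comm]

lemma cpow_neg_half_sq (z : ℂ) : (z ^ (-(1 / 2) : ℂ)) ^ 2 = z⁻¹ := by
  rw [← cpow_nat_mul]
  have : ((2 : ℕ) : ℂ) * (-(1 / 2)) = -1 := by norm_num
  rw [this, cpow_neg_one]

/-- The square of the Euler factors of `G` as a product over all primes, to be compared prime by prime
with the Euler products of `ζ`, of `L(·, χ₄)` and of the series of the sums of two squares. -/
lemma hasProd_eulerFactor_sq {s : ℂ} (hs : 1 / 2 < s.re) :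
    HasProd (fun p : Nat.Primes => (if (p : ℕ) = 2 then (1 - (2 : ℂ) ^ (-s))⁻¹ else 1) *
      (if (p : ℕ) % 4 = 3 then (1 - ((p : ℕ) : ℂ) ^ (-2 * s))⁻¹ else 1)) (eulerFactor s ^ 2) := by
  rw [eulerFactor, mul_pow, cpow_neg_half_sq]
  have h2 : HasProd (fun p : Nat.Primes => if (p : ℕ) = 2 then (1 - (2 : ℂ) ^ (-s))⁻¹ else 1)
      (1 - (2 : ℂ) ^ (-s))⁻¹ := by
    convert hasProd_single (f := fun p : Nat.Primes => if (p : ℕ) = 2 then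
      (1 - (2 : ℂ) ^ (-s))⁻¹ else 1) ⟨2, Nat.prime_two⟩ fun p hp =>
        if_neg fun h => hp (Subtype.ext h) using 1
    exact (if_pos rfl).symm
  refine h2.mul ?_
  let g : PrimesThree → Nat.Primes := fun p => ⟨p, p.2.1⟩
  have hg : Function.Injective g := fun p q h => Subtype.ext (congrArg (fun x : Nat.Primes => (x : ℕ)) h)
  rw [← hg.hasProd_iff]
  · have h := (hasProd_three hs).mul (hasProd_three hs)
    rw [← sq] at h
    convert h using 1
    funext p
    rw [← sq, cpow_neg_half_sq, Function.comp_apply, if_pos p.2.2]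
  · intro p hp
    rw [if_neg]
    exact fun h => hp ⟨⟨p, p.2, h⟩, rfl⟩

/-- The identity between the Euler factors at `p` of `F²` and of `ζ L` times the factors at `2` and
at the primes congruent to `3`. -/
lemma euler_factor_identity {p : ℕ} (hp : p.Prime) {s : ℂ} (hs : 0 < s.re) :
    (if p % 4 = 3 then (1 - (p : ℂ) ^ (-2 * s))⁻¹ else (1 - (p : ℂ) ^ (-s))⁻¹) *
      (if p % 4 = 3 then (1 - (p : ℂ) ^ (-2 * s))⁻¹ else (1 - (p : ℂ) ^ (-s))⁻¹) =
    (1 - (p : ℂ) ^ (-s))⁻¹ * (1 - chi4 (p : ZMod 4) * (p : ℂ) ^ (-s))⁻¹ *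
      ((if p = 2 then (1 - (2 : ℂ) ^ (-s))⁻¹ else 1) *
        (if p % 4 = 3 then (1 - (p : ℂ) ^ (-2 * s))⁻¹ else 1)) := by
  rw [chi4_apply, ZMod.χ₄_nat_eq_if_mod_four]
  rcases hp.eq_two_or_odd with rfl | hodd
  · simp
  · have hw := norm_prime_cpow_lt_one hp hs
    rw [if_neg (show p ≠ 2 by omega), if_neg (show ¬ p % 2 = 0 by omega)]
    by_cases h3 : p % 4 = 3
    · rw [if_pos h3, if_pos h3, if_neg (show ¬ p % 4 = 1 by omega), cpow_neg_two_mul]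
      set w := (p : ℂ) ^ (-s)
      have ha : 1 - w ≠ 0 := fun h => by
        rw [← sub_eq_zero.1 h] at hw; simp at hw
      have hb : 1 + w ≠ 0 := fun h => by
        have : w = -1 := by linear_combination h
        rw [this] at hw; simp at hw
      have hc : 1 - w ^ 2 = (1 - w) * (1 + w) := by ring
      push_cast
      rw [hc, neg_one_mul, sub_neg_eq_add, mul_inv]
      ring
    · rw [if_neg h3, if_neg h3, if_pos (show p % 4 = 1 by omega)]
      simp

/-- `F² = ζ L (1 - 2^{-s})^{-1} ∏_{p ≡ 3} (1 - p^{-2s})^{-1}`, by comparison of Euler factors. -/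
lemma twoSquaresSeries_sq {s : ℂ} (hs : 1 < s.re) :
    twoSquaresSeries s ^ 2 = riemannZeta s * chi4.LFunction s * eulerFactor s ^ 2 := by
  have h1 := (hasProd_twoSquaresSeries hs).mul (hasProd_twoSquaresSeries hs)
  have h2 := ((riemannZeta_eulerProduct_hasProd hs).mul
    (DirichletCharacter.LSeries_eulerProduct_hasProd chi4 hs)).mul
      (hasProd_eulerFactor_sq (s := s) (by linarith))
  rw [← DirichletCharacter.LFunction_eq_LSeries chi4 hs] at h2
  rw [sq]
  refine h1.unique ?_
  convert h2 using 1
  funext p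
  exact euler_factor_identity p.2 (by linarith)

/-! ### The function `G` and its relation to the Dirichlet series -/

/-- The domain `Ω_ζ ∩ Ω_L` of `G`. -/
def domG : Set ℂ := cutHalfPlane zetaReg ∩ cutHalfPlane chi4.LFunction

lemma isOpen_domG : IsOpen domG :=
  (isOpen_cutHalfPlane differentiable_zetaReg.continuous
    fun _ => zetaReg_ne_zero_of_one_le_re).inter
  (isOpen_cutHalfPlane differentiable_LFunction_chi4.continuous
    fun _ => LFunction_chi4_ne_zero_of_one_le_re)

lemma half_lt_re_of_mem_domG {s : ℂ} (hs : s ∈ domG) : 1 / 2 < s.re := hs.1.1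

lemma mem_domG_of_zetaL_ne_zero {s : ℂ} (hs : 1 / 2 < s.re)
    (h : ∀ t : ℝ, 0 ≤ t → zetaL (s + t) ≠ 0) : s ∈ domG :=
  ⟨⟨hs, fun t ht => left_ne_zero_of_mul (h t ht)⟩, ⟨hs, fun t ht => right_ne_zero_of_mul (h t ht)⟩⟩

lemma mem_domG_of_one_le_re {s : ℂ} (hs : 1 ≤ s.re) : s ∈ domG :=
  mem_domG_of_zetaL_ne_zero (by linarith) fun t ht =>
    zetaL_ne_zero_of_one_le_re (by simp; linarith)

lemma ofReal_mem_domG {σ : ℝ} (hσ : 1 / 2 < σ) : (σ : ℂ) ∈ domG := by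
  refine mem_domG_of_zetaL_ne_zero (by simpa using hσ) fun t ht => ?_
  obtain ⟨y, hy, h1⟩ := zetaReg_pos (σ := σ + t) (by linarith)
  obtain ⟨z, hz, h2⟩ := LFunction_chi4_pos (σ := σ + t) (by linarith)
  rw [← ofReal_add, zetaL, h1, h2, ← ofReal_mul]
  exact ofReal_ne_zero.2 (mul_pos hy hz).ne'

lemma continuousAt_twoSquaresSeries {z : ℂ} (hz : 1 < z.re) : ContinuousAt twoSquaresSeries z := by
  refine (LSeries_differentiableOn _).continuousOn.continuousAt ?_
  have h1 : LSeries.abscissaOfAbsConv (fun n => (twoSquaresCoeff n : ℂ)) ≤ 1 :=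
    LSeries.abscissaOfAbsConv_le_of_le_const ⟨1, fun n _ => norm_twoSquaresCoeff_le n⟩
  have h2 : {s : ℂ | 1 < s.re} ⊆
      {s : ℂ | LSeries.abscissaOfAbsConv (fun n => (twoSquaresCoeff n : ℂ)) < s.re} :=
    fun w hw => h1.trans_lt (by exact_mod_cast hw)
  exact mem_of_superset ((isOpen_re_gt 1).mem_nhds hz) h2

section
variable {A B : ℂ → ℂ} (hA : IsSqrtBranch zetaReg A) (hB : IsSqrtBranch chi4.LFunction B)
include hA hB

lemma analyticOnNhd_G : AnalyticOnNhd ℂ (G A B) domG := by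
  have hE : AnalyticOnNhd ℂ eulerFactor domG := fun s hs => by
    have h1 : DifferentiableOn ℂ eulerFactor {s : ℂ | 1 / 2 < s.re} := fun z hz =>
      (differentiableAt_eulerFactor hz).differentiableWithinAt
    exact h1.analyticOnNhd (isOpen_re_gt _) s (half_lt_re_of_mem_domG hs)
  have h1 : AnalyticOnNhd ℂ (fun s => A s * B s * eulerFactor s) domG :=
    ((hA.analytic.mono inter_subset_left).mul (hB.analytic.mono inter_subset_right)).mul hE
  exact h1.congr isOpen_domG fun s hs => (G_eq (half_lt_re_of_mem_domG hs)).symm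

lemma G_sq {s : ℂ} (hs : s ∈ domG) :
    G A B s ^ 2 = zetaReg s * chi4.LFunction s * eulerFactor s ^ 2 := by
  rw [G_eq (half_lt_re_of_mem_domG hs), mul_pow, mul_pow, hA.sq_eq s hs.1, hB.sq_eq s hs.2]

lemma G_ne_zero {s : ℂ} (hs : s ∈ domG) : G A B s ≠ 0 := fun h => by
  have h1 := G_sq hA hB hs
  have h2 : zetaReg s ≠ 0 := by simpa using hs.1.2 0 le_rfl
  have h3 : chi4.LFunction s ≠ 0 := by simpa using hs.2.2 0 le_rfl
  rw [h, zero_pow two_ne_zero] at h1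
  exact mul_ne_zero (mul_ne_zero h2 h3)
    (pow_ne_zero 2 (eulerFactor_ne_zero (half_lt_re_of_mem_domG hs))) h1.symm

lemma exists_norm_G_sq_le {δ : ℝ} (hδ : 0 < δ) : ∃ C : ℝ, 0 < C ∧ ∀ s : ℂ, s ∈ domG →
    1 / 2 + δ ≤ s.re → ‖G A B s‖ ^ 2 ≤ C * (‖zetaReg s‖ * ‖chi4.LFunction s‖) := by
  obtain ⟨C, hC, h⟩ := exists_norm_eulerFactor_le hδ
  refine ⟨C ^ 2, by positivity, fun s hs hre => ?_⟩
  rw [← norm_pow, G_sq hA hB hs, norm_mul, norm_mul, norm_pow, mul_comm]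
  gcongr
  exact h s hre

/-- The two sides have equal squares, and the right one does not vanish on the connected half-plane
`Re s > 1`, so they agree because they agree at `s = 2`. -/
lemma twoSquaresSeries_eq {s : ℂ} (hs : 1 < s.re) :
    twoSquaresSeries s = G A B s * (s - 1) ^ (-(1 / 2) : ℂ) := by
  have hG : ContinuousOn (G A B) {s : ℂ | 1 < s.re} := fun z hz =>
    ((analyticOnNhd_G hA hB) z (mem_domG_of_one_le_re (le_of_lt hz))).continuousAt.continuousWithinAt
  have hslit : ∀ z : ℂ, 1 < z.re → z - 1 ∈ slitPlane := fun z hz => Or.inl (by simpa using hz)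
  have hpow : ContinuousOn (fun s : ℂ => (s - 1) ^ (-(1 / 2) : ℂ)) {s : ℂ | 1 < s.re} := fun z hz =>
    ((continuousAt_id.sub continuousAt_const).cpow continuousAt_const
      (hslit z hz)).continuousWithinAt
  have hF : ContinuousOn twoSquaresSeries {s : ℂ | 1 < s.re} := fun z hz =>
    (continuousAt_twoSquaresSeries hz).continuousWithinAt
  refine (isPreconnected_re_gt 1).eq_of_sq_eq (f := twoSquaresSeries)
    (g := fun s => G A B s * (s - 1) ^ (-(1 / 2) : ℂ)) hF (hG.mul hpow) (fun z hz => ?_)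
    (fun {z} hz => ?_) (y := 2) (by simp) ?_ hs
  · have hz1 : z ≠ 1 := one_ne_of_one_lt_re hz
    have hz2 : z - 1 ≠ 0 := sub_ne_zero.2 hz1
    simp only [Pi.pow_apply]
    rw [twoSquaresSeries_sq hz, mul_pow, G_sq hA hB (mem_domG_of_one_le_re (le_of_lt hz)),
      cpow_neg_half_sq, zetaReg_of_ne hz1]
    field_simp
  · have hz2 : z - 1 ≠ 0 := sub_ne_zero.2 (one_ne_of_one_lt_re hz)
    refine mul_ne_zero (G_ne_zero hA hB (mem_domG_of_one_le_re (le_of_lt hz))) ?_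
    rw [cpow_def_of_ne_zero hz2]
    exact exp_ne_zero _
  · -- at `s = 2` both sides are positive and their squares agree
    have hreal : ∀ {h : ℂ → ℂ} {f : ℂ → ℂ}, IsSqrtBranch f h → ∃ y : ℝ, 0 < y ∧ h 2 = y :=
      fun hh => by
        obtain ⟨-, h1, h2⟩ := hh.pos 2 (by norm_num)
        exact ⟨_, h1, Complex.ext (by simp) (by simpa using h2)⟩
    obtain ⟨a, ha, hAa⟩ := hreal hA
    obtain ⟨b, hb, hBb⟩ := hreal hB
    obtain ⟨e, he, hEe⟩ := eulerFactor_two_pos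
    have hG2 : G A B 2 * (2 - 1) ^ (-(1 / 2) : ℂ) = ((a * b * e : ℝ) : ℂ) := by
      rw [G_eq (by norm_num), hAa, hBb, hEe]
      have : (2 - 1 : ℂ) = 1 := by norm_num
      rw [this, one_cpow]
      push_cast
      ring
    have hs2 : HasSum (fun n => twoSquaresCoeff n * (n : ℝ) ^ (-2 : ℝ)) (twoSquaresSeries 2).re := by
      have h1 := hasSum_re (LSeriesSummable_twoSquaresCoeff (s := 2) (by simp)).hasSum
      rw [twoSquaresSeries, LSeries]
      convert h1 using 1
      funext n
      symm
      rw [LSeries.term_def]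
      split_ifs with h
      · simp [h]
      · have : (2 : ℂ) = ((2 : ℝ) : ℂ) := by norm_num
        rw [this, natCast_cpow_ofReal, ← ofReal_div, ofReal_re, Real.rpow_neg (Nat.cast_nonneg n)]
        rfl
    have hpos : 0 < (twoSquaresSeries 2).re := by
      have h1 := hs2.summable.tsum_pos (i := 1)
        (fun n => mul_nonneg (twoSquaresCoeff_nonneg n) (by positivity))
        (by rw [twoSquaresCoeff_one]; norm_num)
      rwa [hs2.tsum_eq] at h1
    have hsq : twoSquaresSeries 2 ^ 2 = ((a * b * e : ℝ) : ℂ) ^ 2 := by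
      rw [← hG2, twoSquaresSeries_sq (by simp), mul_pow,
        G_sq hA hB (mem_domG_of_one_le_re (by simp)), cpow_neg_half_sq,
        zetaReg_of_ne (by norm_num)]
      norm_num
    rw [hG2]
    rcases sq_eq_sq_iff_eq_or_eq_neg.1 hsq with h | h
    · exact h
    · rw [h, neg_re, ofReal_re] at hpos
      have : 0 < a * b * e := by positivity
      linarith
end

/-! ### Perron's formula for Riesz means -/

/-- The function `max (1 - u) 0` on the positive half-line, written with indicators so that its
Mellin transform can be read off. -/
noncomputable def hat (u : ℝ) : ℂ :=
  (Ioc (0 : ℝ) 1).indicator (fun _ => (1 : ℂ)) u - (Ioc (0 : ℝ) 1).indicator (fun u => (u : ℂ) ^ (1 : ℂ)) u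

lemma hat_eq {u : ℝ} (hu : 0 < u) : hat u = ((max (1 - u) 0 : ℝ) : ℂ) := by
  rcases le_or_gt u 1 with h | h
  · rw [hat, indicator_of_mem (show u ∈ Ioc (0 : ℝ) 1 from ⟨hu, h⟩),
      indicator_of_mem (show u ∈ Ioc (0 : ℝ) 1 from ⟨hu, h⟩), max_eq_left (by linarith), cpow_one]
    push_cast; rfl
  · have : u ∉ Ioc (0 : ℝ) 1 := fun h' => by linarith [h'.2]
    rw [hat, indicator_of_notMem this, indicator_of_notMem this, max_eq_right (by linarith)]
    simp

lemma hasMellin_hat {s : ℂ} (hs : 0 < s.re) : HasMellin hat s (1 / (s * (s + 1))) := by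
  have h := hasMellin_sub (hasMellin_one_Ioc hs).1 (hasMellin_cpow_Ioc 1 (s := s)
    (by simp; linarith)).1
  refine ⟨h.1, h.2.trans ?_⟩
  rw [(hasMellin_one_Ioc hs).2, (hasMellin_cpow_Ioc 1 (s := s) (by simp; linarith)).2]
  have h1 : s ≠ 0 := by rintro rfl; simp at hs
  have h2 : s + 1 ≠ 0 := fun h => by
    have := congrArg re h
    simp at this; linarith
  field_simp
  ring

lemma norm_le_norm_add_one {s : ℂ} (hs : 0 ≤ s.re) : ‖s‖ ≤ ‖s + 1‖ := by
  rw [← sq_le_sq₀ (norm_nonneg _) (norm_nonneg _), Complex.sq_norm, Complex.sq_norm,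
    normSq_apply, normSq_apply]
  simp
  nlinarith

lemma one_add_sq_le {κ : ℝ} (hκ : 1 ≤ κ) (y : ℝ) : 1 + y ^ 2 ≤ ‖(κ + y * I : ℂ)‖ ^ 2 := by
  rw [Complex.sq_norm, normSq_apply]
  simp
  nlinarith

lemma norm_inv_mul_add_one_le {κ : ℝ} (hκ : 1 ≤ κ) (y : ℝ) :
    ‖1 / ((κ + y * I : ℂ) * (κ + y * I + 1))‖ ≤ (1 + y ^ 2)⁻¹ := by
  rw [norm_div, norm_one, one_div, norm_mul]
  refine inv_anti₀ (by positivity) ((one_add_sq_le hκ y).trans ?_)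
  rw [sq]
  gcongr
  exact norm_le_norm_add_one (by simp; linarith)

lemma vertical_ne_zero {κ : ℝ} (hκ : 1 ≤ κ) (y : ℝ) :
    (κ + y * I : ℂ) * (κ + y * I + 1) ≠ 0 := by
  have h : ∀ a : ℝ, 0 < a → (a + y * I : ℂ) ≠ 0 := fun a ha h => by
    have := congrArg re h
    simp at this; linarith
  refine mul_ne_zero (h κ (by linarith)) ?_
  have := h (κ + 1) (by linarith)
  push_cast at this
  convert this using 1; ring

lemma continuous_inv_vertical {κ : ℝ} (hκ : 1 ≤ κ) :
    Continuous fun y : ℝ => 1 / ((κ + y * I : ℂ) * (κ + y * I + 1)) :=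
  Continuous.div continuous_const (by fun_prop) (vertical_ne_zero hκ)

/-- Perron's formula for the weight `max (1 - v) 0`. -/
lemma integral_perron {κ v : ℝ} (hκ : 1 ≤ κ) (hv : 0 < v) :
    ∫ y : ℝ, (v : ℂ) ^ (-(κ + y * I : ℂ)) * (1 / ((κ + y * I : ℂ) * (κ + y * I + 1))) =
      2 * Real.pi * ((max (1 - v) 0 : ℝ) : ℂ) := by
  have hmel : ∀ y : ℝ, mellin hat (κ + y * I) = 1 / ((κ + y * I : ℂ) * (κ + y * I + 1)) := fun y =>
    (hasMellin_hat (by simp; linarith)).2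
  have hvi : VerticalIntegrable (mellin hat) κ := by
    unfold VerticalIntegrable
    simp only [hmel]
    exact integrable_inv_one_add_sq.mono' (continuous_inv_vertical hκ).aestronglyMeasurable
      (ae_of_all _ (norm_inv_mul_add_one_le hκ))
  have hcont : ContinuousAt hat v := by
    have h1 : Continuous fun u : ℝ => ((max (1 - u) 0 : ℝ) : ℂ) := by fun_prop
    refine h1.continuousAt.congr ?_
    filter_upwards [Ioi_mem_nhds hv] with u hu using (hat_eq hu).symm
  have h := mellinInv_mellin_eq κ hat hv (hasMellin_hat (by simp; linarith)).1 hvi hcont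
  rw [mellinInv, hat_eq hv] at h
  simp only [hmel, smul_eq_mul] at h
  rw [← h, real_smul]
  generalize (∫ y : ℝ, _ : ℂ) = J
  push_cast
  field_simp

/-- The Riesz mean `∑_{n ≤ x} 1_E(n) (x - n)`. -/
noncomputable def rieszSum (x : ℝ) : ℝ := ∑ n ∈ Finset.Icc 1 ⌊x⌋₊, twoSquaresCoeff n * (x - n)

lemma cpow_add_one_mul_cpow {x : ℝ} (hx : 0 < x) {n : ℕ} (hn : n ≠ 0) (s : ℂ) :
    (x : ℂ) ^ (s + 1) / (n : ℂ) ^ s = x * ((n / x : ℝ) : ℂ) ^ (-s) := by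
  have hx0 : (x : ℂ) ≠ 0 := ofReal_ne_zero.2 hx.ne'
  have hn0 : (n : ℂ) ≠ 0 := Nat.cast_ne_zero.2 hn
  have h1 : ((n / x : ℝ) : ℂ) ^ (-s) = (n : ℂ) ^ (-s) * (x : ℂ) ^ s := by
    rw [div_eq_mul_inv, ofReal_mul, mul_cpow_ofReal_nonneg (Nat.cast_nonneg n)
      (inv_nonneg.2 hx.le), ofReal_inv, inv_cpow _ _ (by
        rw [arg_ofReal_of_nonneg hx.le]; exact Real.pi_pos.ne), cpow_neg (x : ℂ), inv_inv,
      ofReal_natCast]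
  rw [h1, cpow_add _ _ hx0, cpow_one, cpow_neg]
  field_simp

lemma norm_cpow_vertical {x : ℝ} (hx : 0 < x) (κ y : ℝ) :
    ‖(x : ℂ) ^ (κ + y * I + 1 : ℂ)‖ = x ^ (κ + 1) := by
  rw [norm_cpow_eq_rpow_re_of_pos hx]; simp

lemma continuous_cpow_vertical {x : ℝ} (hx : 0 < x) (κ : ℝ) :
    Continuous fun y : ℝ => (x : ℂ) ^ (κ + y * I + 1 : ℂ) :=
  Continuous.const_cpow (by fun_prop) (Or.inl (ofReal_ne_zero.2 hx.ne'))

/-- Perron's formula for the Riesz mean. -/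
lemma integral_riesz {κ x : ℝ} (hκ : 1 < κ) (hx : 0 < x) :
    ∫ y : ℝ, twoSquaresSeries (κ + y * I) * ((x : ℂ) ^ (κ + y * I + 1 : ℂ) *
      (1 / ((κ + y * I : ℂ) * (κ + y * I + 1)))) = 2 * Real.pi * (rieszSum x : ℂ) := by
  set T : ℕ → ℝ → ℂ := fun n y => LSeries.term (fun n => (twoSquaresCoeff n : ℂ)) (κ + y * I) n *
    ((x : ℂ) ^ (κ + y * I + 1 : ℂ) * (1 / ((κ + y * I : ℂ) * (κ + y * I + 1)))) with hT
  have hT0 : ∀ y, T 0 y = 0 := fun y => by simp [hT]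
  have hTn : ∀ n : ℕ, n ≠ 0 → ∀ y, T n y = twoSquaresCoeff n * x *
      (((n / x : ℝ) : ℂ) ^ (-(κ + y * I : ℂ)) * (1 / ((κ + y * I : ℂ) * (κ + y * I + 1)))) := by
    intro n hn y
    have := cpow_add_one_mul_cpow hx hn (κ + y * I)
    simp only [hT]
    rw [LSeries.term_of_ne_zero hn, div_mul_eq_mul_div, ← mul_assoc, mul_div_right_comm,
      mul_div_assoc, this]
    ring
  have hint : ∀ n, ∫ y, T n y = 2 * Real.pi * ((twoSquaresCoeff n *
      (if n = 0 then 0 else max (x - n) 0) : ℝ) : ℂ) := by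
    intro n
    rcases eq_or_ne n 0 with rfl | hn
    · simp [hT0]
    · simp only [hTn n hn]
      rw [integral_const_mul, integral_perron hκ.le (by positivity), if_neg hn]
      have : max (x - n) 0 = x * max (1 - n / x) 0 := by
        rw [mul_max_of_nonneg _ _ hx.le, mul_zero]; congr 1; field_simp
      rw [this]; push_cast; ring
  have hTm : ∀ n, Continuous (T n) := by
    intro n
    rcases eq_or_ne n 0 with rfl | hn
    · simp only [funext hT0]; exact continuous_const
    · simp only [funext (hTn n hn)]
      have hpos : (0 : ℝ) < n / x := by positivity
      exact continuous_const.mul ((Continuous.const_cpow (by fun_prop)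
        (Or.inl (ofReal_ne_zero.2 hpos.ne'))).mul (continuous_inv_vertical hκ.le))
  have hTb : ∀ n y, ‖T n y‖ ≤ ‖LSeries.term (fun n => (twoSquaresCoeff n : ℂ)) (κ : ℂ) n‖ *
      x ^ (κ + 1) * (1 + y ^ 2)⁻¹ := by
    intro n y
    have h1 : ‖LSeries.term (fun n => (twoSquaresCoeff n : ℂ)) (κ + y * I) n‖ =
        ‖LSeries.term (fun n => (twoSquaresCoeff n : ℂ)) (κ : ℂ) n‖ := by
      simp [LSeries.norm_term_eq]
    simp only [hT]
    rw [norm_mul, norm_mul, h1, norm_cpow_vertical hx, mul_assoc]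
    gcongr
    exact norm_inv_mul_add_one_le hκ.le y
  have hTi : ∀ n, Integrable (T n) := fun n =>
    (integrable_inv_one_add_sq.const_mul _).mono' (hTm n).aestronglyMeasurable
      (ae_of_all _ (hTb n))
  have hsum : Summable fun n => ∫ y, ‖T n y‖ := by
    refine Summable.of_nonneg_of_le (fun n => integral_nonneg fun y => norm_nonneg _)
      (fun n => integral_mono (hTi n).norm (integrable_inv_one_add_sq.const_mul _) (hTb n)) ?_
    simp only [integral_const_mul]
    exact ((LSeriesSummable_twoSquaresCoeff (s := (κ : ℂ)) (by simpa)).norm.mul_right _).mul_right _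
  have h1 := hasSum_integral_of_summable_integral_norm hTi hsum
  simp only [hint] at h1
  have h2 : ∀ y : ℝ, ∑' n, T n y = twoSquaresSeries (κ + y * I) * ((x : ℂ) ^ (κ + y * I + 1 : ℂ) *
      (1 / ((κ + y * I : ℂ) * (κ + y * I + 1)))) := fun y => tsum_mul_right
  simp only [h2] at h1
  refine h1.unique ?_
  rw [rieszSum, ofReal_sum, Finset.mul_sum]
  have h3 : ∀ n ∈ Finset.Icc 1 ⌊x⌋₊, 2 * Real.pi * ((twoSquaresCoeff n * (x - n) : ℝ) : ℂ) =
      2 * Real.pi * ((twoSquaresCoeff n * (if n = 0 then 0 else max (x - n) 0) : ℝ) : ℂ) := by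
    intro n hn
    rw [Finset.mem_Icc, Nat.le_floor_iff hx.le] at hn
    rw [if_neg (by omega), max_eq_left (by linarith)]
  rw [Finset.sum_congr rfl h3]
  refine hasSum_sum_of_ne_finset_zero fun n hn => ?_
  rw [Finset.mem_Icc, not_and, Nat.le_floor_iff hx.le] at hn
  rcases eq_or_ne n 0 with rfl | h0
  · simp
  · have := hn (Nat.one_le_iff_ne_zero.2 h0)
    rw [if_neg h0, max_eq_right (by linarith)]
    simp

/-- The smoothed Perron kernel `((x + h)^{s+1} - x^{s+1}) / (h s (s + 1))`, which is the mean of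
`u^s / s` over `x ≤ u ≤ x + h`. -/
noncomputable def kernel (x h : ℝ) (s : ℂ) : ℂ :=
  (((x + h : ℝ) : ℂ) ^ (s + 1) - (x : ℂ) ^ (s + 1)) / (h * (s * (s + 1)))

lemma integrable_riesz {κ x : ℝ} (hκ : 1 < κ) (hκ2 : κ ≤ 2) (hx : 0 < x) :
    Integrable fun y : ℝ => twoSquaresSeries (κ + y * I) * ((x : ℂ) ^ (κ + y * I + 1 : ℂ) *
      (1 / ((κ + y * I : ℂ) * (κ + y * I + 1)))) := by
  have hF : Continuous fun y : ℝ => twoSquaresSeries (κ + y * I) :=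
    continuous_iff_continuousAt.2 fun y => ContinuousAt.comp (g := twoSquaresSeries)
      (continuousAt_twoSquaresSeries (by simpa)) (by fun_prop)
  refine (integrable_inv_one_add_sq.const_mul (32 / (κ - 1) * x ^ (κ + 1))).mono'
    (hF.mul ((continuous_cpow_vertical hx κ).mul
      (continuous_inv_vertical hκ.le))).aestronglyMeasurable (ae_of_all _ fun y => ?_)
  have h1 := norm_LSeries_le norm_twoSquaresCoeff_le (s := (κ + y * I : ℂ)) (by simpa) (by simpa)
  have h2 : (κ + y * I : ℂ).re = κ := by simp
  rw [h2] at h1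
  rw [norm_mul, norm_mul, norm_cpow_vertical hx, ← mul_assoc]
  have h3 : 0 < κ - 1 := by linarith
  gcongr
  · exact h1
  · exact norm_inv_mul_add_one_le hκ.le y

lemma series_mul_kernel (x h κ y : ℝ) : twoSquaresSeries (κ + y * I) * kernel x h (κ + y * I) =
    (h : ℂ)⁻¹ * (twoSquaresSeries (κ + y * I) * (((x + h : ℝ) : ℂ) ^ (κ + y * I + 1 : ℂ) *
      (1 / ((κ + y * I : ℂ) * (κ + y * I + 1)))) -
    twoSquaresSeries (κ + y * I) * ((x : ℂ) ^ (κ + y * I + 1 : ℂ) *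
      (1 / ((κ + y * I : ℂ) * (κ + y * I + 1))))) := by
  rw [kernel, div_eq_mul_inv _ ((h : ℂ) * _), mul_inv]
  ring

lemma integrable_series_mul_kernel {κ x h : ℝ} (hκ : 1 < κ) (hκ2 : κ ≤ 2) (hx : 0 < x)
    (hh : 0 < h) :
    Integrable fun y : ℝ => twoSquaresSeries (κ + y * I) * kernel x h (κ + y * I) := by
  simp only [series_mul_kernel]
  exact ((integrable_riesz hκ hκ2 (by positivity)).sub (integrable_riesz hκ hκ2 hx)).const_mul _

/-- Perron's formula for the difference quotient of the Riesz mean. -/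
lemma integral_series_mul_kernel {κ x h : ℝ} (hκ : 1 < κ) (hκ2 : κ ≤ 2) (hx : 0 < x)
    (hh : 0 < h) :
    ∫ y : ℝ, twoSquaresSeries (κ + y * I) * kernel x h (κ + y * I) =
      2 * Real.pi * (((rieszSum (x + h) - rieszSum x) / h : ℝ) : ℂ) := by
  simp only [series_mul_kernel]
  rw [integral_const_mul, integral_sub (integrable_riesz hκ hκ2 (by positivity))
    (integrable_riesz hκ hκ2 hx), integral_riesz hκ (by positivity), integral_riesz hκ hx]
  push_cast
  field_simp

lemma countTwoSquares_eq (x : ℝ) :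
    countTwoSquares x = ∑ n ∈ Finset.Icc 1 ⌊x⌋₊, twoSquaresCoeff n := rfl

/-- The counting function differs little from the difference quotient of the Riesz mean. -/
lemma abs_riesz_quotient_sub_le {x h : ℝ} (hx : 0 ≤ x) (hh : 0 < h) :
    |countTwoSquares x - (rieszSum (x + h) - rieszSum x) / h| ≤ h + 1 := by
  have hle : ⌊x⌋₊ ≤ ⌊x + h⌋₊ := Nat.floor_mono (by linarith)
  have hsplit : Finset.Icc 1 ⌊x + h⌋₊ = Finset.Icc 1 ⌊x⌋₊ ∪ Finset.Ioc ⌊x⌋₊ ⌊x + h⌋₊ := by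
    ext n; simp only [Finset.mem_Icc, Finset.mem_union, Finset.mem_Ioc]; omega
  have hdisj : Disjoint (Finset.Icc 1 ⌊x⌋₊) (Finset.Ioc ⌊x⌋₊ ⌊x + h⌋₊) := by
    rw [Finset.disjoint_left]; intro n; simp only [Finset.mem_Icc, Finset.mem_Ioc]; omega
  set R := ∑ n ∈ Finset.Ioc ⌊x⌋₊ ⌊x + h⌋₊, twoSquaresCoeff n * (x + h - n) with hR
  have h1 : rieszSum (x + h) - rieszSum x = h * countTwoSquares x + R := by
    rw [rieszSum, hsplit, Finset.sum_union hdisj, ← hR, rieszSum, countTwoSquares_eq,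
      add_sub_right_comm, ← Finset.sum_sub_distrib, Finset.mul_sum]
    congr 1
    exact Finset.sum_congr rfl fun n _ => by ring
  have hbd : ∀ n ∈ Finset.Ioc ⌊x⌋₊ ⌊x + h⌋₊, 0 ≤ twoSquaresCoeff n * (x + h - n) ∧
      twoSquaresCoeff n * (x + h - n) ≤ h := by
    intro n hn
    rw [Finset.mem_Ioc, Nat.floor_lt hx, Nat.le_floor_iff (by linarith)] at hn
    have h2 := twoSquaresCoeff_nonneg n
    have h3 := twoSquaresCoeff_le_one n
    constructor <;> nlinarith
  have hR0 : 0 ≤ R := Finset.sum_nonneg fun n hn => (hbd n hn).1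
  have hR1 : R ≤ h * (h + 1) := by
    calc R ≤ ∑ n ∈ Finset.Ioc ⌊x⌋₊ ⌊x + h⌋₊, h := Finset.sum_le_sum fun n hn => (hbd n hn).2
      _ = (⌊x + h⌋₊ - ⌊x⌋₊ : ℝ) * h := by
        rw [Finset.sum_const, Nat.card_Ioc, nsmul_eq_mul, Nat.cast_sub hle]
      _ ≤ h * (h + 1) := by
        have h4 := Nat.floor_le (show 0 ≤ x + h by linarith)
        have h5 := Nat.lt_floor_add_one x
        nlinarith
  have h6 : countTwoSquares x - (rieszSum (x + h) - rieszSum x) / h = -(R / h) := by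
    rw [h1]; field_simp; ring
  rw [h6, abs_neg, abs_of_nonneg (by positivity), div_le_iff₀ hh]
  linarith

/-! ### Bounds for the smoothed kernel -/

lemma add_rpow_le {x h a n : ℝ} (hx : 0 < x) (hh : 0 < h) (hhx : h ≤ x) (ha : 0 ≤ a) (han : a ≤ n) :
    (x + h) ^ a ≤ 2 ^ n * x ^ a := by
  calc (x + h) ^ a ≤ (2 * x) ^ a := Real.rpow_le_rpow (by linarith) (by linarith) ha
    _ = 2 ^ a * x ^ a := Real.mul_rpow (by norm_num) hx.le
    _ ≤ 2 ^ n * x ^ a := by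
      gcongr
      norm_num

/-- The kernel decays like `|s|^{-2}`, at the cost of a factor `x / h`. The bound controls the tails and
the horizontal sides of the contour. -/
lemma norm_kernel_le_sq {x h : ℝ} {s : ℂ} (hx : 0 < x) (hh : 0 < h) (hhx : h ≤ x) (hs : 0 < s.re)
    (hs2 : s.re ≤ 2) : ‖kernel x h s‖ ≤ 9 * x ^ (s.re + 1) / (h * ‖s‖ ^ 2) := by
  have hs0 : 0 < ‖s‖ := norm_pos_iff.2 fun h => by simp [h] at hs
  have h1 : ‖((x + h : ℝ) : ℂ) ^ (s + 1)‖ ≤ 8 * x ^ (s.re + 1) := by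
    rw [norm_cpow_eq_rpow_re_of_pos (by linarith)]
    have := add_rpow_le (n := 3) hx hh hhx (show 0 ≤ s.re + 1 by linarith) (by linarith)
    norm_num at this ⊢
    exact this
  have h2 : ‖(x : ℂ) ^ (s + 1)‖ = x ^ (s.re + 1) := by
    rw [norm_cpow_eq_rpow_re_of_pos hx]; simp
  rw [kernel, norm_div, norm_mul, norm_mul, norm_real, Real.norm_of_nonneg hh.le, sq]
  have h3 := norm_le_norm_add_one hs.le
  gcongr
  exact (norm_sub_le _ _).trans (by linarith)

/-- The kernel is bounded like `x^s / s`, uniformly in `h`, by the mean value inequality. -/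
lemma norm_kernel_le {x h : ℝ} {s : ℂ} (hx : 0 < x) (hh : 0 < h) (hhx : h ≤ x) (hs : 0 < s.re)
    (hs2 : s.re ≤ 2) : ‖kernel x h s‖ ≤ 4 * x ^ s.re / ‖s‖ := by
  have hs0 : 0 < ‖s‖ := norm_pos_iff.2 fun h => by simp [h] at hs
  have hs1 : 0 < ‖s + 1‖ := hs0.trans_le (norm_le_norm_add_one hs.le)
  have hd : ∀ u ∈ Icc x (x + h), HasDerivWithinAt (fun u : ℝ => (u : ℂ) ^ (s + 1))
      ((s + 1) * (u : ℂ) ^ s) (Icc x (x + h)) u := fun u hu => by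
    have hu0 : (u : ℂ) ≠ 0 := ofReal_ne_zero.2 (by linarith [hu.1] : (0:ℝ) < u).ne'
    have := ((hasDerivAt_id (u : ℂ)).cpow_const (c := s + 1)
      (Or.inl (by simpa using (by linarith [hu.1] : (0:ℝ) < u)))).comp_ofReal
    exact (this.congr_deriv (by simp)).hasDerivWithinAt
  have h1 := (convex_Icc x (x + h)).norm_image_sub_le_of_norm_hasDerivWithin_le
    (C := ‖s + 1‖ * (4 * x ^ s.re)) hd (fun u hu => by
      have hu0 : 0 < u := by linarith [hu.1]
      rw [norm_mul, norm_cpow_eq_rpow_re_of_pos hu0]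
      gcongr
      have h2 := add_rpow_le (n := 2) hx hh hhx hs.le hs2
      norm_num at h2
      exact (Real.rpow_le_rpow hu0.le hu.2 hs.le).trans h2)
    (left_mem_Icc.2 (by linarith)) (right_mem_Icc.2 (by linarith))
  rw [add_sub_cancel_left, Real.norm_of_nonneg hh.le] at h1
  rw [kernel, norm_div, norm_mul, norm_mul, norm_real, Real.norm_of_nonneg hh.le,
    div_le_div_iff₀ (by positivity) hs0]
  calc _ ≤ ‖s + 1‖ * (4 * x ^ s.re) * h * ‖s‖ := by gcongr
    _ = _ := by ring

/-- On the real segment the kernel is close to `x ^ σ / σ`. -/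
lemma norm_kernel_ofReal_sub_le {x h σ : ℝ} (hx : 1 ≤ x) (hh : 0 < h) (hσ : 1 / 2 ≤ σ)
    (hσ1 : σ ≤ 1) : ‖kernel x h σ - ((x ^ σ / σ : ℝ) : ℂ)‖ ≤ 2 * h := by
  have hx0 : 0 < x := by linarith
  have hk : kernel x h σ = ((((x + h) ^ (σ + 1) - x ^ (σ + 1)) / (h * (σ * (σ + 1))) : ℝ) : ℂ) := by
    rw [kernel]
    push_cast [ofReal_cpow hx0.le, ofReal_cpow (show 0 ≤ x + h by linarith)]
    rfl
  have hd : ∀ u ∈ Icc x (x + h), HasDerivWithinAt (fun u : ℝ => u ^ (σ + 1) / (σ + 1) - x ^ σ * u)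
      (u ^ σ - x ^ σ) (Icc x (x + h)) u := fun u hu => by
    have := (((Real.hasDerivAt_rpow_const (p := σ + 1) (Or.inl (by linarith [hu.1] : (0:ℝ) < u).ne')).div_const
      (σ + 1)).sub ((hasDerivAt_id u).const_mul (x ^ σ)))
    refine (this.congr_deriv ?_).hasDerivWithinAt
    have : σ + 1 ≠ 0 := by positivity
    field_simp
    simp
  have h1 := (convex_Icc x (x + h)).norm_image_sub_le_of_norm_hasDerivWithin_le
    (C := h) hd (fun u hu => by
      have h2 : x ^ σ ≤ u ^ σ := Real.rpow_le_rpow hx0.le hu.1 (by linarith)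
      rw [Real.norm_of_nonneg (by linarith)]
      have h3 := rpow_one_add_le_one_add_mul_self (s := u / x - 1) (p := σ)
        (by have : 0 ≤ u / x := div_nonneg (by linarith [hu.1]) hx0.le
            linarith) (by linarith) hσ1
      have h4 : u ^ σ = x ^ σ * (1 + (u / x - 1)) ^ σ := by
        rw [← Real.mul_rpow hx0.le (by
          have : 0 ≤ u / x := div_nonneg (by linarith [hu.1]) hx0.le
          linarith)]
        congr 1; field_simp; ring
      have h5 : x ^ σ ≤ x := by
        simpa using Real.rpow_le_rpow_of_exponent_le hx hσ1
      have h6 : x ^ σ * (u / x - 1) ≤ u - x := by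
        have : u / x - 1 = (u - x) / x := by field_simp
        rw [this, mul_div_assoc', div_le_iff₀ hx0, mul_comm]
        exact mul_le_mul_of_nonneg_left h5 (by linarith [hu.1])
      have h7 : 0 ≤ x ^ σ * (u / x - 1) := by
        refine mul_nonneg (by positivity) (sub_nonneg.2 ?_)
        rw [one_le_div hx0]; exact hu.1
      rw [h4]
      have h8 : x ^ σ * (1 + (u / x - 1)) ^ σ ≤ x ^ σ * (1 + σ * (u / x - 1)) := by gcongr
      nlinarith [hu.2, mul_le_mul_of_nonneg_right hσ1 h7])
    (left_mem_Icc.2 (by linarith)) (right_mem_Icc.2 (by linarith))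
  rw [hk, ← ofReal_sub, norm_real]
  have h9 : ((x + h) ^ (σ + 1) - x ^ (σ + 1)) / (h * (σ * (σ + 1))) - x ^ σ / σ =
      (h * σ)⁻¹ * ((x + h) ^ (σ + 1) / (σ + 1) - x ^ σ * (x + h) -
        (x ^ (σ + 1) / (σ + 1) - x ^ σ * x)) := by
    field_simp
    ring
  rw [h9, norm_mul, Real.norm_of_nonneg (by positivity)]
  rw [add_sub_cancel_left, Real.norm_of_nonneg hh.le] at h1
  calc _ ≤ (h * σ)⁻¹ * (h * h) := by gcongr
    _ = h / σ := by field_simp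
    _ ≤ 2 * h := by
      rw [div_le_iff₀ (by linarith)]; nlinarith

lemma differentiableAt_kernel {x h : ℝ} {s : ℂ} (hx : 0 < x) (hh : 0 < h) (hs : 0 < s.re) :
    DifferentiableAt ℂ (kernel x h) s := by
  have h0 : s ≠ 0 := by rintro rfl; simp at hs
  have h1 : s + 1 ≠ 0 := fun h => by
    have := congrArg re h
    simp at this; linarith
  have hx0 : (x : ℂ) ≠ 0 := ofReal_ne_zero.2 hx.ne'
  have hx1 : ((x + h : ℝ) : ℂ) ≠ 0 := ofReal_ne_zero.2 (by positivity)
  refine DifferentiableAt.div ?_ (by fun_prop)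
    (mul_ne_zero (ofReal_ne_zero.2 hh.ne') (mul_ne_zero h0 h1))
  exact ((differentiableAt_id.add_const 1).const_cpow (Or.inl hx1)).sub
    ((differentiableAt_id.add_const 1).const_cpow (Or.inl hx0))

/-! ### Contour shift around the branch point -/

lemma intervalIntegrable_abs_sub_one_rpow (a b : ℝ) :
    IntervalIntegrable (fun σ : ℝ => |σ - 1| ^ (-(1 / 2) : ℝ)) volume a b := by
  have h0 : ∀ c : ℝ, 0 ≤ c →
      IntervalIntegrable (fun u : ℝ => |u| ^ (-(1 / 2) : ℝ)) volume 0 c := fun c hc => by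
    refine (intervalIntegral.intervalIntegrable_rpow' (r := -(1 / 2)) (by norm_num)).congr ?_
    intro u hu
    rw [uIoc_of_le hc] at hu
    simp only [abs_of_pos hu.1]
  have h1 : ∀ c : ℝ, IntervalIntegrable (fun u : ℝ => |u| ^ (-(1 / 2) : ℝ)) volume 0 c := fun c => by
    rcases le_total 0 c with hc | hc
    · exact h0 c hc
    · have := (h0 (-c) (by linarith)).comp_mul_left (c := -1)
      simpa using this
  have h2 := ((h1 (a - 1)).symm.trans (h1 (b - 1))).comp_sub_right 1
  simpa using h2

/-- Cauchy's theorem for a rectangle with one side on the real axis, where the function may have an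
inverse square root singularity at `1`. The height `T` may be negative. -/
lemma integral_boundary_rect_of_singularity {g : ℂ → ℂ} {α β T M : ℝ} (hα : α < 1) (hβ : 1 < β)
    (hT : T ≠ 0)
    (hd : ∀ x ∈ Icc α β, ∀ y ∈ uIcc 0 T, ¬ (x = 1 ∧ y = 0) → DifferentiableAt ℂ g (x + y * I))
    (hM : ∀ x ∈ Icc α β, ∀ y ∈ uIcc 0 T, x ≠ 1 → ‖g (x + y * I)‖ ≤ M * |x - 1| ^ (-(1 / 2) : ℝ)) :
    (∫ x in α..β, g x) - (∫ x in α..β, g (x + T * I)) + I * (∫ y in (0)..T, g (β + y * I)) -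
      I * (∫ y in (0)..T, g (α + y * I)) = 0 := by
  have hαβ : α ≤ β := by linarith
  have hmem : ∀ δ ∈ Ioc (0 : ℝ) 1, ∀ y ∈ uIcc (δ * T) T, y ∈ uIcc 0 T ∧ y ≠ 0 := by
    intro δ hδ y hy
    rcases lt_or_gt_of_ne hT with h | h
    · have h1 : T ≤ δ * T := by nlinarith [hδ.2]
      have h2 : δ * T < 0 := mul_neg_of_pos_of_neg hδ.1 h
      rw [uIcc_of_ge h1] at hy
      rw [uIcc_of_ge h.le]
      exact ⟨⟨hy.1, by linarith [hy.2]⟩, by linarith [hy.2]⟩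
    · have h1 : δ * T ≤ T := by nlinarith [hδ.2]
      have h2 : 0 < δ * T := mul_pos hδ.1 h
      rw [uIcc_of_le h1] at hy
      rw [uIcc_of_le h.le]
      refine ⟨⟨by linarith [hy.1], hy.2⟩, ?_⟩
      have := hy.1
      exact (by linarith : 0 < y).ne'
  have hcauchy : ∀ δ ∈ Ioc (0 : ℝ) 1, (∫ x in α..β, g (x + (δ * T : ℝ) * I)) -
      (∫ x in α..β, g (x + T * I)) + I * (∫ y in (δ * T)..T, g (β + y * I)) -
      I * (∫ y in (δ * T)..T, g (α + y * I)) = 0 := by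
    intro δ hδ
    have h := integral_boundary_rect_eq_zero_of_differentiableOn g (⟨α, δ * T⟩) (⟨β, T⟩) (by
      rintro s ⟨h1, h2⟩
      simp only [mem_preimage] at h1 h2
      rw [uIcc_of_le hαβ] at h1
      obtain ⟨h3, h4⟩ := hmem δ hδ _ h2
      have := hd s.re h1 s.im h3 (fun h => h4 h.2)
      rw [re_add_im] at this
      exact this.differentiableWithinAt)
    simpa using h
  have hδ : ∀ᶠ δ in 𝓝[>] (0 : ℝ), δ ∈ Ioc (0 : ℝ) 1 := Ioc_mem_nhdsGT one_pos
  have hmul : Tendsto (fun δ : ℝ => δ * T) (𝓝[>] 0) (𝓝[uIcc 0 T] 0) := by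
    refine tendsto_nhdsWithin_iff.2 ⟨?_, ?_⟩
    · have : Continuous fun δ : ℝ => δ * T := by fun_prop
      simpa using (this.tendsto 0).mono_left nhdsWithin_le_nhds
    · filter_upwards [hδ] with δ hδ
      exact (hmem δ hδ _ left_mem_uIcc).1
  have hvert : ∀ γ ∈ Icc α β, γ ≠ 1 → Tendsto (fun δ : ℝ => ∫ y in (δ * T)..T, g (γ + y * I))
      (𝓝[>] 0) (𝓝 (∫ y in (0)..T, g (γ + y * I))) := by
    intro γ hγ hγ1
    have hc : ContinuousOn (fun y : ℝ => g (γ + y * I)) (uIcc 0 T) := fun y hy =>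
      (ContinuousAt.comp (g := g) (f := fun y : ℝ => (γ + y * I : ℂ))
        (hd γ hγ y hy (fun h => hγ1 h.1)).continuousAt (by fun_prop)).continuousWithinAt
    have h1 := intervalIntegral.continuousOn_primitive_interval_left
      (hc.integrableOn_compact (μ := volume) isCompact_uIcc) 0 left_mem_uIcc
    exact Tendsto.comp h1 hmul
  have hmeas : ∀ y ∈ uIcc 0 T, AEStronglyMeasurable (fun x : ℝ => g (x + y * I))
      (volume.restrict (uIoc α β)) := by
    intro y hy
    have hc : ContinuousOn (fun x : ℝ => g (x + y * I)) (Ioc α β \ {1}) := fun x hx =>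
      (ContinuousAt.comp (g := g) (f := fun x : ℝ => (x + y * I : ℂ))
        (hd x ⟨hx.1.1.le, hx.1.2⟩ y hy (fun h => hx.2 h.1)).continuousAt
        (by fun_prop)).continuousWithinAt
    have := hc.aestronglyMeasurable (μ := volume)
      (measurableSet_Ioc.diff (measurableSet_singleton 1))
    rw [uIoc_of_le hαβ]
    rwa [Measure.restrict_congr_set (sdiff_null_ae_eq_self (by simp))] at this
  have hhor : Tendsto (fun δ : ℝ => ∫ x in α..β, g (x + (δ * T : ℝ) * I)) (𝓝[>] 0)
      (𝓝 (∫ x in α..β, g x)) := by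
    refine intervalIntegral.tendsto_integral_filter_of_dominated_convergence
      (fun x => M * |x - 1| ^ (-(1 / 2) : ℝ)) ?_ ?_
      ((intervalIntegrable_abs_sub_one_rpow α β).const_mul M) ?_
    · filter_upwards [hδ] with δ hδ
      exact hmeas _ (hmem δ hδ _ left_mem_uIcc).1
    · filter_upwards [hδ] with δ hδ
      filter_upwards [compl_mem_ae_iff.2 (measure_singleton (1 : ℝ))] with x hx1 hx
      rw [uIoc_of_le hαβ] at hx
      exact hM x ⟨hx.1.le, hx.2⟩ _ (hmem δ hδ _ left_mem_uIcc).1 hx1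
    · filter_upwards [compl_mem_ae_iff.2 (measure_singleton (1 : ℝ))] with x hx1 hx
      rw [uIoc_of_le hαβ] at hx
      have h1 := hd x ⟨hx.1.le, hx.2⟩ 0 left_mem_uIcc (fun h => hx1 h.1)
      have h2 : ContinuousAt (fun y : ℝ => g (x + y * I)) 0 :=
        ContinuousAt.comp (g := g) (f := fun y : ℝ => (x + y * I : ℂ)) h1.continuousAt
          (by fun_prop)
      have h3 := h2.tendsto.comp (hmul.mono_right nhdsWithin_le_nhds)
      simpa [Function.comp_def] using h3
  have hlim := ((hhor.sub_const (∫ x in α..β, g (x + T * I))).add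
    ((hvert β (right_mem_Icc.2 hαβ) hβ.ne').const_mul I)).sub
    ((hvert α (left_mem_Icc.2 hαβ) hα.ne).const_mul I)
  refine tendsto_nhds_unique hlim (tendsto_const_nhds.congr' ?_)
  filter_upwards [hδ] with δ hδ using (hcauchy δ hδ).symm

lemma I_cpow_neg_half_sq : I ^ (-(1 / 2) : ℂ) * I ^ (-(1 / 2) : ℂ) = -I := by
  rw [← cpow_add _ _ I_ne_zero, ← inv_I, ← cpow_neg_one]
  norm_num

lemma neg_I_cpow_neg_half_sq : (-I) ^ (-(1 / 2) : ℂ) * (-I) ^ (-(1 / 2) : ℂ) = I := by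
  rw [← cpow_add _ _ (neg_ne_zero.2 I_ne_zero)]
  norm_num [cpow_neg_one]

lemma mul_cpow_of_arg {z w : ℂ} (hz : z ≠ 0) (hw : w ≠ 0) (h : arg z + arg w ∈ Ioc (-Real.pi) Real.pi)
    (a : ℂ) : (z * w) ^ a = z ^ a * w ^ a := by
  rw [cpow_def_of_ne_zero (mul_ne_zero hz hw), cpow_def_of_ne_zero hz, cpow_def_of_ne_zero hw,
    Complex.log_mul hz hw h, add_mul, Complex.exp_add]

lemma ofReal_mul_cpow_of_pos {r : ℝ} (hr : 0 < r) {w : ℂ} (hw : w ≠ 0) (a : ℂ) :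
    (r * w) ^ a = (r : ℂ) ^ a * w ^ a :=
  mul_cpow_of_arg (ofReal_ne_zero.2 hr.ne') hw (by
    rw [arg_ofReal_of_nonneg hr.le, zero_add]; exact arg_mem_Ioc w) a

/-- The branch of `w ^ (-1/2)` that is analytic across the positive and the negative real axis from
the upper half-plane; the cut is the negative imaginary axis. -/
noncomputable def upperBranch (w : ℂ) : ℂ := I ^ (-(1 / 2) : ℂ) * (-I * w) ^ (-(1 / 2) : ℂ)

/-- The branch of `w ^ (-1/2)` cut along the positive imaginary axis. -/
noncomputable def lowerBranch (w : ℂ) : ℂ := (-I) ^ (-(1 / 2) : ℂ) * (I * w) ^ (-(1 / 2) : ℂ)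

lemma upperBranch_eq {w : ℂ} (hw : 0 < w.im) : upperBranch w = w ^ (-(1 / 2) : ℂ) := by
  have hw0 : w ≠ 0 := by rintro rfl; simp at hw
  have h1 : |arg (-I * w)| < Real.pi / 2 := abs_arg_lt_pi_div_two_iff.2 (Or.inl (by simpa))
  rw [abs_lt] at h1
  rw [upperBranch, ← mul_cpow_of_arg I_ne_zero (mul_ne_zero (neg_ne_zero.2 I_ne_zero) hw0)
    (by rw [arg_I]; constructor <;> linarith [Real.pi_pos, h1.1, h1.2])]
  rw [← mul_assoc, mul_neg, I_mul_I, neg_neg, one_mul]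

lemma lowerBranch_eq {w : ℂ} (hw : w.im < 0) : lowerBranch w = w ^ (-(1 / 2) : ℂ) := by
  have hw0 : w ≠ 0 := by rintro rfl; simp at hw
  have h1 : |arg (I * w)| < Real.pi / 2 := abs_arg_lt_pi_div_two_iff.2 (Or.inl (by simpa))
  rw [abs_lt] at h1
  rw [lowerBranch, ← mul_cpow_of_arg (neg_ne_zero.2 I_ne_zero) (mul_ne_zero I_ne_zero hw0)
    (by rw [arg_neg_I]; constructor <;> linarith [Real.pi_pos, h1.1, h1.2])]
  rw [← mul_assoc, neg_mul, I_mul_I, neg_neg, one_mul]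

lemma ofReal_cpow_neg_half {r : ℝ} (hr : 0 < r) :
    (r : ℂ) ^ (-(1 / 2) : ℂ) = ((r ^ (-(1 / 2) : ℝ) : ℝ) : ℂ) := by
  rw [ofReal_cpow hr.le]; norm_num

/-- The jump of `(σ - 1) ^ (-1/2)` across the cut. -/
lemma upperBranch_sub_lowerBranch_of_lt {σ : ℝ} (hσ : σ < 1) :
    upperBranch (σ - 1) - lowerBranch (σ - 1) = -2 * I * ((|σ - 1| ^ (-(1 / 2) : ℝ) : ℝ) : ℂ) := by
  have hr : 0 < 1 - σ := by linarith
  have h1 : -I * ((σ : ℂ) - 1) = ((1 - σ : ℝ) : ℂ) * I := by push_cast; ring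
  have h2 : I * ((σ : ℂ) - 1) = ((1 - σ : ℝ) : ℂ) * (-I) := by push_cast; ring
  have h3 : |σ - 1| = 1 - σ := by rw [abs_sub_comm, abs_of_pos hr]
  rw [upperBranch, lowerBranch, h1, h2, ofReal_mul_cpow_of_pos hr I_ne_zero,
    ofReal_mul_cpow_of_pos hr (neg_ne_zero.2 I_ne_zero), h3, ← ofReal_cpow_neg_half hr]
  linear_combination ((1 - σ : ℝ) : ℂ) ^ (-(1 / 2) : ℂ) *
    (I_cpow_neg_half_sq - neg_I_cpow_neg_half_sq)

lemma upperBranch_sub_lowerBranch_of_gt {σ : ℝ} (hσ : 1 < σ) :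
    upperBranch (σ - 1) - lowerBranch (σ - 1) = 0 := by
  have hr : 0 < σ - 1 := by linarith
  have h1 : -I * ((σ : ℂ) - 1) = ((σ - 1 : ℝ) : ℂ) * (-I) := by push_cast; ring
  have h2 : I * ((σ : ℂ) - 1) = ((σ - 1 : ℝ) : ℂ) * I := by push_cast; ring
  rw [upperBranch, lowerBranch, h1, h2, ofReal_mul_cpow_of_pos hr I_ne_zero,
    ofReal_mul_cpow_of_pos hr (neg_ne_zero.2 I_ne_zero)]
  ring

lemma norm_cpow_neg_half (w : ℂ) : ‖w ^ (-(1 / 2) : ℂ)‖ = ‖w‖ ^ (-(1 / 2) : ℝ) := by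
  have := norm_cpow_real w (-(1 / 2))
  push_cast at this
  exact this

lemma norm_upperBranch (w : ℂ) : ‖upperBranch w‖ = ‖w‖ ^ (-(1 / 2) : ℝ) := by
  rw [upperBranch, norm_mul, norm_cpow_neg_half, norm_cpow_neg_half]; simp

lemma norm_lowerBranch (w : ℂ) : ‖lowerBranch w‖ = ‖w‖ ^ (-(1 / 2) : ℝ) := by
  rw [lowerBranch, norm_mul, norm_cpow_neg_half, norm_cpow_neg_half]; simp

lemma differentiableAt_upperBranch {w : ℂ} (hw : 0 ≤ w.im) (hw0 : w ≠ 0) :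
    DifferentiableAt ℂ upperBranch w := by
  refine (DifferentiableAt.cpow_const (by fun_prop) ?_).const_mul _
  rw [mem_slitPlane_iff]
  rcases hw.eq_or_lt with h | h
  · right
    simp only [neg_mul, neg_im, I_mul_im, ne_eq, neg_eq_zero]
    exact fun h' => hw0 (Complex.ext h' h.symm)
  · left; simpa using h

lemma differentiableAt_lowerBranch {w : ℂ} (hw : w.im ≤ 0) (hw0 : w ≠ 0) :
    DifferentiableAt ℂ lowerBranch w := by
  refine (DifferentiableAt.cpow_const (by fun_prop) ?_).const_mul _
  rw [mem_slitPlane_iff]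
  rcases hw.eq_or_lt with h | h
  · right
    simp only [I_mul_im, ne_eq]
    exact fun h' => hw0 (Complex.ext h' h)
  · left; simpa using h

lemma rpow_neg_half_norm_le {x y : ℝ} (hx : x ≠ 1) :
    ‖(x + y * I - 1 : ℂ)‖ ^ (-(1 / 2) : ℝ) ≤ |x - 1| ^ (-(1 / 2) : ℝ) := by
  refine Real.rpow_le_rpow_of_nonpos (abs_pos.2 (sub_ne_zero.2 hx)) ?_ (by norm_num)
  have := abs_re_le_norm (x + y * I - 1 : ℂ)
  simpa using this

lemma integral_congr_of_sign {f g : ℝ → ℂ} {a b : ℝ} (h : ∀ y ∈ uIoc a b, y ≠ 0 → f y = g y) :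
    ∫ y in a..b, f y = ∫ y in a..b, g y := by
  refine intervalIntegral.integral_congr_ae ?_
  filter_upwards [compl_mem_ae_iff.2 (measure_singleton (0 : ℝ))] with y hy hy'
  exact h y hy' hy

/-- Moving the line of integration of `H(s) (s - 1)^{-1/2}` to the left of the branch point `1`
leaves the integral of the jump across the cut `[α, 1]`. -/
lemma integral_vertical_shift {H : ℂ → ℂ} {α β T : ℝ} (hα : α < 1) (hβ : 1 < β) (hT : 0 < T)
    (hd : ∀ x ∈ Icc α β, ∀ y ∈ Icc (-T) T, DifferentiableAt ℂ H (x + y * I)) :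
    I * (∫ y in (-T)..T, H (β + y * I) * (β + y * I - 1) ^ (-(1 / 2) : ℂ)) =
      I * (∫ y in (-T)..T, H (α + y * I) * (α + y * I - 1) ^ (-(1 / 2) : ℂ)) +
      (∫ x in α..β, H (x + T * I) * (x + T * I - 1) ^ (-(1 / 2) : ℂ)) -
      (∫ x in α..β, H (x + (-T : ℝ) * I) * (x + (-T : ℝ) * I - 1) ^ (-(1 / 2) : ℂ)) +
      2 * I * ∫ x in α..1, H x * ((|x - 1| ^ (-(1 / 2) : ℝ) : ℝ) : ℂ) := by
  have hαβ : α ≤ β := by linarith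
  obtain ⟨M, hM⟩ : ∃ M, ∀ x ∈ Icc α β, ∀ y ∈ Icc (-T) T, ‖H (x + y * I)‖ ≤ M := by
    have hc : ContinuousOn (fun p : ℝ × ℝ => H (p.1 + p.2 * I)) (Icc α β ×ˢ Icc (-T) T) :=
      fun p hp => (ContinuousAt.comp (g := H) (f := fun p : ℝ × ℝ => (p.1 + p.2 * I : ℂ))
        (hd p.1 hp.1 p.2 hp.2).continuousAt (by fun_prop)).continuousWithinAt
    obtain ⟨M, hM⟩ := (isCompact_Icc.prod isCompact_Icc).exists_bound_of_continuousOn hc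
    exact ⟨M, fun x hx y hy => hM (x, y) ⟨hx, hy⟩⟩
  have hM0 : 0 ≤ M := (norm_nonneg _).trans
    (hM α (left_mem_Icc.2 hαβ) 0 ⟨by linarith, hT.le⟩)
  have hne : ∀ x y : ℝ, ¬ (x = 1 ∧ y = 0) → (x + y * I - 1 : ℂ) ≠ 0 := fun x y h h' => by
    have h1 := congrArg re h'
    have h2 := congrArg im h'
    simp at h1 h2
    exact h ⟨by linarith, h2⟩
  have hup := integral_boundary_rect_of_singularity (g := fun s => H s * upperBranch (s - 1))
    (M := M) hα hβ hT.ne' (fun x hx y hy hxy => by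
      rw [uIcc_of_le hT.le] at hy
      refine (hd x hx y ⟨by linarith [hy.1], hy.2⟩).mul ?_
      exact DifferentiableAt.comp (g := upperBranch) (f := fun s => s - 1) _
        (differentiableAt_upperBranch (by simpa using hy.1) (hne x y hxy)) (by fun_prop))
    (fun x hx y hy hx1 => by
      rw [uIcc_of_le hT.le] at hy
      rw [norm_mul, norm_upperBranch]
      exact mul_le_mul (hM x hx y ⟨by linarith [hy.1], hy.2⟩) (rpow_neg_half_norm_le hx1)
        (by positivity) hM0)
  have hlo := integral_boundary_rect_of_singularity (g := fun s => H s * lowerBranch (s - 1))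
    (M := M) hα hβ (neg_ne_zero.2 hT.ne') (fun x hx y hy hxy => by
      rw [uIcc_of_ge (by linarith)] at hy
      refine (hd x hx y ⟨hy.1, by linarith [hy.2]⟩).mul ?_
      exact DifferentiableAt.comp (g := lowerBranch) (f := fun s => s - 1) _
        (differentiableAt_lowerBranch (by simpa using hy.2) (hne x y hxy)) (by fun_prop))
    (fun x hx y hy hx1 => by
      rw [uIcc_of_ge (by linarith)] at hy
      rw [norm_mul, norm_lowerBranch]
      exact mul_le_mul (hM x hx y ⟨hy.1, by linarith [hy.2]⟩) (rpow_neg_half_norm_le hx1)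
        (by positivity) hM0)
  have hupv : ∀ γ : ℝ, ∫ y in (0)..T, H (γ + y * I) * upperBranch (γ + y * I - 1) =
      ∫ y in (0)..T, H (γ + y * I) * (γ + y * I - 1) ^ (-(1 / 2) : ℂ) := fun γ =>
    integral_congr_of_sign fun y hy _ => by
      rw [uIoc_of_le hT.le] at hy
      rw [upperBranch_eq (by simpa using hy.1)]
  have hlov : ∀ γ : ℝ, ∫ y in (0)..(-T), H (γ + y * I) * lowerBranch (γ + y * I - 1) =
      ∫ y in (0)..(-T), H (γ + y * I) * (γ + y * I - 1) ^ (-(1 / 2) : ℂ) := fun γ =>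
    integral_congr_of_sign fun y hy hy0 => by
      rw [uIoc_of_ge (by linarith)] at hy
      rw [lowerBranch_eq (by simpa using lt_of_le_of_ne hy.2 hy0)]
  have hvi : ∀ γ ∈ Icc α β, γ ≠ 1 → ∀ a ∈ Icc (-T) T, ∀ b ∈ Icc (-T) T, IntervalIntegrable
      (fun y : ℝ => H (γ + y * I) * (γ + y * I - 1) ^ (-(1 / 2) : ℂ)) volume a b := by
    intro γ hγ hγ1 a ha b hb
    have hsub : uIoc a b ⊆ Icc (-T) T := uIoc_subset_uIcc.trans (uIcc_subset_Icc ha hb)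
    have hmeas : AEStronglyMeasurable
        (fun y : ℝ => H (γ + y * I) * (γ + y * I - 1) ^ (-(1 / 2) : ℂ))
        (volume.restrict (uIoc a b)) := by
      refine AEStronglyMeasurable.mul ?_ ?_
      · refine ContinuousOn.aestronglyMeasurable (fun y hy => ?_) measurableSet_uIoc
        exact (ContinuousAt.comp (g := H) (f := fun y : ℝ => (γ + y * I : ℂ))
          (hd γ hγ y (hsub hy)).continuousAt (by fun_prop)).continuousWithinAt
      · exact (Measurable.pow_const (by fun_prop) _).aestronglyMeasurable
    refine (intervalIntegrable_const (c := M * |γ - 1| ^ (-(1 / 2) : ℝ))).mono_fun' hmeas ?_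
    refine (ae_restrict_iff' measurableSet_uIoc).2 (ae_of_all _ fun y hy => ?_)
    beta_reduce
    rw [norm_mul, norm_cpow_neg_half]
    exact mul_le_mul (hM γ hγ y (hsub hy)) (rpow_neg_half_norm_le hγ1) (by positivity) hM0
  have hsplit : ∀ γ ∈ Icc α β, γ ≠ 1 →
      ∫ y in (-T)..T, H (γ + y * I) * (γ + y * I - 1) ^ (-(1 / 2) : ℂ) =
      (∫ y in (0)..T, H (γ + y * I) * (γ + y * I - 1) ^ (-(1 / 2) : ℂ)) -
      ∫ y in (0)..(-T), H (γ + y * I) * (γ + y * I - 1) ^ (-(1 / 2) : ℂ) := by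
    intro γ hγ hγ1
    rw [intervalIntegral.integral_interval_sub_left
      (hvi γ hγ hγ1 0 ⟨by linarith, hT.le⟩ T ⟨by linarith, le_rfl⟩)
      (hvi γ hγ hγ1 0 ⟨by linarith, hT.le⟩ (-T) ⟨le_rfl, by linarith⟩)]
  have hHc : ContinuousOn (fun x : ℝ => H x) (Icc α β) := fun x hx => by
    have h1 := (hd x hx 0 ⟨by linarith, hT.le⟩).continuousAt
    rw [ofReal_zero, zero_mul, add_zero] at h1
    exact (ContinuousAt.comp (g := H) (f := fun x : ℝ => (x : ℂ)) h1
      (by fun_prop)).continuousWithinAt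
  have hbase : ∀ k : ℂ → ℂ, Measurable k → (∀ w, ‖k w‖ = ‖w‖ ^ (-(1 / 2) : ℝ)) →
      IntervalIntegrable (fun x : ℝ => H x * k (x - 1)) volume α β := by
    intro k hk hkn
    refine (((intervalIntegrable_abs_sub_one_rpow α β).const_mul M)).mono_fun' ?_ ?_
    · refine AEStronglyMeasurable.mul ?_ (hk.comp (by fun_prop)).aestronglyMeasurable
      exact (hHc.mono (by rw [uIoc_of_le hαβ]; exact Ioc_subset_Icc_self)).aestronglyMeasurable
        measurableSet_uIoc
    · refine (ae_restrict_iff' measurableSet_uIoc).2 (ae_of_all _ fun x hx => ?_)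
      rw [uIoc_of_le hαβ] at hx
      have h1 := hM x ⟨hx.1.le, hx.2⟩ 0 ⟨by linarith, hT.le⟩
      rw [ofReal_zero, zero_mul, add_zero] at h1
      have h2 : ‖(x : ℂ) - 1‖ = |x - 1| := by
        rw [← ofReal_one, ← ofReal_sub, norm_real, Real.norm_eq_abs]
      beta_reduce
      rw [norm_mul, hkn, h2]
      gcongr
  have hjump : (∫ x in α..β, H x * upperBranch (x - 1)) - (∫ x in α..β, H x * lowerBranch (x - 1)) =
      -(2 * I * ∫ x in α..1, H x * ((|x - 1| ^ (-(1 / 2) : ℝ) : ℝ) : ℂ)) := by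
    have hmu : Measurable upperBranch := by
      unfold upperBranch
      exact (Measurable.pow_const (by fun_prop) _).const_mul _
    have hml : Measurable lowerBranch := by
      unfold lowerBranch
      exact (Measurable.pow_const (by fun_prop) _).const_mul _
    have hiu := hbase _ hmu norm_upperBranch
    have hil := hbase _ hml norm_lowerBranch
    have h1mem : (1 : ℝ) ∈ uIcc α β := by
      rw [uIcc_of_le hαβ]; exact ⟨hα.le, hβ.le⟩
    have hi := hiu.sub hil
    rw [← intervalIntegral.integral_sub hiu hil,
      ← intervalIntegral.integral_add_adjacent_intervals (b := 1)
        (hi.mono_set (uIcc_subset_uIcc_left h1mem)) (hi.mono_set (uIcc_subset_uIcc_right h1mem)),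
      ← intervalIntegral.integral_const_mul, ← intervalIntegral.integral_neg]
    have h2 : ∫ x in (1 : ℝ)..β, (H x * upperBranch (x - 1) - H x * lowerBranch (x - 1)) = 0 := by
      rw [← intervalIntegral.integral_zero (μ := volume) (a := 1) (b := β)]
      refine intervalIntegral.integral_congr_ae (ae_of_all _ fun x hx => ?_)
      rw [uIoc_of_le hβ.le] at hx
      rw [← mul_sub, upperBranch_sub_lowerBranch_of_gt hx.1, mul_zero]
    rw [h2, add_zero]
    refine intervalIntegral.integral_congr_ae ?_
    filter_upwards [compl_mem_ae_iff.2 (measure_singleton (1 : ℝ))] with x hx1 hx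
    rw [uIoc_of_le hα.le] at hx
    rw [← mul_sub, upperBranch_sub_lowerBranch_of_lt (lt_of_le_of_ne hx.2 hx1)]
    ring
  have hhu : ∀ x : ℝ, upperBranch (x + T * I - 1) = (x + T * I - 1) ^ (-(1 / 2) : ℂ) := fun x =>
    upperBranch_eq (by simpa)
  have hhl : ∀ x : ℝ, lowerBranch (x + (-T : ℝ) * I - 1) =
      (x + (-T : ℝ) * I - 1) ^ (-(1 / 2) : ℂ) := fun x => lowerBranch_eq (by simpa)
  simp only [hupv, hhu] at hup
  simp only [hlov, hhl] at hlo
  rw [hsplit β (right_mem_Icc.2 hαβ) hβ.ne', hsplit α (left_mem_Icc.2 hαβ) hα.ne]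
  linear_combination hup - hlo - hjump

/-! ### The counting function in terms of an integral to the left of `1` -/

/-- Truncation of an integral over the line whose integrand decays quadratically. -/
lemma norm_integral_sub_truncation_le {f : ℝ → ℂ} {T K : ℝ} (hT : 0 < T) (hf : Integrable f)
    (hK : ∀ y : ℝ, T ≤ |y| → ‖f y‖ ≤ K * |y| ^ (-2 : ℝ)) :
    ‖(∫ y, f y) - ∫ y in (-T)..T, f y‖ ≤ 2 * K / T := by
  have hbase : ∀ g : ℝ → ℂ, (∀ y : ℝ, T ≤ |y| → ‖g y‖ ≤ K * |y| ^ (-2 : ℝ)) →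
      ‖∫ y in Ioi T, g y‖ ≤ K / T := by
    intro g hg
    have h1 := norm_integral_le_of_norm_le (μ := volume.restrict (Ioi T))
      ((integrableOn_Ioi_rpow_of_lt (a := -2) (by norm_num) hT).const_mul K)
      ((ae_restrict_iff' measurableSet_Ioi).2 (ae_of_all _ fun y (hy : T < y) => by
        have h := hg y (hy.le.trans (le_abs_self y))
        rwa [abs_of_pos (hT.trans hy)] at h)) (f := g)
    refine h1.trans_eq ?_
    rw [integral_const_mul, integral_Ioi_rpow_of_lt (by norm_num) hT]
    norm_num [Real.rpow_neg_one]
    rfl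
  have h1 := hbase f hK
  have h2 := hbase (fun y => f (-y)) (fun y hy => by simpa using hK (-y) (by simpa using hy))
  rw [integral_comp_neg_Ioi (f := f)] at h2
  have h3 : (∫ y, f y) - ∫ y in (-T)..T, f y = (∫ y in Iic (-T), f y) + ∫ y in Ioi T, f y := by
    rw [intervalIntegral.integral_of_le (by linarith), sub_eq_iff_eq_add,
      ← intervalIntegral.integral_Iic_add_Ioi (b := -T) hf.integrableOn hf.integrableOn,
      ← Ioc_union_Ioi_eq_Ioi (show -T ≤ T by linarith),
      setIntegral_union Ioc_disjoint_Ioi_same measurableSet_Ioi hf.integrableOn hf.integrableOn]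
    ring
  rw [h3]
  calc _ ≤ _ := norm_add_le _ _
    _ ≤ K / T + K / T := add_le_add h2 h1
    _ = _ := by ring

section
variable {A B : ℂ → ℂ} (hA : IsSqrtBranch zetaReg A) (hB : IsSqrtBranch chi4.LFunction B)
include hA hB

lemma exists_norm_G_le {δ : ℝ} (hδ : 0 < δ) : ∃ C : ℝ, 0 < C ∧ ∀ s : ℂ, s ∈ domG →
    1 / 2 + δ ≤ s.re → ‖G A B s‖ ^ 2 ≤ C * ‖s‖ ^ 3 := by
  obtain ⟨C, hC, h⟩ := exists_norm_G_sq_le hA hB hδ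
  refine ⟨16 * C, by positivity, fun s hs hre => (h s hs hre).trans ?_⟩
  have h1 := norm_zetaReg_le (s := s) (by linarith)
  have h2 := norm_LFunction_chi4_le (s := s) (by linarith)
  calc C * (‖zetaReg s‖ * ‖chi4.LFunction s‖) ≤ C * ((8 * ‖s‖ ^ 2) * (2 * ‖s‖)) := by gcongr
    _ = _ := by ring

/-- A bound linear in the height; with the decay `|s|^{-2}` of the kernel it makes the horizontal sides
of the contour small. -/
lemma exists_norm_G_mul_cpow_le {δ : ℝ} (hδ : 0 < δ) : ∃ C : ℝ, 0 < C ∧ ∀ s : ℂ, s ∈ domG →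
    1 / 2 + δ ≤ s.re → s.re ≤ 2 → 2 ≤ |s.im| →
    ‖G A B s * (s - 1) ^ (-(1 / 2) : ℂ)‖ ≤ C * |s.im| := by
  obtain ⟨C, hC, h⟩ := exists_norm_G_le hA hB hδ
  refine ⟨1 + 8 * C, by positivity, fun s hs hre hre2 him => ?_⟩
  have h1 := h s hs hre
  have him0 : 0 < |s.im| := by linarith
  have h2 : |s.im| ≤ ‖s - 1‖ := by simpa using abs_im_le_norm (s - 1)
  have h3 : ‖s‖ ≤ 2 * |s.im| := by
    have := norm_le_abs_re_add_abs_im s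
    rw [abs_of_nonneg (by linarith : 0 ≤ s.re)] at this
    linarith
  refine le_of_sq_le_sq ?_ (by positivity)
  rw [norm_mul, norm_cpow_neg_half, mul_pow]
  have h4 : (‖s - 1‖ ^ (-(1 / 2) : ℝ)) ^ 2 ≤ |s.im|⁻¹ := by
    rw [← Real.rpow_natCast, ← Real.rpow_mul (norm_nonneg _)]
    norm_num
    rw [Real.rpow_neg_one]
    exact inv_anti₀ him0 h2
  calc _ ≤ (C * (2 * |s.im|) ^ 3) * |s.im|⁻¹ := by
        gcongr
        exact h1.trans (by gcongr)
    _ = 8 * C * |s.im| ^ 2 := by field_simp; ring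
    _ ≤ _ := by
      rw [mul_pow]
      gcongr
      nlinarith

lemma continuousOn_G_ofReal : ContinuousOn (fun σ : ℝ => G A B σ) (Ioi (1 / 2)) := fun σ hσ =>
  (ContinuousAt.comp (g := G A B) (f := fun x : ℝ => (x : ℂ))
    (analyticOnNhd_G hA hB _ (ofReal_mem_domG hσ)).continuousAt (by fun_prop)).continuousWithinAt

lemma exists_norm_G_ofReal_le {δ : ℝ} (hδ : 0 < δ) : ∃ M : ℝ, 0 < M ∧
    ∀ σ ∈ Icc (1 / 2 + δ) 1, ‖G A B (σ : ℝ)‖ ≤ M := by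
  obtain ⟨M, hM⟩ := isCompact_Icc.exists_bound_of_continuousOn
    ((continuousOn_G_ofReal hA hB).mono
      (fun σ (hσ : σ ∈ Icc (1 / 2 + δ) 1) => show (1:ℝ) / 2 < σ by linarith [hσ.1]))
  exact ⟨max M 1, by positivity, fun σ hσ => (hM σ hσ).trans (le_max_left _ _)⟩

omit hA hB in
/-- An integral of `G` over a part of the real segment, against a kernel bounded by `K`. -/
lemma norm_integral_G_mul_le {δ M K a b : ℝ} {k : ℝ → ℂ} (hδ : 0 < δ)
    (hM : ∀ σ ∈ Icc (1 / 2 + δ) 1, ‖G A B (σ : ℝ)‖ ≤ M) (ha : 1 / 2 + δ ≤ a) (hab : a ≤ b)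
    (hb : b ≤ 1) (hK0 : 0 ≤ K) (hM0 : 0 ≤ M) (hk : ∀ σ ∈ Icc a b, ‖k σ‖ ≤ K) :
    ‖∫ σ in a..b, G A B (σ : ℝ) * (k σ * ((|σ - 1| ^ (-(1 / 2) : ℝ) : ℝ) : ℂ))‖ ≤
      M * K * ∫ σ in (1 / 2)..1, |σ - 1| ^ (-(1 / 2) : ℝ) := by
  have h1 := intervalIntegral.norm_integral_le_of_norm_le hab
    (g := fun σ => M * K * |σ - 1| ^ (-(1 / 2) : ℝ))
    (f := fun σ => G A B (σ : ℝ) * (k σ * ((|σ - 1| ^ (-(1 / 2) : ℝ) : ℝ) : ℂ))) (μ := volume)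
    (ae_of_all _ fun σ hσ => by
      have h2 := hM σ ⟨by linarith [hσ.1], by linarith [hσ.2]⟩
      have h3 := hk σ ⟨hσ.1.le, hσ.2⟩
      rw [norm_mul, norm_mul, norm_real, Real.norm_of_nonneg (by positivity), ← mul_assoc]
      gcongr) ((intervalIntegrable_abs_sub_one_rpow a b).const_mul _)
  refine h1.trans ?_
  rw [intervalIntegral.integral_const_mul]
  refine mul_le_mul_of_nonneg_left ?_ (by positivity)
  exact intervalIntegral.integral_mono_interval (by linarith) hab hb
    (ae_of_all _ fun σ => by positivity) (intervalIntegrable_abs_sub_one_rpow _ _)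

omit hA hB in
lemma integral_abs_rpow_nonneg : 0 ≤ ∫ σ in (1 / 2)..(1 : ℝ), |σ - 1| ^ (-(1 / 2) : ℝ) :=
  intervalIntegral.integral_nonneg (by norm_num) fun σ _ => by positivity

omit hA hB in
lemma main_integrand_eq (x σ : ℝ) (g : ℂ) :
    g * ((x ^ σ / (σ * |σ - 1| ^ (1 / 2 : ℝ)) : ℝ) : ℂ) =
      g * (((x ^ σ / σ : ℝ) : ℂ) * ((|σ - 1| ^ (-(1 / 2) : ℝ) : ℝ) : ℂ)) := by
  rw [← ofReal_mul, Real.rpow_neg (abs_nonneg _), ← div_eq_mul_inv, div_div]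

set_option maxHeartbeats 1000000 in
/-- Perron's formula with the line of integration moved to `Re s = σ₀`, in terms of the integral of
`|G(s)| |s - 1|^{-1/2} / |s|` over that line. -/
lemma exists_norm_count_sub_le {δ : ℝ} (hδ : 0 < δ) : ∃ C : ℝ, 0 < C ∧ ∀ x σ₀ T h : ℝ,
    Real.exp 1 ≤ x → 1 / 2 + δ ≤ σ₀ → σ₀ < 1 → 2 ≤ T → 0 < h → h ≤ x →
    (∀ s : ℂ, σ₀ ≤ s.re → |s.im| ≤ T → zetaL s ≠ 0) →
    ‖(countTwoSquares x : ℂ) - 1 / (Real.pi : ℂ) *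
        ∫ σ in σ₀..1, G A B (σ : ℂ) * ((x ^ σ / (σ * |σ - 1| ^ (1 / 2 : ℝ)) : ℝ) : ℂ)‖ ≤
      C * (h + 1 + x ^ 2 * Real.log x / (h * T) + x ^ σ₀ *
        ∫ t in (-T)..T, ‖G A B (σ₀ + t * I)‖ * ‖(σ₀ + t * I - 1 : ℂ)‖ ^ (-(1 / 2) : ℝ) /
          ‖(σ₀ + t * I : ℂ)‖) := by
  obtain ⟨C₁, hC₁, hG⟩ := exists_norm_G_mul_cpow_le hA hB hδ
  obtain ⟨M, hM0, hM⟩ := exists_norm_G_ofReal_le hA hB hδ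
  set I₀ := ∫ σ in (1 / 2)..(1 : ℝ), |σ - 1| ^ (-(1 / 2) : ℝ) with hI₀
  have hI₀0 : 0 ≤ I₀ := integral_abs_rpow_nonneg
  have he3 : Real.exp 1 ≤ 3 := Real.exp_one_lt_three.le
  refine ⟨1728 + 108 * C₁ + 4 + 1 + 2 * M * I₀, by positivity, fun x σ₀ T h hx hσ₀ hσ1 hT hh hhx hz => ?_⟩
  have hx0 : 0 < x := (Real.exp_pos 1).trans_le hx
  have hx1 : 1 ≤ x := (Real.one_le_exp zero_le_one).trans hx
  have hL : 1 ≤ Real.log x := (Real.le_log_iff_exp_le hx0).2 hx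
  have hT0 : 0 < T := by linarith
  set κ := 1 + 1 / Real.log x with hκ
  have hκ1 : 1 < κ := by rw [hκ]; have : 0 < 1 / Real.log x := by positivity
                         linarith
  have hκ2 : κ ≤ 2 := by
    have : 1 / Real.log x ≤ 1 := by rw [div_le_one (by linarith)]; exact hL
    linarith
  have hxκ : x ^ (κ + 1) = x ^ 2 * Real.exp 1 := by
    have : κ + 1 = 2 + 1 / Real.log x := by rw [hκ]; ring
    rw [this, Real.rpow_add hx0, Real.rpow_two, Real.rpow_def_of_pos hx0 (1 / _)]
    congr 2
    field_simp
  have hmem : ∀ u ∈ Icc σ₀ κ, ∀ y ∈ Icc (-T) T, (u + y * I : ℂ) ∈ domG := by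
    intro u hu y hy
    refine mem_domG_of_zetaL_ne_zero (by simp; linarith [hu.1]) fun t ht => hz _ ?_ ?_
    · simp; linarith [hu.1]
    · simpa using abs_le.2 hy
  have hre : ∀ u y : ℝ, (u + y * I : ℂ).re = u := fun u y => by simp
  have him : ∀ u y : ℝ, (u + y * I : ℂ).im = y := fun u y => by simp
  -- the truncated integral on the line `Re s = κ`
  set P := ∫ y in (-T)..T, twoSquaresSeries (κ + y * I) * kernel x h (κ + y * I) with hP
  have htail : ‖2 * Real.pi * (((rieszSum (x + h) - rieszSum x) / h : ℝ) : ℂ) - P‖ ≤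
      1728 * (x ^ 2 * Real.log x / (h * T)) := by
    rw [← integral_series_mul_kernel hκ1 hκ2 hx0 hh]
    refine (norm_integral_sub_truncation_le hT0 (integrable_series_mul_kernel hκ1 hκ2 hx0 hh)
      (K := 32 * Real.log x * (9 * (x ^ 2 * Real.exp 1) / h)) fun y hy => ?_).trans ?_
    · have h1 := norm_LSeries_le norm_twoSquaresCoeff_le (s := (κ + y * I : ℂ))
        (by rw [hre]; exact hκ1) (by rw [hre]; exact hκ2)
      have h2 := norm_kernel_le_sq (s := (κ + y * I : ℂ)) hx0 hh hhx
        (by rw [hre]; linarith) (by rw [hre]; exact hκ2)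
      rw [hre] at h1 h2
      have h3 : 32 / (κ - 1) = 32 * Real.log x := by rw [hκ]; simp
      rw [h3] at h1
      rw [hxκ] at h2
      have hy0 : 0 < |y| := hT0.trans_le hy
      have h4 : |y| ≤ ‖(κ + y * I : ℂ)‖ := by
        have := abs_im_le_norm (κ + y * I : ℂ); rwa [him] at this
      rw [norm_mul]
      calc _ ≤ (32 * Real.log x) * (9 * (x ^ 2 * Real.exp 1) / (h * |y| ^ 2)) := by
            refine mul_le_mul h1 (h2.trans ?_) (norm_nonneg _) (by positivity)
            gcongr
        _ = _ := by
          rw [Real.rpow_neg hy0.le, Real.rpow_two]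
          field_simp
    · have : 2 * (32 * Real.log x * (9 * (x ^ 2 * Real.exp 1) / h)) / T =
          576 * Real.exp 1 * (x ^ 2 * Real.log x / (h * T)) := by field_simp; ring
      rw [this]
      gcongr
      linarith
  have hseries : ∀ y : ℝ, twoSquaresSeries (κ + y * I) * kernel x h (κ + y * I) =
      (G A B (κ + y * I) * kernel x h (κ + y * I)) * (κ + y * I - 1) ^ (-(1 / 2) : ℂ) := fun y => by
    rw [twoSquaresSeries_eq hA hB (by rw [hre]; exact hκ1)]; ring
  have hshift := integral_vertical_shift (H := fun s => G A B s * kernel x h s) hσ1 hκ1 hT0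
    (fun u hu y hy => ((analyticOnNhd_G hA hB _ (hmem u hu y hy)).differentiableAt).mul
      (differentiableAt_kernel hx0 hh (by rw [hre]; linarith [hu.1])))
  simp only [← hseries] at hshift
  rw [← hP] at hshift
  -- the horizontal sides
  have hhor : ∀ y : ℝ, |y| = T →
      ‖∫ u in σ₀..κ, G A B (u + y * I) * kernel x h (u + y * I) *
        (u + y * I - 1) ^ (-(1 / 2) : ℂ)‖ ≤ 54 * C₁ * (x ^ 2 * Real.log x / (h * T)) := by
    intro y hy
    have h1 : ∀ u ∈ uIoc σ₀ κ, ‖G A B (u + y * I) * kernel x h (u + y * I) *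
        (u + y * I - 1) ^ (-(1 / 2) : ℂ)‖ ≤ 27 * C₁ * (x ^ 2 / (h * T)) := by
      intro u hu
      rw [uIoc_of_le (by linarith)] at hu
      have hyT : y ∈ Icc (-T) T := abs_le.1 hy.le
      have h2 := hG _ (hmem u ⟨hu.1.le, hu.2⟩ y hyT) (by rw [hre]; linarith [hu.1])
        (by rw [hre]; linarith [hu.2]) (by rw [him, hy]; exact hT)
      rw [him, hy] at h2
      have h3 := norm_kernel_le_sq (s := (u + y * I : ℂ)) hx0 hh hhx
        (by rw [hre]; linarith [hu.1]) (by rw [hre]; linarith [hu.2])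
      rw [hre] at h3
      have h4 : T ≤ ‖(u + y * I : ℂ)‖ := by
        have := abs_im_le_norm (u + y * I : ℂ); rwa [him, hy] at this
      have h5 : x ^ (u + 1) ≤ x ^ 2 * 3 := by
        calc x ^ (u + 1) ≤ x ^ (κ + 1) :=
              Real.rpow_le_rpow_of_exponent_le hx1 (by linarith [hu.2])
          _ ≤ _ := by rw [hxκ]; gcongr
      rw [mul_right_comm, norm_mul]
      calc _ ≤ C₁ * T * (9 * (x ^ 2 * 3) / (h * T ^ 2)) := by
            refine mul_le_mul h2 (h3.trans ?_) (norm_nonneg _) (by positivity)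
            gcongr
        _ = _ := by field_simp; ring
    refine (intervalIntegral.norm_integral_le_of_norm_le_const h1).trans ?_
    have h6 : |κ - σ₀| ≤ 2 := by rw [abs_of_pos (by linarith)]; linarith
    calc _ ≤ 27 * C₁ * (x ^ 2 / (h * T)) * 2 := by gcongr
      _ = 54 * C₁ * (x ^ 2 * 1 / (h * T)) := by ring
      _ ≤ _ := by gcongr
  -- the vertical side on `Re s = σ₀`
  set W := ∫ t in (-T)..T, ‖G A B (σ₀ + t * I)‖ * ‖(σ₀ + t * I - 1 : ℂ)‖ ^ (-(1 / 2) : ℝ) /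
    ‖(σ₀ + t * I : ℂ)‖ with hW
  have hW0 : 0 ≤ W := intervalIntegral.integral_nonneg (by linarith) fun t _ => by positivity
  have hleft : ‖∫ y in (-T)..T, G A B (σ₀ + y * I) * kernel x h (σ₀ + y * I) *
      (σ₀ + y * I - 1) ^ (-(1 / 2) : ℂ)‖ ≤ 4 * (x ^ σ₀ * W) := by
    have h1 : IntervalIntegrable (fun t : ℝ => ‖G A B (σ₀ + t * I)‖ *
        ‖(σ₀ + t * I - 1 : ℂ)‖ ^ (-(1 / 2) : ℝ) / ‖(σ₀ + t * I : ℂ)‖) volume (-T) T := by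
      refine ContinuousOn.intervalIntegrable fun y hy => ContinuousAt.continuousWithinAt ?_
      rw [uIcc_of_le (by linarith)] at hy
      have h2 : ContinuousAt (fun t : ℝ => G A B (σ₀ + t * I)) y :=
        ContinuousAt.comp (g := G A B) (f := fun t : ℝ => (σ₀ + t * I : ℂ))
          (analyticOnNhd_G hA hB _ (hmem σ₀ ⟨le_rfl, by linarith⟩ y hy)).continuousAt
          (by fun_prop)
      have h3 : (σ₀ + y * I - 1 : ℂ) ≠ 0 := fun h => by
        have := congrArg re h
        simp at this; linarith
      have h4 : (σ₀ + y * I : ℂ) ≠ 0 := fun h => by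
        have := congrArg re h
        simp at this; linarith
      have h6 : ContinuousAt (fun t : ℝ => ‖(σ₀ + t * I - 1 : ℂ)‖ ^ (-(1 / 2) : ℝ)) y :=
        ContinuousAt.rpow_const (by fun_prop) (Or.inl (norm_ne_zero_iff.2 h3))
      have h7 : ContinuousAt (fun t : ℝ => ‖(σ₀ + t * I : ℂ)‖) y := by fun_prop
      exact (h2.norm.mul h6).div h7 (norm_ne_zero_iff.2 h4)
    have h5 := intervalIntegral.norm_integral_le_of_norm_le (by linarith : -T ≤ T) (μ := volume)
      (f := fun y : ℝ => G A B (σ₀ + y * I) * kernel x h (σ₀ + y * I) *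
        (σ₀ + y * I - 1) ^ (-(1 / 2) : ℂ)) (ae_of_all _ fun y hy => by
        have h6 := norm_kernel_le (s := (σ₀ + y * I : ℂ)) hx0 hh hhx
          (by rw [hre]; linarith) (by rw [hre]; linarith)
        rw [hre] at h6
        rw [norm_mul, norm_mul, norm_cpow_neg_half, mul_right_comm]
        exact mul_le_mul_of_nonneg_left h6 (by positivity)) (h1.const_mul (4 * x ^ σ₀) |>.congr
          (g := fun t : ℝ => ‖G A B (σ₀ + t * I)‖ * ‖(σ₀ + t * I - 1 : ℂ)‖ ^ (-(1 / 2) : ℝ) *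
            (4 * x ^ σ₀ / ‖(σ₀ + t * I : ℂ)‖)) (fun t _ => by ring))
    refine h5.trans_eq ?_
    rw [hW, ← mul_assoc, ← intervalIntegral.integral_const_mul]
    congr 1
    funext t
    ring
  -- the jump across the cut
  set J := ∫ u in σ₀..1, G A B (u : ℝ) * kernel x h (u : ℝ) *
    ((|u - 1| ^ (-(1 / 2) : ℝ) : ℝ) : ℂ) with hJ
  set J' := ∫ σ in σ₀..1, G A B (σ : ℂ) * ((x ^ σ / (σ * |σ - 1| ^ (1 / 2 : ℝ)) : ℝ) : ℂ) with hJ'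
  have hJJ : ‖J - J'‖ ≤ 2 * M * I₀ * h := by
    have hGc : ContinuousOn (fun σ : ℝ => G A B σ) (uIcc σ₀ 1) :=
      (continuousOn_G_ofReal hA hB).mono fun σ hσ => by
        rw [uIcc_of_le hσ1.le] at hσ
        exact (by linarith [hσ.1] : (1:ℝ) / 2 < σ)
    have hkc : ContinuousOn (fun σ : ℝ => kernel x h σ) (uIcc σ₀ 1) := fun σ hσ => by
      rw [uIcc_of_le hσ1.le] at hσ
      exact (ContinuousAt.comp (g := kernel x h) (f := fun x : ℝ => (x : ℂ))
        (differentiableAt_kernel hx0 hh (by simp; linarith [hσ.1])).continuousAt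
        (by fun_prop)).continuousWithinAt
    have hxc : ContinuousOn (fun σ : ℝ => ((x ^ σ / σ : ℝ) : ℂ)) (uIcc σ₀ 1) := by
      refine continuous_ofReal.comp_continuousOn (ContinuousOn.div ?_ continuousOn_id ?_)
      · exact (Continuous.rpow continuous_const continuous_id (fun _ => Or.inl hx0.ne')).continuousOn
      · intro σ hσ
        rw [uIcc_of_le hσ1.le] at hσ
        exact (by linarith [hσ.1] : 0 < σ).ne'
    have hI : IntervalIntegrable (fun σ : ℝ => ((|σ - 1| ^ (-(1 / 2) : ℝ) : ℝ) : ℂ)) volume σ₀ 1 :=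
      have h2 := intervalIntegrable_abs_sub_one_rpow σ₀ 1
      ⟨h2.1.ofReal, h2.2.ofReal⟩
    have h1 : J - J' = ∫ σ in σ₀..1, G A B (σ : ℝ) * ((kernel x h σ - ((x ^ σ / σ : ℝ) : ℂ)) *
        ((|σ - 1| ^ (-(1 / 2) : ℝ) : ℝ) : ℂ)) := by
      simp only [hJ, hJ', main_integrand_eq]
      rw [← intervalIntegral.integral_sub]
      · congr 1
        funext σ
        ring
      · exact hI.continuousOn_mul (hGc.mul hkc)
      · exact (hI.continuousOn_mul hxc).continuousOn_mul hGc
    rw [h1]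
    refine (norm_integral_G_mul_le (A := A) (B := B) (k := fun σ => kernel x h σ - ((x ^ σ / σ : ℝ) : ℂ)) hδ hM
      hσ₀ hσ1.le le_rfl (by positivity : 0 ≤ 2 * h) hM0.le
      fun σ hσ => norm_kernel_ofReal_sub_le hx1 hh (by linarith [hσ.1]) hσ.2).trans_eq ?_
    rw [hI₀]; ring
  set Q := ((rieszSum (x + h) - rieszSum x) / h : ℝ) with hQ
  have hcount : ‖(countTwoSquares x : ℂ) - (Q : ℂ)‖ ≤ h + 1 := by
    rw [← ofReal_sub, norm_real]
    exact abs_riesz_quotient_sub_le hx0.le hh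
  set E₁ := ∫ u in σ₀..κ, G A B (u + T * I) * kernel x h (u + T * I) *
    (u + T * I - 1) ^ (-(1 / 2) : ℂ) with hE₁
  set E₂ := ∫ u in σ₀..κ, G A B (u + (-T : ℝ) * I) * kernel x h (u + (-T : ℝ) * I) *
    (u + (-T : ℝ) * I - 1) ^ (-(1 / 2) : ℂ) with hE₂
  set V := ∫ y in (-T)..T, G A B (σ₀ + y * I) * kernel x h (σ₀ + y * I) *
      (σ₀ + y * I - 1) ^ (-(1 / 2) : ℂ) with hV
  have h₁ := hhor T (abs_of_pos hT0)
  have h₂ := hhor (-T) (by rw [abs_neg, abs_of_pos hT0])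
  rw [← hE₁] at h₁
  rw [← hE₂] at h₂
  have hPeq : P = V - I * (E₁ - E₂) + 2 * J := by
    have : P = -I * (I * P) := by rw [← mul_assoc, neg_mul, I_mul_I, neg_neg, one_mul]
    rw [this, hshift]
    linear_combination (-V - 2 * J) * I_mul_I
  have hpi : (Real.pi : ℂ) ≠ 0 := ofReal_ne_zero.2 Real.pi_ne_zero
  have hdecomp : (countTwoSquares x : ℂ) - 1 / (Real.pi : ℂ) * J' = ((countTwoSquares x : ℂ) - Q) +
      1 / (Real.pi : ℂ) * (1 / 2 * (((2 * Real.pi * (Q : ℂ) - P) + V - I * (E₁ - E₂))) +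
        (J - J')) := by
    rw [hPeq]
    field_simp
    ring
  set X := x ^ 2 * Real.log x / (h * T) with hX
  have hX0 : 0 ≤ X := by positivity
  have hpi1 : ‖(1 / (Real.pi : ℂ))‖ ≤ 1 := by
    rw [norm_div, norm_one, norm_real, Real.norm_of_nonneg Real.pi_pos.le,
      div_le_one Real.pi_pos]
    linarith [Real.pi_gt_three]
  have hinner : ‖1 / 2 * (((2 * Real.pi * (Q : ℂ) - P) + V - I * (E₁ - E₂))) + (J - J')‖ ≤
      1728 * X + 4 * (x ^ σ₀ * W) + 108 * C₁ * X + 2 * M * I₀ * h := by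
    have h3 : ‖(2 * Real.pi * (Q : ℂ) - P) + V - I * (E₁ - E₂)‖ ≤
        1728 * X + 4 * (x ^ σ₀ * W) + 108 * C₁ * X := by
      calc _ ≤ ‖(2 * Real.pi * (Q : ℂ) - P)‖ + ‖V‖ + ‖I * (E₁ - E₂)‖ :=
            (norm_sub_le _ _).trans (by gcongr; exact norm_add_le _ _)
        _ ≤ 1728 * X + 4 * (x ^ σ₀ * W) + (54 * C₁ * X + 54 * C₁ * X) := by
          gcongr
          rw [norm_mul, norm_I, one_mul]
          exact (norm_sub_le _ _).trans (add_le_add h₁ h₂)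
        _ = _ := by ring
    calc _ ≤ ‖(1 / 2 : ℂ)‖ * ‖(2 * Real.pi * (Q : ℂ) - P) + V - I * (E₁ - E₂)‖ + ‖J - J'‖ := by
          rw [← norm_mul]; exact norm_add_le _ _
      _ ≤ 1 * (1728 * X + 4 * (x ^ σ₀ * W) + 108 * C₁ * X) + 2 * M * I₀ * h := by
          gcongr
          norm_num
      _ = _ := by ring
  rw [hdecomp]
  have hY0 : 0 ≤ x ^ σ₀ * W := by positivity
  have hMI : 0 ≤ M * I₀ := by positivity
  calc _ ≤ (h + 1) + 1 * (1728 * X + 4 * (x ^ σ₀ * W) + 108 * C₁ * X + 2 * M * I₀ * h) := by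
        refine (norm_add_le _ _).trans (add_le_add hcount ?_)
        rw [norm_mul]
        exact mul_le_mul hpi1 hinner (norm_nonneg _) zero_le_one
    _ ≤ (1728 + 108 * C₁ + 4 + 1 + 2 * M * I₀) * (h + 1) +
        (1728 + 108 * C₁ + 4 + 1 + 2 * M * I₀) * X +
        (1728 + 108 * C₁ + 4 + 1 + 2 * M * I₀) * (x ^ σ₀ * W) := by
      have e1 : 0 ≤ C₁ * h := by positivity
      have e2 : 0 ≤ C₁ * X := by positivity
      have e3 : 0 ≤ C₁ * (x ^ σ₀ * W) := by positivity
      have e4 : 0 ≤ (M * I₀) * X := by positivity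
      have e5 : 0 ≤ (M * I₀) * (x ^ σ₀ * W) := by positivity
      have e6 : 0 ≤ (M * I₀) * h := by positivity
      have e7 : 0 ≤ C₁ * 1 := by positivity
      linarith
    _ = _ := by ring
end

/-! ### The unconditional error term -/

section
variable {A B : ℂ → ℂ} (hA : IsSqrtBranch zetaReg A) (hB : IsSqrtBranch chi4.LFunction B)
include hA hB

/-- Changing the lower limit of integration in the main term. -/
lemma exists_norm_main_sub_le {δ : ℝ} (hδ : 0 < δ) : ∃ C : ℝ, 0 < C ∧ ∀ x a b : ℝ, 1 ≤ x →
    1 / 2 + δ ≤ a → a ≤ b → b ≤ 1 →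
    ‖(1 / (Real.pi : ℂ) * ∫ σ in a..1,
        G A B (σ : ℂ) * ((x ^ σ / (σ * |σ - 1| ^ (1 / 2 : ℝ)) : ℝ) : ℂ)) -
      1 / (Real.pi : ℂ) * ∫ σ in b..1,
        G A B (σ : ℂ) * ((x ^ σ / (σ * |σ - 1| ^ (1 / 2 : ℝ)) : ℝ) : ℂ)‖ ≤ C * x ^ b := by
  obtain ⟨M, hM0, hM⟩ := exists_norm_G_ofReal_le hA hB hδ
  set I₀ := ∫ σ in (1 / 2)..(1 : ℝ), |σ - 1| ^ (-(1 / 2) : ℝ) with hI₀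
  have hI₀0 : 0 ≤ I₀ := integral_abs_rpow_nonneg
  refine ⟨2 * M * I₀ + 1, by positivity, fun x a b hx ha hab hb => ?_⟩
  have hx0 : 0 < x := by linarith
  have hint : IntervalIntegrable (fun σ : ℝ => G A B (σ : ℂ) *
      ((x ^ σ / (σ * |σ - 1| ^ (1 / 2 : ℝ)) : ℝ) : ℂ)) volume a 1 := by
    simp only [main_integrand_eq]
    have hI : IntervalIntegrable (fun σ : ℝ => ((|σ - 1| ^ (-(1 / 2) : ℝ) : ℝ) : ℂ)) volume a 1 :=
      have h2 := intervalIntegrable_abs_sub_one_rpow a 1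
      ⟨h2.1.ofReal, h2.2.ofReal⟩
    have hsub : ∀ σ ∈ uIcc a 1, 1 / 2 < σ := fun σ hσ => by
      rw [uIcc_of_le (by linarith)] at hσ
      linarith [hσ.1]
    refine (hI.continuousOn_mul ?_).continuousOn_mul ((continuousOn_G_ofReal hA hB).mono hsub)
    refine continuous_ofReal.comp_continuousOn (ContinuousOn.div ?_ continuousOn_id ?_)
    · exact (Continuous.rpow continuous_const continuous_id (fun _ => Or.inl hx0.ne')).continuousOn
    · exact fun σ hσ => (by linarith [hsub σ hσ] : 0 < σ).ne'
  have hbmem : b ∈ uIcc a 1 := by rw [uIcc_of_le (by linarith)]; exact ⟨hab, hb⟩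
  rw [← intervalIntegral.integral_add_adjacent_intervals (hint.mono_set (uIcc_subset_uIcc_left hbmem))
    (hint.mono_set (uIcc_subset_uIcc_right hbmem)), mul_add, add_sub_cancel_right, norm_mul]
  simp only [main_integrand_eq]
  have h1 := norm_integral_G_mul_le (A := A) (B := B) (k := fun σ => ((x ^ σ / σ : ℝ) : ℂ)) hδ hM
    ha hab hb (by positivity : 0 ≤ 2 * x ^ b) hM0.le fun σ hσ => by
      have hσ0 : 1 / 2 ≤ σ := by linarith [hσ.1]
      rw [norm_real, Real.norm_of_nonneg (by positivity), div_le_iff₀ (by linarith)]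
      have := Real.rpow_le_rpow_of_exponent_le hx hσ.2
      nlinarith [Real.rpow_pos_of_pos hx0 b]
  have hpi1 : ‖(1 / (Real.pi : ℂ))‖ ≤ 1 := by
    rw [norm_div, norm_one, norm_real, Real.norm_of_nonneg Real.pi_pos.le,
      div_le_one Real.pi_pos]
    linarith [Real.pi_gt_three]
  calc _ ≤ 1 * (M * (2 * x ^ b) * I₀) := mul_le_mul hpi1 h1 (norm_nonneg _) zero_le_one
    _ ≤ _ := by nlinarith [Real.rpow_pos_of_pos hx0 b]

set_option maxHeartbeats 1000000 in
/-- The unconditional error term: the zero-free region allows the line of integration at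
`1 - c / log T`, where `T = exp (a √(log x))`. -/
theorem count_sub_mainTerm_isBigO {ε : ℝ} (hε : 0 < ε) (hε2 : ε < 1 / 2) : ∃ c : ℝ, 0 < c ∧
    (fun x : ℝ => (countTwoSquares x : ℂ) - mainTerm (G A B) ε x)
      =O[atTop] fun x : ℝ => x * Real.exp (-c * Real.sqrt (Real.log x)) := by
  obtain ⟨c₀, hc₀, hzero⟩ := exists_zero_free_region
  obtain ⟨C₁, hC₁, hcore⟩ := exists_norm_count_sub_le hA hB hε
  obtain ⟨C₂, hC₂, hmain⟩ := exists_norm_main_sub_le hA hB hε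
  obtain ⟨C₃, hC₃, hG⟩ := exists_norm_G_le hA hB hε
  obtain ⟨a, ha0, ha1, hac⟩ : ∃ a : ℝ, 0 < a ∧ a ≤ 1 ∧ a ≤ c₀ / 8 :=
    ⟨min 1 (c₀ / 8), by positivity, min_le_left _ _, min_le_right _ _⟩
  set C₄ := 4 * (1 + 8 * C₃) * (1 + 1 / c₀) with hC₄
  have hC₄0 : 0 < C₄ := by positivity
  refine ⟨a / 4, by positivity, IsBigO.of_bound (C₁ * (2 + 32 / a ^ 2 + C₄) + C₂) ?_⟩
  have hr : Tendsto (fun x : ℝ => Real.sqrt (Real.log x)) atTop atTop :=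
    Real.tendsto_sqrt_atTop.comp Real.tendsto_log_atTop
  filter_upwards [eventually_ge_atTop (Real.exp 1),
    hr.eventually_ge_atTop (1 / a + c₀ / (a * (1 / 2 - ε)))] with x hx hrx
  set r := Real.sqrt (Real.log x) with hr_def
  have hx0 : 0 < x := (Real.exp_pos 1).trans_le hx
  have hx1 : 1 ≤ x := (Real.one_le_exp zero_le_one).trans hx
  have hL : 1 ≤ Real.log x := (Real.le_log_iff_exp_le hx0).2 hx
  have hr2 : r ^ 2 = Real.log x := Real.sq_sqrt (by linarith)
  have hxr : x = Real.exp (r ^ 2) := by rw [hr2, Real.exp_log hx0]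
  have hε' : 0 < 1 / 2 - ε := by linarith
  have hq : 0 < c₀ / (a * (1 / 2 - ε)) := by positivity
  have hra : 1 / a ≤ r := by linarith
  have hr1 : 1 ≤ r := le_trans (by rw [le_div_iff₀ ha0]; linarith) hra
  have har : 1 ≤ a * r := by rw [div_le_iff₀ ha0] at hra; linarith
  -- With `h = x T^{-1/2}` the tails contribute `x² log x / (h T) = x log x T^{-1/2}`. The line
  -- `Re s = σ₀` contributes `x T⁴ exp (-(c₀ / a) r)`, where `T⁴ = exp (4 a r)` and `c₀ / a ≥ 8 ≥ 8 a`.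
  set T := Real.exp (a * r) with hT
  have hTar : a * r + 1 ≤ T := Real.add_one_le_exp _
  have hT2 : 2 ≤ T := by linarith
  have hlogT : Real.log T = a * r := Real.log_exp _
  set σ₀ := 1 - c₀ / (a * r) with hσ₀
  have hσ1 : σ₀ < 1 := by
    have : 0 < c₀ / (a * r) := by positivity
    linarith
  have hσε : 1 / 2 + ε ≤ σ₀ := by
    have h1 : c₀ / (a * (1 / 2 - ε)) ≤ r := by
      have : 0 < 1 / a := by positivity
      linarith
    have h2 : c₀ / (a * r) ≤ 1 / 2 - ε := by
      rw [div_le_iff₀ (by positivity)] at h1 ⊢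
      linarith
    linarith
  set E := Real.exp (-(a / 4) * r) with hE
  have hxσ : x ^ σ₀ = x * Real.exp (-(c₀ / a) * r) := by
    rw [hxr, ← Real.exp_mul, ← Real.exp_add, hσ₀]
    congr 1
    field_simp
    ring
  have hca : 8 ≤ c₀ / a := by rw [le_div_iff₀ ha0]; linarith
  have hh1 : 1 ≤ x * Real.exp (-(a / 2) * r) := by
    rw [hxr, ← Real.exp_add]
    refine Real.one_le_exp ?_
    nlinarith only [hr1, ha0, ha1]
  have hhle : Real.exp (-(a / 2) * r) ≤ E := Real.exp_le_exp.2 (by nlinarith only [hr1, ha0])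
  have h1 := hcore x σ₀ T (x * Real.exp (-(a / 2) * r)) hx hσε hσ1 hT2 (by positivity)
    (mul_le_of_le_one_right hx0.le (Real.exp_le_one_iff.2 (by nlinarith only [hr1, ha0])))
    (fun s hs ht => hzero T hT2 s ht (by rw [hlogT]; exact hs))
  have h2 := hmain x (1 / 2 + ε) σ₀ hx1 le_rfl hσε hσ1.le
  have hW : ∫ t in (-T)..T, ‖G A B (σ₀ + t * I)‖ * ‖(σ₀ + t * I - 1 : ℂ)‖ ^ (-(1 / 2) : ℝ) /
      ‖(σ₀ + t * I : ℂ)‖ ≤ C₄ * T ^ 4 := by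
    have h3 : ∀ t ∈ uIoc (-T) T, ‖‖G A B (σ₀ + t * I)‖ * ‖(σ₀ + t * I - 1 : ℂ)‖ ^ (-(1 / 2) : ℝ) /
        ‖(σ₀ + t * I : ℂ)‖‖ ≤ (1 + 8 * C₃) * T ^ 2 * ((1 + 1 / c₀) * T) / (1 / 2) := by
      intro t ht
      rw [uIoc_of_le (by linarith)] at ht
      have htT : |t| ≤ T := abs_le.2 ⟨ht.1.le, ht.2⟩
      have hre : (σ₀ + t * I : ℂ).re = σ₀ := by simp
      have him : (σ₀ + t * I : ℂ).im = t := by simp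
      have hmem : (σ₀ + t * I : ℂ) ∈ domG :=
        mem_domG_of_zetaL_ne_zero (by rw [hre]; linarith) fun u hu =>
          hzero T hT2 _ (by simpa) (by rw [hlogT]; simp; linarith)
      have hs1 : ‖(σ₀ + t * I : ℂ)‖ ≤ 2 * T := by
        have := norm_le_abs_re_add_abs_im (σ₀ + t * I : ℂ)
        rw [hre, him, abs_of_pos (by linarith)] at this
        linarith
      have hs2 : 1 / 2 ≤ ‖(σ₀ + t * I : ℂ)‖ := by
        have := (le_abs_self _).trans (abs_re_le_norm (σ₀ + t * I : ℂ))
        rw [hre] at this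
        linarith
      have hG1 : ‖G A B (σ₀ + t * I)‖ ≤ (1 + 8 * C₃) * T ^ 2 := by
        refine le_of_sq_le_sq ((hG _ hmem (by rw [hre]; linarith)).trans ?_) (by positivity)
        calc C₃ * ‖(σ₀ + t * I : ℂ)‖ ^ 3 ≤ C₃ * (2 * T) ^ 3 := by gcongr
          _ = 8 * C₃ * T ^ 3 := by ring
          _ ≤ (1 + 8 * C₃) ^ 2 * T ^ 4 := by
            gcongr ?_ * ?_
            · nlinarith only [hC₃, sq_nonneg C₃]
            · exact pow_le_pow_right₀ (by linarith) (by norm_num)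
          _ = _ := by ring
      have hs3 : c₀ / (a * r) ≤ ‖(σ₀ + t * I - 1 : ℂ)‖ := by
        have := abs_re_le_norm (σ₀ + t * I - 1 : ℂ)
        simp only [sub_re, hre, one_re] at this
        rw [abs_of_neg (by linarith), hσ₀] at this
        linarith
      have hs4 : ‖(σ₀ + t * I - 1 : ℂ)‖ ^ (-(1 / 2) : ℝ) ≤ (1 + 1 / c₀) * T := by
        calc _ ≤ (c₀ / (a * r)) ^ (-(1 / 2) : ℝ) :=
              Real.rpow_le_rpow_of_nonpos (by positivity) hs3 (by norm_num)
          _ = (a * r / c₀) ^ (1 / 2 : ℝ) := by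
            rw [Real.rpow_neg (by positivity), ← Real.inv_rpow (by positivity), inv_div]
          _ ≤ (1 + a * r / c₀) ^ (1 : ℝ) := by
            have h0 : 0 ≤ a * r / c₀ := by positivity
            exact (Real.rpow_le_rpow h0 (by linarith) (by norm_num)).trans
              (Real.rpow_le_rpow_of_exponent_le (by linarith) (by norm_num))
          _ = 1 + a * r * (1 / c₀) := by rw [Real.rpow_one]; ring
          _ ≤ _ := by
            have : 0 < 1 / c₀ := by positivity
            nlinarith only [this, hTar, hT2]
      rw [Real.norm_of_nonneg (by positivity)]
      gcongr
    have h4 := intervalIntegral.norm_integral_le_of_norm_le_const h3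
    refine (le_abs_self _).trans (h4.trans_eq ?_)
    rw [abs_of_pos (by linarith), hC₄]
    ring
  have hE0 : 0 < E := Real.exp_pos _
  have hxσW : x ^ σ₀ * (C₄ * T ^ 4) ≤ C₄ * (x * E) := by
    have : Real.exp (-(c₀ / a) * r) * T ^ 4 ≤ E := by
      rw [hT, ← Real.exp_nat_mul, ← Real.exp_add, hE]
      refine Real.exp_le_exp.2 ?_
      push_cast
      nlinarith only [hca, hr1, ha1, ha0]
    rw [hxσ]
    calc _ = C₄ * (x * (Real.exp (-(c₀ / a) * r) * T ^ 4)) := by ring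
      _ ≤ _ := by gcongr
  have hxσ2 : x ^ σ₀ ≤ x * E := by
    rw [hxσ]
    gcongr
    refine Real.exp_le_exp.2 ?_
    nlinarith only [hca, hr1, ha1, ha0]
  have hX : x ^ 2 * Real.log x / (x * Real.exp (-(a / 2) * r) * T) ≤ 32 / a ^ 2 * (x * E) := by
    have h5 := Real.quadratic_le_exp_of_nonneg (show 0 ≤ a / 4 * r by positivity)
    have h6 : r ^ 2 ≤ 32 / a ^ 2 * Real.exp (a / 4 * r) := by
      rw [div_mul_eq_mul_div, le_div_iff₀ (by positivity)]
      have h6 : 0 < a * r := by positivity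
      nlinarith only [h5, h6]
    have h7 : Real.exp (-(a / 2) * r) * T = Real.exp (a / 2 * r) := by
      rw [hT, ← Real.exp_add]; congr 1; ring
    have h8 : Real.exp (a / 4 * r) = Real.exp (a / 2 * r) * E := by
      rw [hE, ← Real.exp_add]; congr 1; ring
    rw [mul_assoc, h7, ← hr2, div_le_iff₀ (by positivity)]
    calc x ^ 2 * r ^ 2 ≤ x ^ 2 * (32 / a ^ 2 * (Real.exp (a / 2 * r) * E)) := by
          rw [← h8]; gcongr
      _ = _ := by ring
  have hhE : x * Real.exp (-(a / 2) * r) ≤ x * E := by gcongr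
  rw [Real.norm_of_nonneg (by positivity : 0 ≤ x * E)]
  have hsplit : (countTwoSquares x : ℂ) - mainTerm (G A B) ε x =
      ((countTwoSquares x : ℂ) - 1 / (Real.pi : ℂ) *
        ∫ σ in σ₀..1, G A B (σ : ℂ) * ((x ^ σ / (σ * |σ - 1| ^ (1 / 2 : ℝ)) : ℝ) : ℂ)) -
      (mainTerm (G A B) ε x - 1 / (Real.pi : ℂ) *
        ∫ σ in σ₀..1, G A B (σ : ℂ) * ((x ^ σ / (σ * |σ - 1| ^ (1 / 2 : ℝ)) : ℝ) : ℂ)) := by ring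
  rw [hsplit]
  calc _ ≤ _ := norm_sub_le _ _
    _ ≤ C₁ * (x * E + x * E + 32 / a ^ 2 * (x * E) + C₄ * (x * E)) + C₂ * (x * E) := by
      refine add_le_add (h1.trans ?_) (h2.trans (by gcongr))
      exact mul_le_mul_of_nonneg_left (add_le_add (add_le_add (add_le_add hhE (hh1.trans hhE)) hX)
        ((mul_le_mul_of_nonneg_left hW (by positivity)).trans hxσW)) hC₁.le
    _ = _ := by ring
end

/-! ### A Plancherel inequality -/

open scoped FourierTransform ENNReal

lemma integral_fourier_mul_eq_flip {f g : ℝ → ℂ} (hf : Integrable f) (hg : Integrable g) :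
    ∫ t, 𝓕 f t * g t = ∫ v, f v * 𝓕 g v := by
  have h := VectorFourier.integral_fourierIntegral_smul_eq_flip (L := innerₗ ℝ) (μ := volume)
    (ν := volume) Real.continuous_fourierChar continuous_inner hf hg
  rw [flip_innerₗ] at h
  exact h

lemma continuous_fourier {f : ℝ → ℂ} (hf : Integrable f) : Continuous (𝓕 f) :=
  VectorFourier.fourierIntegral_continuous Real.continuous_fourierChar
    (by exact continuous_inner) hf

lemma norm_fourier_le (f : ℝ → ℂ) (t : ℝ) : ‖𝓕 f t‖ ≤ ∫ v, ‖f v‖ :=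
  VectorFourier.norm_fourierIntegral_le_integral_norm _ _ _ _ _

/-- A Gaussian weight of width `T`, modulated by the frequency `v`. -/
noncomputable def gaussianWeight (T v t : ℝ) : ℂ :=
  cexp (-Real.pi * (((T ^ 2)⁻¹ : ℝ) : ℂ) * t ^ 2 + 2 * Real.pi * (I * v) * t)

lemma integrable_gaussianWeight {T : ℝ} (hT : 0 < T) (v : ℝ) :
    Integrable (gaussianWeight T v) := by
  have := integrable_cexp_quadratic (b := Real.pi * (((T ^ 2)⁻¹ : ℝ) : ℂ))
    (by rw [← ofReal_mul, ofReal_re]; positivity) (2 * Real.pi * (I * v)) 0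
  refine this.congr (ae_of_all _ fun t => ?_)
  simp only [gaussianWeight]
  congr 1; ring

lemma gaussianWeight_zero (T t : ℝ) :
    gaussianWeight T 0 t = ((Real.exp (-Real.pi * (T ^ 2)⁻¹ * t ^ 2) : ℝ) : ℂ) := by
  rw [gaussianWeight]
  push_cast
  congr 1; ring

lemma gaussianWeight_eq (T v t : ℝ) : gaussianWeight T v t =
    ((Real.exp (-Real.pi * (T ^ 2)⁻¹ * t ^ 2) : ℝ) : ℂ) * cexp ((2 * Real.pi * t * v : ℝ) * I) := by
  rw [gaussianWeight, ofReal_exp, ← Complex.exp_add]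
  push_cast
  congr 1; ring

lemma norm_fourier_gaussianWeight {T : ℝ} (hT : 0 < T) (v u : ℝ) :
    ‖𝓕 (gaussianWeight T v) u‖ = T * Real.exp (-(Real.pi * T ^ 2) * (u - v) ^ 2) := by
  have h := fourier_gaussian_pi' (b := (((T ^ 2)⁻¹ : ℝ) : ℂ)) (by rw [ofReal_re]; positivity) (I * v)
  have h1 : 𝓕 (gaussianWeight T v) u = _ := congrFun h u
  have h2 : ‖(((T ^ 2)⁻¹ : ℝ) : ℂ) ^ (1 / 2 : ℂ)‖ = T⁻¹ := by
    have := norm_cpow_real (((T ^ 2)⁻¹ : ℝ) : ℂ) (1 / 2)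
    push_cast at this ⊢
    rw [this, norm_inv, norm_pow, norm_real, Real.norm_of_nonneg hT.le, ← Real.sqrt_eq_rpow,
      Real.sqrt_inv, Real.sqrt_sq hT.le]
  have h3 : -Real.pi / (((T ^ 2)⁻¹ : ℝ) : ℂ) * ((u : ℂ) + I * (I * v)) ^ 2 =
      ((-(Real.pi * T ^ 2) * (u - v) ^ 2 : ℝ) : ℂ) := by
    have : T ≠ 0 := hT.ne'
    rw [← mul_assoc, I_mul_I]
    push_cast
    field_simp
    ring
  rw [h1, norm_mul, norm_div, norm_one, h2, h3, ← ofReal_exp, norm_real,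
    Real.norm_of_nonneg (Real.exp_pos _).le]
  simp

lemma lintegral_fourier_gaussianWeight {T : ℝ} (hT : 0 < T) (v : ℝ) :
    ∫⁻ u, ‖𝓕 (gaussianWeight T v) u‖ₑ = 1 := by
  have hb : 0 < Real.pi * T ^ 2 := by positivity
  have hi : Integrable fun u : ℝ => T * Real.exp (-(Real.pi * T ^ 2) * (u - v) ^ 2) :=
    ((integrable_exp_neg_mul_sq hb).comp_sub_right v).const_mul T
  have h1 : ∀ u, ‖𝓕 (gaussianWeight T v) u‖ₑ =
      ENNReal.ofReal (T * Real.exp (-(Real.pi * T ^ 2) * (u - v) ^ 2)) := fun u => by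
    rw [← norm_fourier_gaussianWeight hT, ofReal_norm]
  simp only [h1]
  rw [← ofReal_integral_eq_lintegral_ofReal hi (ae_of_all _ fun u => by positivity),
    integral_const_mul, integral_sub_right_eq_self (fun u => Real.exp (-(Real.pi * T ^ 2) * u ^ 2)),
    integral_gaussian]
  have : Real.pi / (Real.pi * T ^ 2) = (T⁻¹) ^ 2 := by field_simp
  rw [this, Real.sqrt_sq (by positivity), mul_inv_cancel₀ hT.ne', ENNReal.ofReal_one]

lemma enorm_mul_le_sq_add_sq (a b : ℝ≥0∞) : a * b ≤ a ^ 2 + b ^ 2 := by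
  rcases le_total a b with h | h
  · calc a * b ≤ b * b := by gcongr
      _ = b ^ 2 := (sq b).symm
      _ ≤ _ := le_add_self
  · calc a * b ≤ a * a := by gcongr
      _ = a ^ 2 := (sq a).symm
      _ ≤ _ := le_self_add

/-- Schur's bound for a symmetric kernel of total mass one. -/
lemma lintegral_symm_kernel_le {f : ℝ → ℝ≥0∞} {K : ℝ → ℝ → ℝ≥0∞} (hf : AEMeasurable f)
    (hft : ∀ v, f v ≠ ∞) (hK : Measurable fun p : ℝ × ℝ => K p.1 p.2)
    (hsymm : ∀ v u, K v u = K u v) (hK1 : ∀ v, ∫⁻ u, K v u = 1) :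
    ∫⁻ v, f v * ∫⁻ u, f u * K v u ≤ 2 * ∫⁻ v, f v ^ 2 := by
  have hf2 : AEMeasurable fun v => f v ^ 2 := hf.pow_const 2
  have hKm : ∀ v, Measurable fun u => K v u := fun v => hK.comp measurable_prodMk_left
  calc ∫⁻ v, f v * ∫⁻ u, f u * K v u ≤ ∫⁻ v, ∫⁻ u, (f v ^ 2 * K v u + f u ^ 2 * K v u) := by
        refine lintegral_mono fun v => ?_
        rw [← lintegral_const_mul' _ _ (hft v)]
        refine lintegral_mono fun u => ?_
        rw [← mul_assoc, ← add_mul]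
        gcongr
        exact enorm_mul_le_sq_add_sq _ _
    _ = ∫⁻ v, (f v ^ 2 + ∫⁻ u, f u ^ 2 * K v u) := by
      refine lintegral_congr fun v => ?_
      rw [lintegral_add_left ((hKm v).const_mul _), lintegral_const_mul _ (hKm v), hK1, mul_one]
    _ = (∫⁻ v, f v ^ 2) + ∫⁻ v, ∫⁻ u, f u ^ 2 * K v u := lintegral_add_left' hf2 _
    _ = (∫⁻ v, f v ^ 2) + ∫⁻ u, ∫⁻ v, f u ^ 2 * K v u := by
      rw [lintegral_lintegral_swap]
      have h1 : AEMeasurable (fun p : ℝ × ℝ => f p.2 ^ 2) (volume.prod volume) := hf2.comp_snd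
      exact h1.mul hK.aemeasurable
    _ = 2 * ∫⁻ v, f v ^ 2 := by
      rw [two_mul]
      congr 1
      refine lintegral_congr fun u => ?_
      simp only [hsymm _ u]
      rw [lintegral_const_mul _ (hKm u), hK1, mul_one]

/-- The inequality that replaces Plancherel's theorem: the mean square of a Fourier transform over
`[-T, T]` is at most a constant multiple of the mean square of the function, uniformly in `T`. -/
lemma integral_norm_fourier_sq_le {h : ℝ → ℂ} (hh : Integrable h)
    (hh2 : Integrable fun v => ‖h v‖ ^ 2) {T : ℝ} (hT : 0 < T) :
    ∫ t in (-T)..T, ‖𝓕 h t‖ ^ 2 ≤ 2 * Real.exp Real.pi * ∫ v, ‖h v‖ ^ 2 := by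
  have hc := continuous_fourier hh
  have hwr : ∀ t, gaussianWeight T 0 t = ((Real.exp (-Real.pi * (T ^ 2)⁻¹ * t ^ 2) : ℝ) : ℂ) :=
    gaussianWeight_zero T
  have hwi : Integrable fun t => Real.exp (-Real.pi * (T ^ 2)⁻¹ * t ^ 2) := by
    have := (integrable_gaussianWeight hT 0).norm
    refine this.congr (ae_of_all _ fun t => ?_)
    simp only [hwr, norm_real, Real.norm_of_nonneg (Real.exp_pos _).le]
  have hwc : Continuous (gaussianWeight T 0) := by unfold gaussianWeight; fun_prop
  set P : ℝ → ℂ := fun t => (starRingEnd ℂ) (gaussianWeight T 0 t * 𝓕 h t) with hP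
  have hPi : Integrable P := by
    refine ((integrable_gaussianWeight hT 0).norm.mul_const (∫ v, ‖h v‖)).mono'
      (continuous_conj.comp (hwc.mul hc)).aestronglyMeasurable (ae_of_all _ fun t => ?_)
    simp only [hP, RCLike.norm_conj, norm_mul]
    gcongr
    exact norm_fourier_le h t
  -- the Fourier transform of `P` is a Gaussian average of `h`
  have hPhat : ∀ v, ‖𝓕 P v‖ₑ ≤ ∫⁻ u, ‖h u‖ₑ * ‖𝓕 (gaussianWeight T v) u‖ₑ := by
    intro v
    have h1 : 𝓕 P v = (starRingEnd ℂ) (∫ t, 𝓕 h t * gaussianWeight T v t) := by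
      rw [Real.fourier_real_eq_integral_exp_smul, ← integral_conj]
      congr 1
      funext t
      have e1 : (starRingEnd ℂ) (((2 * Real.pi * t * v : ℝ) : ℂ) * I) =
          ((-2 * Real.pi * t * v : ℝ) : ℂ) * I := by
        rw [map_mul, conj_ofReal, conj_I]; push_cast; ring
      simp only [hP, map_mul, smul_eq_mul, hwr, gaussianWeight_eq T v]
      rw [← Complex.exp_conj, e1, conj_ofReal]
      ring
    rw [h1, RCLike.enorm_conj, integral_fourier_mul_eq_flip hh (integrable_gaussianWeight hT v)]
    refine (enorm_integral_le_lintegral_enorm _).trans_eq ?_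
    simp only [enorm_mul]
  have hkey : ‖∫ t, 𝓕 h t * P t‖ₑ ≤ 2 * ∫⁻ v, ‖h v‖ₑ ^ 2 := by
    rw [integral_fourier_mul_eq_flip hh hPi]
    have hW : ∀ v u, ‖𝓕 (gaussianWeight T v) u‖ₑ =
        ENNReal.ofReal (T * Real.exp (-(Real.pi * T ^ 2) * (u - v) ^ 2)) := fun v u => by
      rw [← norm_fourier_gaussianWeight hT, ofReal_norm]
    have hWsymm : ∀ v u, ‖𝓕 (gaussianWeight T v) u‖ₑ = ‖𝓕 (gaussianWeight T u) v‖ₑ := fun v u => by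
      rw [hW, hW, ← neg_sub u v, neg_sq]
    have hWm : Measurable fun p : ℝ × ℝ => ‖𝓕 (gaussianWeight T p.1) p.2‖ₑ := by
      simp only [hW]
      exact ENNReal.measurable_ofReal.comp (by fun_prop)
    refine (enorm_integral_le_lintegral_enorm _).trans ?_
    refine le_trans (lintegral_mono fun v => ?_) (lintegral_symm_kernel_le hh.1.enorm
      (fun _ => enorm_ne_top) hWm hWsymm (lintegral_fourier_gaussianWeight hT))
    rw [enorm_mul]
    gcongr
    exact hPhat v
  have hprod : ∀ t, 𝓕 h t * P t =
      ((Real.exp (-Real.pi * (T ^ 2)⁻¹ * t ^ 2) * ‖𝓕 h t‖ ^ 2 : ℝ) : ℂ) := fun t => by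
    simp only [hP, map_mul, hwr, conj_ofReal]
    rw [mul_left_comm, mul_conj, normSq_eq_norm_sq]
    push_cast; ring
  have hweighted : ∫ t, Real.exp (-Real.pi * (T ^ 2)⁻¹ * t ^ 2) * ‖𝓕 h t‖ ^ 2 ≤
      2 * ∫ v, ‖h v‖ ^ 2 := by
    simp only [hprod] at hkey
    rw [integral_complex_ofReal, ← ofReal_norm, norm_real] at hkey
    have h1 : ∫⁻ v, ‖h v‖ₑ ^ 2 = ENNReal.ofReal (∫ v, ‖h v‖ ^ 2) := by
      rw [ofReal_integral_eq_lintegral_ofReal hh2 (ae_of_all _ fun v => by positivity)]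
      refine lintegral_congr fun v => ?_
      rw [ENNReal.ofReal_pow (norm_nonneg _), ofReal_norm]
    have h0 : 0 ≤ ∫ v, ‖h v‖ ^ 2 := integral_nonneg fun v => by positivity
    rw [h1, ← ENNReal.ofReal_ofNat, ← ENNReal.ofReal_mul (by norm_num),
      ENNReal.ofReal_le_ofReal_iff (by positivity)] at hkey
    exact (le_abs_self _).trans hkey
  have hgi : Integrable fun t => Real.exp (-Real.pi * (T ^ 2)⁻¹ * t ^ 2) * ‖𝓕 h t‖ ^ 2 := by
    refine (hwi.mul_const ((∫ v, ‖h v‖) ^ 2)).mono' (by fun_prop) (ae_of_all _ fun t => ?_)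
    rw [Real.norm_of_nonneg (by positivity)]
    gcongr
    exact norm_fourier_le h t
  calc ∫ t in (-T)..T, ‖𝓕 h t‖ ^ 2
      ≤ ∫ t in (-T)..T, Real.exp Real.pi *
          (Real.exp (-Real.pi * (T ^ 2)⁻¹ * t ^ 2) * ‖𝓕 h t‖ ^ 2) := by
        refine intervalIntegral.integral_mono_on (by linarith)
          ((hc.norm.pow 2).intervalIntegrable _ _) (hgi.const_mul _).intervalIntegrable
          fun t ht => ?_
        rw [← mul_assoc, ← Real.exp_add]
        refine le_mul_of_one_le_left (by positivity) (Real.one_le_exp ?_)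
        have : (T ^ 2)⁻¹ * t ^ 2 ≤ 1 := by
          rw [inv_mul_le_iff₀ (by positivity), mul_one]
          exact sq_le_sq' (by linarith [ht.1]) ht.2
        nlinarith [Real.pi_pos]
    _ ≤ Real.exp Real.pi * ∫ t, Real.exp (-Real.pi * (T ^ 2)⁻¹ * t ^ 2) * ‖𝓕 h t‖ ^ 2 := by
        rw [intervalIntegral.integral_const_mul, intervalIntegral.integral_of_le (by linarith)]
        refine mul_le_mul_of_nonneg_left ?_ (Real.exp_pos _).le
        exact setIntegral_le_integral hgi (ae_of_all _ fun t => by positivity)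
    _ ≤ Real.exp Real.pi * (2 * ∫ v, ‖h v‖ ^ 2) := by gcongr
    _ = _ := by ring

/-! ### Second moments of zeta and `L(s, χ₄)` on vertical lines -/

lemma integrable_exp_neg_mul_abs {c : ℝ} (hc : 0 < c) :
    Integrable fun v : ℝ => Real.exp (-c * |v|) := by
  rw [← integrableOn_univ, ← Iic_union_Ioi (a := (0 : ℝ))]
  refine IntegrableOn.union ?_ ?_
  · refine (integrableOn_exp_mul_Iic hc 0).congr_fun (fun v (hv : v ≤ 0) => ?_) measurableSet_Iic
    simp only [abs_of_nonpos hv]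
    congr 1; ring
  · refine (integrableOn_exp_mul_Ioi (neg_lt_zero.2 hc) 0).congr_fun
      (fun v (hv : 0 < v) => ?_) measurableSet_Ioi
    simp only [abs_of_pos hv]

/-- Functions that behave like the remainder `⌊u⌋ - u`: they are bounded by `1` and by `u`, and they
vary no more than `⌊u⌋` and `u` do. -/
structure IsRemainder (R : ℝ → ℝ) : Prop where
  measurable : Measurable R
  le_one : ∀ u, 0 < u → |R u| ≤ 1
  le_self : ∀ u, 0 < u → |R u| ≤ u
  abs_sub_le : ∀ u v, 0 < u → u ≤ v → |R v - R u| ≤ ((⌊v⌋₊ : ℝ) - ⌊u⌋₊) + (v - u)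

lemma isRemainder_floorRemainder : IsRemainder floorRemainder where
  measurable := measurable_floorRemainder
  le_one u hu := abs_floorRemainder_le hu.le
  le_self u hu := by
    unfold floorRemainder
    have h1 := Nat.floor_le hu.le
    rw [abs_le]
    constructor <;> linarith [Nat.cast_nonneg (α := ℝ) ⌊u⌋₊]
  abs_sub_le u v hu huv := by
    unfold floorRemainder
    have h1 : (⌊u⌋₊ : ℝ) ≤ ⌊v⌋₊ := by exact_mod_cast Nat.floor_mono huv
    rw [abs_le]
    constructor <;> linarith

lemma isRemainder_chiSum : IsRemainder chiSum where
  measurable := measurable_chiSum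
  le_one u _ := abs_chiSum_le u
  le_self u hu := by
    rcases lt_or_ge u 1 with h | h
    · rw [chiSum, Nat.floor_eq_zero.2 h]
      simpa using hu.le
    · exact (abs_chiSum_le u).trans h
  abs_sub_le u v hu huv := by
    have hle : ⌊u⌋₊ ≤ ⌊v⌋₊ := Nat.floor_mono huv
    have h1 : (⌊u⌋₊ : ℝ) ≤ ⌊v⌋₊ := by exact_mod_cast hle
    rcases hle.eq_or_lt with h | h
    · rw [chiSum_eq, chiSum_eq, h, sub_self, abs_zero]
      linarith
    · have h2 : (⌊u⌋₊ : ℝ) + 1 ≤ ⌊v⌋₊ := by exact_mod_cast h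
      have h3 := abs_chiSum_le u
      have h4 := abs_chiSum_le v
      have h5 := chiSum_nonneg u
      have h6 := chiSum_nonneg v
      rw [abs_le] at h3 h4 ⊢
      constructor <;> linarith

section
variable {R : ℝ → ℝ} (hR : IsRemainder R)
include hR

lemma IsRemainder.integrableOn_Ioc {s : ℂ} (hs : s.re < 1) :
    IntegrableOn (fun u : ℝ => (R u : ℂ) * (u : ℂ) ^ (-(s + 1))) (Ioc 0 1) := by
  have h1 : IntegrableOn (fun u : ℝ => u ^ (-s.re)) (Ioc 0 1) :=
    (intervalIntegrable_iff_integrableOn_Ioc_of_le zero_le_one).1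
      (intervalIntegral.intervalIntegrable_rpow' (by linarith))
  refine h1.mono' ?_ ((ae_restrict_iff' measurableSet_Ioc).2 (ae_of_all _ fun u hu => ?_))
  · exact ((measurable_ofReal.comp hR.measurable).mul
      (Measurable.pow_const measurable_ofReal _)).aestronglyMeasurable
  · rw [norm_mul, norm_real, Real.norm_eq_abs, norm_cpow_eq_rpow_re_of_pos hu.1]
    calc |R u| * u ^ (-(s + 1)).re ≤ u ^ (1 : ℝ) * u ^ (-(s + 1)).re := by
          rw [Real.rpow_one]
          exact mul_le_mul_of_nonneg_right (hR.le_self u hu.1) (Real.rpow_nonneg hu.1.le _)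
      _ = u ^ (-s.re) := by
        rw [← Real.rpow_add hu.1]; congr 1; simp

lemma IsRemainder.integrableOn_Ioi {s : ℂ} (h0 : 0 < s.re) (h1 : s.re < 1) :
    IntegrableOn (fun u : ℝ => (R u : ℂ) * (u : ℂ) ^ (-(s + 1))) (Ioi 0) := by
  rw [← Ioc_union_Ioi_eq_Ioi (zero_le_one (α := ℝ))]
  exact (hR.integrableOn_Ioc h1).union
    (integrableOn_tail hR.measurable (fun u hu => hR.le_one u (by linarith)) h0)

lemma IsRemainder.mellinConvergent {s : ℂ} (h0 : 0 < s.re) (h1 : s.re < 1) :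
    MellinConvergent (fun u => (R u : ℂ)) (-s) := by
  refine (hR.integrableOn_Ioi h0 h1).congr_fun (fun u _ => ?_) measurableSet_Ioi
  simp only [smul_eq_mul]
  rw [mul_comm, neg_add']

lemma IsRemainder.mellin_eq {s : ℂ} (h0 : 0 < s.re) (h1 : s.re < 1) :
    mellin (fun u => (R u : ℂ)) (-s) =
      (∫ u in Ioc (0 : ℝ) 1, (R u : ℂ) * (u : ℂ) ^ (-(s + 1))) + tailIntegral R s := by
  rw [tailIntegral, ← setIntegral_union Ioc_disjoint_Ioi_same measurableSet_Ioi
    (hR.integrableOn_Ioc h1)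
    (integrableOn_tail hR.measurable (fun u hu => hR.le_one u (by linarith)) h0),
    Ioc_union_Ioi_eq_Ioi (zero_le_one (α := ℝ)), mellin]
  refine setIntegral_congr_fun measurableSet_Ioi fun u _ => ?_
  simp only [smul_eq_mul]
  rw [mul_comm, neg_add']

/-- A multiplicative shift of the remainder multiplies its Mellin transform by `e^{ηs} - 1`. -/
lemma IsRemainder.mellin_shift {s : ℂ} (h0 : 0 < s.re) (h1 : s.re < 1) (η : ℝ) :
    mellin (fun u => ((R (Real.exp η * u) - R u : ℝ) : ℂ)) (-s) =
      (cexp (η * s) - 1) * mellin (fun u => (R u : ℂ)) (-s) := by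
  have hc := hR.mellinConvergent h0 h1
  have hc' := (MellinConvergent.comp_mul_left (f := fun u => (R u : ℂ)) (s := -s)
    (Real.exp_pos η)).2 hc
  have h := (hasMellin_sub hc' hc).2
  have h2 := mellin_comp_mul_left (fun u => (R u : ℂ)) (-s) (Real.exp_pos η)
  have h3 : ((Real.exp η : ℝ) : ℂ) ^ s = cexp (η * s) := by
    rw [cpow_def_of_ne_zero (ofReal_ne_zero.2 (Real.exp_pos η).ne'), ← ofReal_log (Real.exp_pos η).le,
      Real.log_exp]
  rw [h2, neg_neg, h3, smul_eq_mul] at h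
  rw [sub_mul, one_mul, ← h]
  congr 1
  funext u
  push_cast
  rfl

/-- The squared increment of a remainder over a short multiplicative shift. -/
lemma IsRemainder.sq_increment_le {η u : ℝ} (hη : 0 < η) (hη1 : η ≤ 1) (hu : 0 < u) :
    (R (Real.exp η * u) - R u) ^ 2 ≤
      6 * ((⌊Real.exp η * u⌋₊ : ℝ) - ⌊u⌋₊) + 8 * min 1 (η * u) ^ 2 := by
  have he : Real.exp η - 1 ≤ 2 * η := by
    have := Real.abs_exp_sub_one_le (x := η) (by rwa [abs_of_pos hη])
    rw [abs_of_pos hη] at this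
    exact (le_abs_self _).trans this
  have he1 : 1 ≤ Real.exp η := Real.one_le_exp hη.le
  have huv : u ≤ Real.exp η * u := le_mul_of_one_le_left hu.le he1
  have hv0 : 0 < Real.exp η * u := by positivity
  have hF : (⌊u⌋₊ : ℝ) ≤ ⌊Real.exp η * u⌋₊ := by exact_mod_cast Nat.floor_mono huv
  have hd := hR.abs_sub_le u _ hu huv
  have hlen : Real.exp η * u - u ≤ 2 * (η * u) := by nlinarith
  set F := (⌊Real.exp η * u⌋₊ : ℝ) - ⌊u⌋₊ with hF_def
  have hF0 : 0 ≤ F := by linarith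
  rw [← sq_abs]
  rcases le_or_gt (η * u) 1 with h | h
  · rw [min_eq_right h]
    have h1 := Nat.floor_le hv0.le
    have h2 := Nat.lt_floor_add_one u
    have hF3 : F ≤ 3 := by linarith
    have h3 : |R (Real.exp η * u) - R u| ≤ F + 2 * (η * u) := by linarith
    calc |R (Real.exp η * u) - R u| ^ 2 ≤ (F + 2 * (η * u)) ^ 2 := by gcongr
      _ ≤ 2 * F ^ 2 + 8 * (η * u) ^ 2 := by nlinarith only [sq_nonneg (F - 2 * (η * u))]
      _ ≤ _ := by nlinarith only [hF0, hF3]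
  · rw [min_eq_left h.le]
    have h1 := hR.le_one u hu
    have h2 := hR.le_one _ hv0
    have h3 : |R (Real.exp η * u) - R u| ≤ 2 := (abs_sub _ _).trans (by linarith)
    nlinarith [abs_nonneg (R (Real.exp η * u) - R u)]

lemma IsRemainder.abs_increment_le {η u : ℝ} (hη1 : η ≤ 1) (hu : 0 < u) :
    |R (Real.exp η * u) - R u| ≤ 4 * min 1 u := by
  have he : Real.exp η ≤ 3 :=
    (Real.exp_le_exp.2 hη1).trans Real.exp_one_lt_three.le
  have hv0 : 0 < Real.exp η * u := by positivity
  have h1 := hR.le_one u hu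
  have h2 := hR.le_one _ hv0
  have h3 := hR.le_self u hu
  have h4 := hR.le_self _ hv0
  have h5 : Real.exp η * u ≤ 3 * u := by gcongr
  refine (abs_sub _ _).trans ?_
  rcases min_cases 1 u with ⟨h, -⟩ | ⟨h, -⟩ <;> rw [h] <;> linarith
end

/-- The increment of a remainder over the shift `η`, in the logarithmic variable and with the weight
`e^{σv}`; its Fourier transform is the Mellin transform of the increment on `Re s = -σ`. -/
noncomputable def logIncrement (R : ℝ → ℝ) (σ η v : ℝ) : ℂ :=
  Real.exp (σ * v) • ((R (Real.exp η * Real.exp (-v)) - R (Real.exp (-v)) : ℝ) : ℂ)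

lemma norm_logIncrement (R : ℝ → ℝ) (σ η v : ℝ) : ‖logIncrement R σ η v‖ =
    Real.exp (σ * v) * |R (Real.exp η * Real.exp (-v)) - R (Real.exp (-v))| := by
  rw [logIncrement, norm_smul, norm_real, Real.norm_of_nonneg (Real.exp_pos _).le, Real.norm_eq_abs]

lemma mellin_eq_fourier_logIncrement (R : ℝ → ℝ) (σ η t : ℝ) :
    mellin (fun u => ((R (Real.exp η * u) - R u : ℝ) : ℂ)) (-(σ + t * I)) =
      𝓕 (logIncrement R σ η) ((-1 / (2 * Real.pi)) * t) := by
  rw [mellin_eq_fourier]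
  have h1 : (-(σ + t * I : ℂ)).im / (2 * Real.pi) = (-1 / (2 * Real.pi)) * t := by
    simp; ring
  have h2 : -(-(σ + t * I : ℂ)).re = σ := by simp
  rw [h1, h2]
  rfl

/-- The weighted floor function `⌊e^{-v}⌋ e^{2σv}`. -/
noncomputable def logFloor (σ v : ℝ) : ℝ := ⌊Real.exp (-v)⌋₊ * Real.exp (2 * σ * v)

lemma integrable_logFloor {σ : ℝ} (hσ : 1 / 2 < σ) : Integrable (logFloor σ) := by
  refine (integrable_exp_neg_mul_abs (c := 2 * σ - 1) (by linarith)).mono' ?_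
    (ae_of_all _ fun v => ?_)
  · refine Measurable.aestronglyMeasurable ?_
    unfold logFloor
    fun_prop
  · rw [logFloor, Real.norm_of_nonneg (by positivity)]
    rcases lt_or_ge 0 v with hv | hv
    · rw [Nat.floor_eq_zero.2 (show Real.exp (-v) < 1 by
        rw [← Real.exp_zero]; exact Real.exp_lt_exp.2 (by linarith))]
      simp [(Real.exp_pos _).le]
    · calc _ ≤ Real.exp (-v) * Real.exp (2 * σ * v) := by
            gcongr
            exact Nat.floor_le (Real.exp_pos _).le
        _ = _ := by
          rw [← Real.exp_add, abs_of_nonpos hv]; congr 1; ring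

section
variable {R : ℝ → ℝ} (hR : IsRemainder R)
include hR

lemma IsRemainder.norm_logIncrement_le {σ η : ℝ} (hσ : 1 / 2 < σ) (hη1 : η ≤ 1) (v : ℝ) : ‖logIncrement R σ η v‖ ≤ 4 * Real.exp (-(1 - σ) * |v|) := by
  rw [norm_logIncrement]
  have h1 := hR.abs_increment_le hη1 (Real.exp_pos (-v))
  have h2 : Real.exp (σ * v) * min 1 (Real.exp (-v)) ≤ Real.exp (-(1 - σ) * |v|) := by
    rcases le_total 0 v with hv | hv
    · calc _ ≤ Real.exp (σ * v) * Real.exp (-v) := by gcongr; exact min_le_right _ _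
        _ = _ := by rw [← Real.exp_add, abs_of_nonneg hv]; congr 1; ring
    · calc _ ≤ Real.exp (σ * v) * 1 := by gcongr; exact min_le_left _ _
        _ ≤ _ := by
          rw [mul_one, abs_of_nonpos hv]
          exact Real.exp_le_exp.2 (by nlinarith)
  calc _ ≤ Real.exp (σ * v) * (4 * min 1 (Real.exp (-v))) := by gcongr
    _ = 4 * (Real.exp (σ * v) * min 1 (Real.exp (-v))) := by ring
    _ ≤ _ := by gcongr

lemma IsRemainder.aestronglyMeasurable_logIncrement (σ η : ℝ) :
    AEStronglyMeasurable (logIncrement R σ η) := by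
  have := hR.measurable
  refine Measurable.aestronglyMeasurable ?_
  unfold logIncrement
  fun_prop

lemma IsRemainder.integrable_logIncrement {σ η : ℝ} (hσ : 1 / 2 < σ) (hσ1 : σ < 1)
    (hη1 : η ≤ 1) : Integrable (logIncrement R σ η) :=
  ((integrable_exp_neg_mul_abs (c := 1 - σ) (by linarith)).const_mul 4).mono'
    (hR.aestronglyMeasurable_logIncrement σ η)
    (ae_of_all _ (hR.norm_logIncrement_le hσ hη1))

lemma IsRemainder.integrable_logIncrement_sq {σ η : ℝ} (hσ : 1 / 2 < σ) (hσ1 : σ < 1)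
    (hη1 : η ≤ 1) : Integrable fun v => ‖logIncrement R σ η v‖ ^ 2 := by
  refine ((integrable_exp_neg_mul_abs (c := 2 * (1 - σ)) (by linarith)).const_mul 16).mono'
    ((hR.aestronglyMeasurable_logIncrement σ η).norm.pow 2) (ae_of_all _ fun v => ?_)
  rw [Real.norm_of_nonneg (by positivity)]
  calc _ ≤ (4 * Real.exp (-(1 - σ) * |v|)) ^ 2 := by
        gcongr
        exact hR.norm_logIncrement_le hσ hη1 v
    _ = _ := by
      rw [mul_pow, ← Real.exp_nat_mul]
      ring_nf

lemma IsRemainder.norm_logIncrement_sq_le {σ η : ℝ} (hσ : 1 / 2 < σ) (hη : 0 < η)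
    (hη1 : η ≤ 1) (v : ℝ) : ‖logIncrement R σ η v‖ ^ 2 ≤
      6 * (Real.exp (2 * σ * η) * logFloor σ (v - η) - logFloor σ v) +
      8 * (η ^ (2 * σ) * Real.exp (-(2 * (1 - σ)) * |v - Real.log η|)) := by
  have h1 := hR.sq_increment_le hη hη1 (Real.exp_pos (-v))
  have h2 : Real.exp (2 * σ * v) * min 1 (η * Real.exp (-v)) ^ 2 ≤
      η ^ (2 * σ) * Real.exp (-(2 * (1 - σ)) * |v - Real.log η|) := by
    rw [Real.rpow_def_of_pos hη, ← Real.exp_add]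
    have h3 : η * Real.exp (-v) = Real.exp (Real.log η - v) := by
      rw [sub_eq_add_neg, Real.exp_add, Real.exp_log hη]
    rcases le_total 0 (v - Real.log η) with hv | hv
    · calc _ ≤ Real.exp (2 * σ * v) * (η * Real.exp (-v)) ^ 2 := by
            gcongr; exact min_le_right _ _
        _ = _ := by
          rw [h3, ← Real.exp_nat_mul, ← Real.exp_add, abs_of_nonneg hv]
          congr 1; push_cast; ring
    · calc _ ≤ Real.exp (2 * σ * v) * 1 ^ 2 := by
            gcongr; exact min_le_left _ _
        _ ≤ _ := by
          rw [one_pow, mul_one, abs_of_nonpos hv]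
          exact Real.exp_le_exp.2 (by nlinarith)
  have h4 : Real.exp (2 * σ * η) * logFloor σ (v - η) =
      Real.exp (2 * σ * v) * ⌊Real.exp η * Real.exp (-v)⌋₊ := by
    rw [logFloor, ← Real.exp_add, mul_left_comm, ← Real.exp_add, mul_comm]
    congr 2
    · ring
    · congr 2; ring
  rw [norm_logIncrement, mul_pow, sq_abs, ← Real.exp_nat_mul, h4, logFloor]
  have h5 : ((2 : ℕ) : ℝ) * (σ * v) = 2 * σ * v := by push_cast; ring
  rw [h5]
  calc _ ≤ Real.exp (2 * σ * v) * (6 * ((⌊Real.exp η * Real.exp (-v)⌋₊ : ℝ) - ⌊Real.exp (-v)⌋₊) +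
        8 * min 1 (η * Real.exp (-v)) ^ 2) := by gcongr
    _ = 6 * (Real.exp (2 * σ * v) * ⌊Real.exp η * Real.exp (-v)⌋₊ -
        ⌊Real.exp (-v)⌋₊ * Real.exp (2 * σ * v)) +
        8 * (Real.exp (2 * σ * v) * min 1 (η * Real.exp (-v)) ^ 2) := by ring
    _ ≤ _ := by gcongr

/-- The mean square of the increment is of the order of the shift: the integral of
`⌊e^{η-v}⌋ - ⌊e^{-v}⌋` telescopes by translation invariance. -/
lemma IsRemainder.exists_integral_logIncrement_sq_le {σ : ℝ} (hσ : 1 / 2 < σ) (hσ1 : σ < 1) :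
    ∃ C : ℝ, 0 < C ∧ ∀ η : ℝ, 0 < η → η ≤ 1 / 2 →
      ∫ v, ‖logIncrement R σ η v‖ ^ 2 ≤ C * η := by
  set IB := ∫ v, logFloor σ v with hIB
  set E := ∫ v, Real.exp (-(2 * (1 - σ)) * |v|) with hE
  have hIB0 : 0 ≤ IB := integral_nonneg fun v => by unfold logFloor; positivity
  have hE0 : 0 ≤ E := integral_nonneg fun v => by positivity
  refine ⟨24 * IB + 8 * E + 1, by positivity, fun η hη hη2 => ?_⟩
  have hη1 : η ≤ 1 := by linarith
  have hB := integrable_logFloor hσ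
  have hEi := integrable_exp_neg_mul_abs (c := 2 * (1 - σ)) (by linarith)
  have hi1 : Integrable fun v => 6 * (Real.exp (2 * σ * η) * logFloor σ (v - η) - logFloor σ v) :=
    (((hB.comp_sub_right η).const_mul _).sub hB).const_mul 6
  have hi2 : Integrable fun v =>
      8 * (η ^ (2 * σ) * Real.exp (-(2 * (1 - σ)) * |v - Real.log η|)) :=
    ((hEi.comp_sub_right (Real.log η)).const_mul _).const_mul 8
  have h1 := integral_mono (hR.integrable_logIncrement_sq hσ hσ1 hη1) (hi1.add hi2)
    (hR.norm_logIncrement_sq_le hσ hη hη1)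
  refine h1.trans ?_
  have h2 : ∫ v, (6 * (Real.exp (2 * σ * η) * logFloor σ (v - η) - logFloor σ v) +
      8 * (η ^ (2 * σ) * Real.exp (-(2 * (1 - σ)) * |v - Real.log η|))) =
      6 * ((Real.exp (2 * σ * η) - 1) * IB) + 8 * (η ^ (2 * σ) * E) := by
    rw [integral_add hi1 hi2, integral_const_mul, integral_const_mul, integral_const_mul,
      integral_sub ((hB.comp_sub_right η).const_mul _) hB, integral_const_mul,
      integral_sub_right_eq_self (logFloor σ),
      integral_sub_right_eq_self (fun v => Real.exp (-(2 * (1 - σ)) * |v|))]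
    ring
  have h3 : Real.exp (2 * σ * η) - 1 ≤ 4 * η := by
    have h4 : 0 ≤ 2 * σ * η := by positivity
    have := Real.abs_exp_sub_one_le (x := 2 * σ * η) (by
      rw [abs_of_nonneg h4]; nlinarith)
    rw [abs_of_nonneg h4] at this
    refine (le_abs_self _).trans (this.trans ?_)
    nlinarith
  have h5 : η ^ (2 * σ) ≤ η := by
    have := Real.rpow_le_rpow_of_exponent_ge hη hη1 (show 1 ≤ 2 * σ by linarith)
    rwa [Real.rpow_one] at this
  refine h2.le.trans ?_
  calc _ ≤ 6 * (4 * η * IB) + 8 * (η * E) := by gcongr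
    _ ≤ _ := by nlinarith

/-- The second moment of a Dirichlet series `s ∫ R(u) u^{-s-1} du` on a vertical line in
`1/2 < Re s < 1` is `O(T)`. -/
lemma IsRemainder.exists_second_moment_le {D : ℂ → ℂ} {σ : ℝ} (hσ : 1 / 2 < σ) (hσ1 : σ < 1)
    (hc : Continuous fun t : ℝ => D (σ + t * I))
    (hD : ∀ t : ℝ, D (σ + t * I) =
      (σ + t * I) * mellin (fun u => (R u : ℂ)) (-(σ + t * I))) :
    ∃ C : ℝ, 0 < C ∧ ∀ T : ℝ, 2 ≤ T → ∫ t in (-T)..T, ‖D (σ + t * I)‖ ^ 2 ≤ C * T := by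
  obtain ⟨C, hC, hCη⟩ := hR.exists_integral_logIncrement_sq_le hσ hσ1
  refine ⟨64 * (2 * Real.pi) * (2 * Real.exp Real.pi) * C, by positivity, fun T hT => ?_⟩
  have hT0 : 0 < T := by linarith
  -- with this shift `|η s| ≤ 1/2` for `|Im s| ≤ T`, so that `|e^{ηs} - 1|` is comparable to `η |s|`
  set η := 1 / (4 * T) with hη_def
  have hη : 0 < η := by positivity
  have hη2 : η ≤ 1 / 2 := by
    rw [hη_def, div_le_div_iff₀ (by positivity) (by norm_num)]; linarith
  set h := logIncrement R σ η with hh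
  have hi := hR.integrable_logIncrement hσ hσ1 (by linarith)
  have hi2 := hR.integrable_logIncrement_sq hσ hσ1 (by linarith)
  have hpt : ∀ t ∈ Icc (-T) T, ‖D (σ + t * I)‖ ^ 2 ≤
      64 * T ^ 2 * ‖𝓕 h ((-1 / (2 * Real.pi)) * t)‖ ^ 2 := by
    intro t ht
    set s : ℂ := σ + t * I with hs
    have hre : s.re = σ := by simp [hs]
    have hs1 : ‖s‖ ≤ 2 * T := by
      have := norm_le_abs_re_add_abs_im s
      rw [hre, abs_of_pos (by linarith), show s.im = t by simp [hs]] at this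
      have := abs_le.2 ht
      linarith
    have hz : ‖(η : ℂ) * s‖ ≤ 1 / 2 := by
      rw [norm_mul, norm_real, Real.norm_of_nonneg hη.le]
      calc η * ‖s‖ ≤ η * (2 * T) := by gcongr
        _ = 1 / 2 := by rw [hη_def]; field_simp; norm_num
    have hexp : η / 2 * ‖s‖ ≤ ‖cexp (η * s) - 1‖ := by
      have h1 := Complex.norm_exp_sub_one_sub_id_le (x := (η : ℂ) * s) (by linarith)
      have h2 := norm_sub_norm_le ((η : ℂ) * s) (-(cexp (η * s) - 1 - η * s))
      have h3 : (η : ℂ) * s - -(cexp (η * s) - 1 - η * s) = cexp (η * s) - 1 := by ring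
      rw [h3, norm_neg] at h2
      have h4 : ‖(η : ℂ) * s‖ = η * ‖s‖ := by
        rw [norm_mul, norm_real, Real.norm_of_nonneg hη.le]
      rw [h4] at h1 h2 hz
      have h5 : (η * ‖s‖) ^ 2 ≤ 1 / 2 * (η * ‖s‖) := by
        rw [sq]; exact mul_le_mul_of_nonneg_right hz (by positivity)
      linarith
    have hm := hR.mellin_shift (s := s) (by rw [hre]; linarith) (by rw [hre]; exact hσ1) η
    rw [hs, mellin_eq_fourier_logIncrement, ← hs, ← hh] at hm
    have h5 : ‖D s‖ ≤ 8 * T * ‖𝓕 h ((-1 / (2 * Real.pi)) * t)‖ := by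
      rw [hm, norm_mul, hs, hD t, ← hs, norm_mul]
      have h6 : 8 * T * (η / 2) = 1 := by rw [hη_def]; field_simp; norm_num
      calc _ = 8 * T * ((η / 2 * ‖s‖) * ‖mellin (fun u => (R u : ℂ)) (-s)‖) := by
            linear_combination (-‖s‖ * ‖mellin (fun u => (R u : ℂ)) (-s)‖) * h6
        _ ≤ _ := by gcongr
    calc _ ≤ (8 * T * ‖𝓕 h ((-1 / (2 * Real.pi)) * t)‖) ^ 2 := by gcongr
      _ = _ := by ring
  have hFc : Continuous fun t : ℝ => ‖𝓕 h ((-1 / (2 * Real.pi)) * t)‖ ^ 2 :=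
    (((continuous_fourier hi).comp (by fun_prop)).norm.pow 2)
  have hpi := Real.pi_pos
  calc ∫ t in (-T)..T, ‖D (σ + t * I)‖ ^ 2
      ≤ ∫ t in (-T)..T, 64 * T ^ 2 * ‖𝓕 h ((-1 / (2 * Real.pi)) * t)‖ ^ 2 :=
        intervalIntegral.integral_mono_on (by linarith) ((hc.norm.pow 2).intervalIntegrable _ _)
          ((hFc.const_mul _).intervalIntegrable _ _) hpt
    _ = 64 * T ^ 2 * (2 * Real.pi *
        ∫ t in (-(T / (2 * Real.pi)))..(T / (2 * Real.pi)), ‖𝓕 h t‖ ^ 2) := by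
      rw [intervalIntegral.integral_const_mul,
        intervalIntegral.integral_comp_mul_left (fun t => ‖𝓕 h t‖ ^ 2)
          (by simp [hpi.ne'] : -1 / (2 * Real.pi) ≠ 0), intervalIntegral.integral_symm, smul_eq_mul]
      have e1 : -1 / (2 * Real.pi) * T = -(T / (2 * Real.pi)) := by ring
      have e2 : -1 / (2 * Real.pi) * -T = T / (2 * Real.pi) := by ring
      rw [e1, e2]
      field_simp
    _ ≤ 64 * T ^ 2 * (2 * Real.pi * (2 * Real.exp Real.pi * (C * η))) := by
      gcongr
      refine (integral_norm_fourier_sq_le hi hi2 (by positivity)).trans ?_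
      gcongr
      exact hCη η hη hη2
    _ = 64 * (2 * Real.pi) * (2 * Real.exp Real.pi) * C * T / 4 := by
      rw [hη_def]; field_simp
    _ ≤ _ := by
      have : 0 < 64 * (2 * Real.pi) * (2 * Real.exp Real.pi) * C * T := by positivity
      linarith
end

/-- The second moment of `L(s, χ₄)`. -/
lemma exists_second_moment_LFunction_le {σ : ℝ} (hσ : 1 / 2 < σ) (hσ1 : σ < 1) :
    ∃ C : ℝ, 0 < C ∧ ∀ T : ℝ, 2 ≤ T →
      ∫ t in (-T)..T, ‖chi4.LFunction (σ + t * I)‖ ^ 2 ≤ C * T := by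
  refine isRemainder_chiSum.exists_second_moment_le hσ hσ1
    (differentiable_LFunction_chi4.continuous.comp (by fun_prop)) fun t => ?_
  have hre : (σ + t * I : ℂ).re = σ := by simp
  rw [LFunction_eq_tail (by rw [hre]; linarith), isRemainder_chiSum.mellin_eq
    (by rw [hre]; linarith) (by rw [hre]; exact hσ1)]
  have h1 : ∫ u in Ioc (0 : ℝ) 1, (chiSum u : ℂ) * (u : ℂ) ^ (-((σ + t * I : ℂ) + 1)) = 0 := by
    rw [integral_Ioc_eq_integral_Ioo]
    refine setIntegral_eq_zero_of_forall_eq_zero fun u hu => ?_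
    rw [chiSum, Nat.floor_eq_zero.2 hu.2]
    simp
  rw [h1, zero_add]

/-- The second moment of the zeta function. -/
lemma exists_second_moment_zeta_le {σ : ℝ} (hσ : 1 / 2 < σ) (hσ1 : σ < 1) :
    ∃ C : ℝ, 0 < C ∧ ∀ T : ℝ, 2 ≤ T →
      ∫ t in (-T)..T, ‖zetaReg (σ + t * I) / (σ + t * I - 1)‖ ^ 2 ≤ C * T := by
  have hne : ∀ t : ℝ, (σ + t * I - 1 : ℂ) ≠ 0 := fun t h => by
    have := congrArg re h
    simp at this; linarith
  refine isRemainder_floorRemainder.exists_second_moment_le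
    (D := fun s => zetaReg s / (s - 1)) hσ hσ1
    ((differentiable_zetaReg.continuous.comp (by fun_prop)).div (by fun_prop) hne) fun t => ?_
  have hre : (σ + t * I : ℂ).re = σ := by simp
  rw [zetaReg_eq_tail (by rw [hre]; linarith), isRemainder_floorRemainder.mellin_eq
    (by rw [hre]; linarith) (by rw [hre]; exact hσ1)]
  have h1 : ∫ u in Ioc (0 : ℝ) 1, (floorRemainder u : ℂ) * (u : ℂ) ^ (-((σ + t * I : ℂ) + 1)) =
      1 / (σ + t * I - 1) := by
    have h2 : ∫ u in Ioc (0 : ℝ) 1, (floorRemainder u : ℂ) * (u : ℂ) ^ (-((σ + t * I : ℂ) + 1)) =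
        ∫ u in Ioc (0 : ℝ) 1, -(u : ℂ) ^ (-(σ + t * I : ℂ)) := by
      rw [integral_Ioc_eq_integral_Ioo, integral_Ioc_eq_integral_Ioo]
      refine setIntegral_congr_fun measurableSet_Ioo fun u hu => ?_
      have hu0 : (u : ℂ) ≠ 0 := ofReal_ne_zero.2 hu.1.ne'
      simp only [floorRemainder, Nat.floor_eq_zero.2 hu.2]
      rw [neg_add, cpow_add _ _ hu0, cpow_neg_one]
      push_cast
      field_simp
      ring
    rw [h2, ← intervalIntegral.integral_of_le zero_le_one, intervalIntegral.integral_neg,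
      integral_cpow (Or.inl (by simp; linarith))]
    have h3 : -(σ + t * I : ℂ) + 1 ≠ 0 := fun h => hne t (by linear_combination -h)
    rw [ofReal_one, one_cpow, ofReal_zero, zero_cpow h3]
    have h4 : -(σ + t * I : ℂ) + 1 = -(σ + t * I - 1) := by ring
    rw [h4]
    field_simp [hne t]
    ring
  rw [h1]
  have := hne t
  field_simp

/-! ### The error term under the Riemann hypotheses -/

lemma zetaL_ne_zero_of_RH (hζ : RiemannHypothesis) (hL : RiemannHypothesisChi4) {s : ℂ}
    (hs : 1 / 2 < s.re) : zetaL s ≠ 0 := by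
  rcases le_or_gt 1 s.re with h1 | h1
  · exact zetaL_ne_zero_of_one_le_re h1
  · have hs1 : s ≠ 1 := by rintro rfl; simp at h1
    refine mul_ne_zero (fun h => ?_) (fun h => ?_)
    · rw [zetaReg_of_ne hs1] at h
      have h2 : riemannZeta s = 0 := (mul_eq_zero.1 h).resolve_right (sub_ne_zero.2 hs1)
      have h3 := hζ s h2 (by
        rintro ⟨n, rfl⟩
        have : (0 : ℝ) ≤ n := Nat.cast_nonneg n
        simp at hs
        linarith) hs1
      linarith
    · have h3 := hL s h (by linarith) h1
      linarith

/-- If the mean of `q` over `[-T, T]` is bounded, then `∫ q / (1 + |t|)` grows at most by a constant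
over each dyadic range. -/
lemma integral_dyadic_le {q p : ℝ → ℝ} {K : ℝ} (hq : Continuous q) (hp : Continuous p)
    (hq0 : ∀ t, 0 ≤ q t) (hp2 : ∀ t, p t ≤ 2 * q t) (hpt : ∀ t, |t| * p t ≤ q t)
    (hK : ∀ T, 2 ≤ T → ∫ t in (-T)..T, q t ≤ K * T) (n : ℕ) :
    ∫ t in (-(2 : ℝ) ^ (n + 1))..2 ^ (n + 1), p t ≤ 4 * K * (n + 1) := by
  have hK0 : 0 ≤ K := by
    have h1 := hK 2 le_rfl
    have h2 : 0 ≤ ∫ t in (-2 : ℝ)..2, q t :=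
      intervalIntegral.integral_nonneg (by norm_num) fun t _ => hq0 t
    linarith
  have hqi : ∀ a b, IntervalIntegrable q volume a b := fun a b => hq.intervalIntegrable a b
  have hpi : ∀ a b, IntervalIntegrable p volume a b := fun a b => hp.intervalIntegrable a b
  induction n with
  | zero =>
    have h1 : ∫ t in (-2 : ℝ)..2, p t ≤ ∫ t in (-2 : ℝ)..2, 2 * q t :=
      intervalIntegral.integral_mono_on (by norm_num) (hpi _ _) ((hqi _ _).const_mul 2)
        fun t _ => hp2 t
    rw [intervalIntegral.integral_const_mul] at h1
    have h2 := hK 2 le_rfl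
    simp only [zero_add, pow_one, Nat.cast_zero]
    linarith
  | succ n ih =>
    set U : ℝ := 2 ^ (n + 1) with hU
    have hU2 : 2 ≤ U := by
      rw [hU, pow_succ]
      have : (1 : ℝ) ≤ 2 ^ n := one_le_pow₀ (by norm_num)
      linarith
    have hU0 : 0 < U := by linarith
    have h2U : (2 : ℝ) ^ (n + 1 + 1) = 2 * U := by rw [hU, pow_succ _ (n + 1)]; ring
    rw [h2U]
    have hpiece : ∀ a b, a ≤ b → (∀ t ∈ Icc a b, U ≤ |t|) →
        ∫ t in a..b, p t ≤ U⁻¹ * ∫ t in a..b, q t := fun a b hab h => by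
      rw [← intervalIntegral.integral_const_mul]
      refine intervalIntegral.integral_mono_on hab (hpi _ _) ((hqi _ _).const_mul _) fun t ht => ?_
      rw [inv_mul_eq_div, le_div_iff₀ hU0]
      rcases le_total 0 (p t) with h0 | h0
      · calc p t * U ≤ p t * |t| := by gcongr; exact h t ht
          _ ≤ _ := by rw [mul_comm]; exact hpt t
      · exact (mul_nonpos_of_nonpos_of_nonneg h0 hU0.le).trans (hq0 t)
    have h1 := hpiece U (2 * U) (by linarith) fun t ht => ht.1.trans (le_abs_self t)
    have h2 := hpiece (-(2 * U)) (-U) (by linarith) fun t ht => by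
      rw [abs_of_nonpos (by linarith [ht.2])]; linarith [ht.2]
    have h3 : ∫ t in (-(2 * U))..(2 * U), p t = (∫ t in (-(2 * U))..(-U), p t) +
        (∫ t in (-U)..U, p t) + ∫ t in U..(2 * U), p t := by
      rw [intervalIntegral.integral_add_adjacent_intervals (hpi _ _) (hpi _ _),
        intervalIntegral.integral_add_adjacent_intervals (hpi _ _) (hpi _ _)]
    have h4 : ∫ t in (-(2 * U))..(2 * U), q t = (∫ t in (-(2 * U))..(-U), q t) +
        (∫ t in (-U)..U, q t) + ∫ t in U..(2 * U), q t := by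
      rw [intervalIntegral.integral_add_adjacent_intervals (hqi _ _) (hqi _ _),
        intervalIntegral.integral_add_adjacent_intervals (hqi _ _) (hqi _ _)]
    have h5 : 0 ≤ ∫ t in (-U)..U, q t :=
      intervalIntegral.integral_nonneg (by linarith) fun t _ => hq0 t
    have h6 := hK (2 * U) (by linarith)
    have h7 : U⁻¹ * ((∫ t in (-(2 * U))..(-U), q t) + ∫ t in U..(2 * U), q t) ≤ 2 * K := by
      rw [inv_mul_eq_div, div_le_iff₀ hU0]
      linarith
    rw [mul_add] at h7
    rw [h3]
    push_cast
    linarith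

section
variable {A B : ℂ → ℂ} (hA : IsSqrtBranch zetaReg A) (hB : IsSqrtBranch chi4.LFunction B)
include hA hB

/-- Under the Riemann hypotheses the mean of `|G(s)| |s - 1|^{-1/2} / |s|` on a vertical line to the
right of `1/2` grows logarithmically: `|G(s)|² / |s - 1|` is bounded by a product of zeta and `L`,
whose second moments are known. -/
lemma exists_integral_G_le {σ : ℝ} (hσ : 1 / 2 < σ) (hσ1 : σ < 1)
    (hz : ∀ s : ℂ, 1 / 2 < s.re → zetaL s ≠ 0) : ∃ K : ℝ, 0 < K ∧ ∀ n : ℕ,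
    ∫ t in (-(2 : ℝ) ^ (n + 1))..2 ^ (n + 1), ‖G A B (σ + t * I)‖ *
      ‖(σ + t * I - 1 : ℂ)‖ ^ (-(1 / 2) : ℝ) / ‖(σ + t * I : ℂ)‖ ≤ K * (n + 1) := by
  obtain ⟨C₀, hC₀, hG⟩ := exists_norm_G_sq_le hA hB (δ := σ - 1 / 2) (by linarith)
  obtain ⟨C₁, hC₁, h1⟩ := exists_second_moment_zeta_le hσ hσ1
  obtain ⟨C₂, hC₂, h2⟩ := exists_second_moment_LFunction_le hσ hσ1
  have hre : ∀ t : ℝ, (σ + t * I : ℂ).re = σ := fun t => by simp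
  have him : ∀ t : ℝ, (σ + t * I : ℂ).im = t := fun t => by simp
  have hne1 : ∀ t : ℝ, (σ + t * I - 1 : ℂ) ≠ 0 := fun t h => by
    have := congrArg re h
    simp at this; linarith
  have hne0 : ∀ t : ℝ, (σ + t * I : ℂ) ≠ 0 := fun t h => by
    have := congrArg re h
    simp at this; linarith
  have hmem : ∀ t : ℝ, (σ + t * I : ℂ) ∈ domG := fun t =>
    mem_domG_of_zetaL_ne_zero (by rw [hre]; exact hσ) fun u hu => hz _ (by simp; linarith)
  set D₁ : ℝ → ℝ := fun t => ‖zetaReg (σ + t * I) / (σ + t * I - 1)‖ with hD₁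
  set D₂ : ℝ → ℝ := fun t => ‖chi4.LFunction (σ + t * I)‖ with hD₂
  have hD₁c : Continuous D₁ :=
    ((differentiable_zetaReg.continuous.comp (by fun_prop)).div (by fun_prop) hne1).norm
  have hD₂c : Continuous D₂ :=
    (differentiable_LFunction_chi4.continuous.comp (by fun_prop)).norm
  set q : ℝ → ℝ := fun t => (1 + C₀) * (D₁ t ^ 2 + D₂ t ^ 2 + 1) with hq
  have hqc : Continuous q := by fun_prop
  have hGc : Continuous fun t : ℝ => ‖G A B (σ + t * I)‖ :=
    continuous_iff_continuousAt.2 fun t => (ContinuousAt.comp (g := G A B)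
      (f := fun t : ℝ => (σ + t * I : ℂ)) (analyticOnNhd_G hA hB _ (hmem t)).continuousAt
      (by fun_prop)).norm
  have hrc : Continuous fun t : ℝ => ‖(σ + t * I - 1 : ℂ)‖ ^ (-(1 / 2) : ℝ) :=
    Continuous.rpow_const (by fun_prop) fun t => Or.inl (norm_ne_zero_iff.2 (hne1 t))
  have hy : ∀ t : ℝ, ‖G A B (σ + t * I)‖ * ‖(σ + t * I - 1 : ℂ)‖ ^ (-(1 / 2) : ℝ) ≤ q t := by
    intro t
    have hq1 : 0 ≤ D₁ t ^ 2 + D₂ t ^ 2 := by positivity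
    refine le_of_sq_le_sq ?_ (by positivity)
    have h3 := hG _ (hmem t) (by rw [hre]; linarith)
    have h4 : (‖(σ + t * I - 1 : ℂ)‖ ^ (-(1 / 2) : ℝ)) ^ 2 = ‖(σ + t * I - 1 : ℂ)‖⁻¹ := by
      rw [← Real.rpow_natCast, ← Real.rpow_mul (norm_nonneg _)]
      norm_num [Real.rpow_neg_one]
    rw [mul_pow, h4]
    calc _ ≤ C₀ * (‖zetaReg (σ + t * I)‖ * ‖chi4.LFunction (σ + t * I)‖) *
          ‖(σ + t * I - 1 : ℂ)‖⁻¹ := by gcongr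
      _ = C₀ * (D₁ t * D₂ t) := by simp only [hD₁, hD₂, norm_div]; ring
      _ ≤ C₀ * (D₁ t ^ 2 + D₂ t ^ 2 + 1) := by
        gcongr
        nlinarith [sq_nonneg (D₁ t - D₂ t), sq_nonneg (D₁ t + D₂ t)]
      _ ≤ (1 + C₀) ^ 2 * (D₁ t ^ 2 + D₂ t ^ 2 + 1) ^ 2 := by
        refine mul_le_mul ?_ ?_ (by positivity) (by positivity)
        · nlinarith only [hC₀]
        · nlinarith only [hq1]
      _ = q t ^ 2 := by simp only [hq]; ring
  have hK : ∀ T, 2 ≤ T → ∫ t in (-T)..T, q t ≤ (1 + C₀) * (C₁ + C₂ + 2) * T := by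
    intro T hT
    have i1 : IntervalIntegrable (fun t => D₁ t ^ 2) volume (-T) T :=
      (hD₁c.pow 2).intervalIntegrable _ _
    have i2 : IntervalIntegrable (fun t => D₂ t ^ 2) volume (-T) T :=
      (hD₂c.pow 2).intervalIntegrable _ _
    simp only [hq]
    rw [intervalIntegral.integral_const_mul, intervalIntegral.integral_add (i1.add i2)
      intervalIntegrable_const, intervalIntegral.integral_add i1 i2,
      intervalIntegral.integral_const, smul_eq_mul, mul_assoc]
    have h3 := h1 T hT
    have h4 := h2 T hT
    gcongr
    linarith
  refine ⟨4 * ((1 + C₀) * (C₁ + C₂ + 2)), by positivity, fun n => ?_⟩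
  have hpc : Continuous fun t : ℝ => ‖G A B (σ + t * I)‖ *
      ‖(σ + t * I - 1 : ℂ)‖ ^ (-(1 / 2) : ℝ) / ‖(σ + t * I : ℂ)‖ :=
    (hGc.mul hrc).div (by fun_prop) fun t => norm_ne_zero_iff.2 (hne0 t)
  refine integral_dyadic_le hqc hpc (fun t => by positivity) (fun t => ?_) (fun t => ?_) hK n
  · have h3 : 1 / 2 ≤ ‖(σ + t * I : ℂ)‖ := by
      have := (le_abs_self _).trans (abs_re_le_norm (σ + t * I : ℂ))
      rw [hre] at this
      linarith
    rw [div_le_iff₀ (norm_pos_iff.2 (hne0 t))]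
    have := hy t
    have hq0 : 0 ≤ q t := by positivity
    nlinarith
  · have h3 : |t| ≤ ‖(σ + t * I : ℂ)‖ := by
      have := abs_im_le_norm (σ + t * I : ℂ)
      rwa [him] at this
    rw [mul_div_assoc', div_le_iff₀ (norm_pos_iff.2 (hne0 t)), mul_comm (q t)]
    exact mul_le_mul h3 (hy t) (by positivity) (norm_nonneg _)

set_option maxHeartbeats 1000000 in
/-- The error term under the Riemann hypotheses. -/
theorem count_sub_mainTerm_isBigO_of_RH (hζ : RiemannHypothesis) (hL : RiemannHypothesisChi4)
    {ε : ℝ} (hε : 0 < ε) (hε2 : ε < 1 / 2) :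
    (fun x : ℝ => (countTwoSquares x : ℂ) - mainTerm (G A B) ε x)
      =O[atTop] fun x : ℝ => x ^ (1 / 2 + ε) := by
  have hz : ∀ s : ℂ, 1 / 2 < s.re → zetaL s ≠ 0 := fun s hs => zetaL_ne_zero_of_RH hζ hL hs
  set σ₀ := 1 / 2 + ε / 2 with hσ₀
  obtain ⟨C₁, hC₁, hcore⟩ := exists_norm_count_sub_le hA hB (half_pos hε)
  obtain ⟨C₂, hC₂, hmain⟩ := exists_norm_main_sub_le hA hB (half_pos hε)
  obtain ⟨K, hK, hW⟩ := exists_integral_G_le hA hB (σ := σ₀) (by linarith) (by linarith) hz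
  refine IsBigO.of_bound (C₁ * (1 + 1 + 2 / ε + K * (8 / ε)) + C₂) ?_
  filter_upwards [eventually_ge_atTop (Real.exp 1)] with x hx
  have hx0 : 0 < x := (Real.exp_pos 1).trans_le hx
  have hx1 : 1 ≤ x := (Real.one_le_exp zero_le_one).trans hx
  have hlog1 : 1 ≤ Real.log x := (Real.le_log_iff_exp_le hx0).2 hx
  have hlog : Real.log x ≤ 2 / ε * x ^ (ε / 2) := by
    have := Real.log_le_rpow_div hx0.le (half_pos hε)
    calc _ ≤ _ := this
      _ = _ := by field_simp
  -- the height is a power of two exceeding `x ^ 2`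
  obtain ⟨n, hn1, hn2⟩ : ∃ n : ℕ, 3 * Real.log x ≤ (n : ℝ) + 1 ∧ (n : ℝ) + 1 ≤ 4 * Real.log x := by
    have h1 := Nat.floor_le (show 0 ≤ 3 * Real.log x by linarith)
    have h2 := Nat.lt_floor_add_one (3 * Real.log x)
    exact ⟨⌊3 * Real.log x⌋₊, h2.le, by linarith⟩
  set T : ℝ := 2 ^ (n + 1) with hT
  have hT2 : 2 ≤ T := by
    rw [hT, pow_succ]
    have : (1 : ℝ) ≤ 2 ^ n := one_le_pow₀ (by norm_num)
    linarith
  have hTx : x ^ 2 ≤ T := by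
    have h1 : T = Real.exp (((n : ℝ) + 1) * Real.log 2) := by
      rw [hT, mul_comm, Real.exp_mul, Real.exp_log two_pos]
      norm_cast
    have h2 : x ^ 2 = Real.exp (2 * Real.log x) := by
      rw [mul_comm, Real.exp_mul, Real.exp_log hx0]; norm_num
    rw [h1, h2]
    refine Real.exp_le_exp.2 ?_
    have h3 := Real.log_two_gt_d9
    nlinarith
  have hsq : 1 ≤ x ^ (1 / 2 : ℝ) := Real.one_le_rpow hx1 (by norm_num)
  have hsqx : x ^ (1 / 2 : ℝ) ≤ x := by
    simpa using Real.rpow_le_rpow_of_exponent_le hx1 (show (1 / 2 : ℝ) ≤ 1 by norm_num)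
  -- the smoothing length `h = x ^ (1/2)` is within the error term
  have h1 := hcore x σ₀ T (x ^ (1 / 2 : ℝ)) hx le_rfl (by linarith) hT2 (by positivity) hsqx
    (fun s hs _ => hz s (by linarith))
  have h2 := hmain x σ₀ (1 / 2 + ε) hx1 le_rfl (by linarith) (by linarith)
  have h3 := hW n
  rw [← hT] at h3
  set X := x ^ (1 / 2 + ε) with hX
  have hX1 : x ^ (1 / 2 : ℝ) ≤ X := Real.rpow_le_rpow_of_exponent_le hx1 (by linarith)
  have hXε : x ^ (ε / 2) ≤ X := Real.rpow_le_rpow_of_exponent_le hx1 (by linarith)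
  have hXmul : x ^ σ₀ * x ^ (ε / 2) = X := by
    rw [← Real.rpow_add hx0, hX, hσ₀]; congr 1; ring
  have h4 : x ^ 2 * Real.log x / (x ^ (1 / 2 : ℝ) * T) ≤ 2 / ε * X := by
    calc x ^ 2 * Real.log x / (x ^ (1 / 2 : ℝ) * T) ≤ T * Real.log x / (1 * T) := by gcongr
      _ = Real.log x := by field_simp
      _ ≤ 2 / ε * x ^ (ε / 2) := hlog
      _ ≤ _ := by gcongr
  have h5 : x ^ σ₀ * (K * (n + 1)) ≤ K * (8 / ε) * X := by
    calc x ^ σ₀ * (K * (n + 1)) ≤ x ^ σ₀ * (K * (4 * (2 / ε * x ^ (ε / 2)))) := by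
          gcongr
          linarith
      _ = K * (8 / ε) * (x ^ σ₀ * x ^ (ε / 2)) := by ring
      _ = _ := by rw [hXmul]
  rw [Real.norm_of_nonneg (by positivity : 0 ≤ X)]
  have hsplit : (countTwoSquares x : ℂ) - mainTerm (G A B) ε x =
      ((countTwoSquares x : ℂ) - 1 / (Real.pi : ℂ) *
        ∫ σ in σ₀..1, G A B (σ : ℂ) * ((x ^ σ / (σ * |σ - 1| ^ (1 / 2 : ℝ)) : ℝ) : ℂ)) +
      (1 / (Real.pi : ℂ) *
        (∫ σ in σ₀..1, G A B (σ : ℂ) * ((x ^ σ / (σ * |σ - 1| ^ (1 / 2 : ℝ)) : ℝ) : ℂ)) -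
        mainTerm (G A B) ε x) := by ring
  rw [hsplit]
  calc _ ≤ _ := norm_add_le _ _
    _ ≤ C₁ * (X + X + 2 / ε * X + K * (8 / ε) * X) + C₂ * X := by
      refine add_le_add (h1.trans ?_) h2
      exact mul_le_mul_of_nonneg_left (add_le_add (add_le_add (add_le_add hX1 (hsq.trans hX1)) h4)
        ((mul_le_mul_of_nonneg_left h3 (by positivity)).trans h5)) hC₁.le
    _ = _ := by ring
end

end TwoSquares

theorem theorem2p1 :
    ∃ A B : ℂ → ℂ,
      TwoSquares.IsSqrtBranch TwoSquares.zetaReg A ∧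
      TwoSquares.IsSqrtBranch TwoSquares.chi4.LFunction B ∧
      AnalyticOnNhd ℂ (TwoSquares.G A B)
        (TwoSquares.cutHalfPlane TwoSquares.zetaReg ∩
          TwoSquares.cutHalfPlane TwoSquares.chi4.LFunction) ∧
      (∀ ε : ℝ, 0 < ε → ε < 1 / 2 → ∃ c : ℝ, 0 < c ∧
        (fun x : ℝ => (TwoSquares.countTwoSquares x : ℂ) -
            TwoSquares.mainTerm (TwoSquares.G A B) ε x)
          =O[atTop] (fun x : ℝ => x * Real.exp (-c * Real.sqrt (Real.log x)))) ∧
      (RiemannHypothesis → TwoSquares.RiemannHypothesisChi4 →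
        AnalyticOnNhd ℂ (TwoSquares.G A B) {s : ℂ | 1 / 2 < s.re} ∧
        ∀ ε : ℝ, 0 < ε → ε < 1 / 2 →
          (fun x : ℝ => (TwoSquares.countTwoSquares x : ℂ) -
              TwoSquares.mainTerm (TwoSquares.G A B) ε x)
            =O[atTop] (fun x : ℝ => x ^ (1 / 2 + ε))) := by
  obtain ⟨A, hA⟩ := TwoSquares.exists_isSqrtBranch TwoSquares.differentiable_zetaReg
    (fun _ => TwoSquares.zetaReg_ne_zero_of_one_le_re) (fun _ => TwoSquares.zetaReg_pos)
  obtain ⟨B, hB⟩ := TwoSquares.exists_isSqrtBranch TwoSquares.differentiable_LFunction_chi4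
    (fun _ => TwoSquares.LFunction_chi4_ne_zero_of_one_le_re)
    (fun _ => TwoSquares.LFunction_chi4_pos)
  have hG := TwoSquares.analyticOnNhd_G hA hB
  refine ⟨A, B, hA, hB, hG, fun ε hε hε2 => TwoSquares.count_sub_mainTerm_isBigO hA hB hε hε2,
    fun hζ hL => ⟨hG.mono fun s hs => ?_, fun ε hε hε2 =>
      TwoSquares.count_sub_mainTerm_isBigO_of_RH hA hB hζ hL hε hε2⟩⟩
  have hs' : 1 / 2 < s.re := hs
  exact TwoSquares.mem_domG_of_zetaL_ne_zero hs' fun t ht =>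
    TwoSquares.zetaL_ne_zero_of_RH hζ hL (by simp; linarith)
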